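/- Let $n,m\ge 0$ be integers, let $\mathcal K\subseteq\mathbf R^m$ be a cone with dual cone $\mathcal K^*=\{y: y^Tx\ge 0\ \forall x\in\mathcal K\}$, and let $A\in\mathbf R^{m\times n}$, $b\in\mathbf R^m$, $c\in\mathbf R^n$ be arbitrary. Put $k=n+m+1$, $$Q=\begin{bmatrix}0&A^T&c\\-A&0&b\\-c^T&-b^T&0\end{bmatrix}\in\mathbf R^{k\times k},\qquad \mathcal C=\mathbf R^n\times\mathcal K^*\times\mathbf R_+\subseteq\mathbf R^k,$$ let $P_{\mathcal C}$ be the Euclidean projection onto $\mathcal C$, and define $F:\mathbf R^{3k}\to\mathbf R^{3k}$ by $$F(\tilde u,u,v)=\bigl((I+Q)\tilde u-(u+v),\ u-P_{\mathcal C}(\tilde u-v),\ \tilde u-u\bigr).$$ For a locally Lipschitz map $G:\mathbf R^N\to\mathbf R^N$ let $\mathcal J(z)$ be Clarke's generalized Jacobian at $z$, i.e. the convex hull of all limits $\lim_i J(z_i)$ of Jacobians of $G$ at points of differentiability $z_i\to z$. Call $G$ semismooth if it is locally Lipschitz and, for all $z,d\in\mathbf R^N$, the limit $$\lim_{t\downarrow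 0,\ d'\to d,\ J\in\mathcal J(z+td')}J\,d'$$ exists; call $G$ strongly semismooth if it is semismooth and, for every $z$, $\|G(z+\delta)-G(z)-J\delta\|_2=O(\|\delta\|_2^2)$ as $\delta\to0$, uniformly over $J\in\mathcal J(z+\delta)$. Then $F$ is strongly semismooth in each of the following cases: 1. $\mathcal K$ is the nonnegative orthant of $\mathbf R^m$, $m\ge0$; 2. $\mathcal K$ is the second-order cone $\{(x,y)\in\mathbf R^{m-1}\times\mathbf R:\|x\|_2\le y\}$, $m\ge1$; 3. $\mathcal K$ is the cone of positive semidefinite matrices in the space of symmetric $d\times d$ matrices, $d\ge0$, where this space, with the trace inner product, is identified with $\mathbf R^{m}$, $m=d(d+1)/2$, by the isometry that lists the diagonal entries and $\sqrt2$ times the entries above the diagonal; the same holds if $\mathcal K\subseteq\mathbf R^{m}$, $m=d^2$, is the set of all full vectorizations $\mathrm{vec}(Z)$ of symmetric positive semidefinite $d\times d$ matrices $Z$. Moreover, $F$ is semismooth when $m=3$ and $\mathcal K$ is the exponential cone $$\{(x,y,z):y>0,\ z\ge y\exp(x/y)\}\cup\{(x,0,z):x\le0,\ z\ge0\}.$$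 -/

import Mathlib

open Filter Topology

noncomputable section

namespace NewtonADMM

section Semismooth

variable {E G : Type*} [NormedAddCommGroup E] [NormedSpace ℝ E]
  [NormedAddCommGroup G] [NormedSpace ℝ G]

/-- The limits of Jacobians `lim J(z_i)` along sequences of points of differentiability
`z_i → z`. -/
def limitingJacobian (F : E → G) (z : E) : Set (E →L[ℝ] G) :=
  {J | ∃ s : ℕ → E, (∀ i, DifferentiableAt ℝ F (s i)) ∧ Tendsto s atTop (𝓝 z) ∧
    Tendsto (fun i => fderiv ℝ F (s i)) atTop (𝓝 J)}

/-- Clarke's generalized Jacobian: the convex hull of the limiting Jacobians. -/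
def genJacobian (F : E → G) (z : E) : Set (E →L[ℝ] G) :=
  convexHull ℝ (limitingJacobian F z)

/-- Semismoothness (Mifflin, Qi and Sun): `F` is locally Lipschitz and, for every point `z` and
every direction `d`, the limit of `J d'` over `J ∈ 𝒥(z + t d')`, `d' → d`, `t ↓ 0`, exists. -/
def Semismooth (F : E → G) : Prop :=
  LocallyLipschitz F ∧
    ∀ z d : E, ∃ l : G, ∀ ε > 0, ∀ᶠ p : ℝ × E in 𝓝[>] (0 : ℝ) ×ˢ 𝓝 d,
      ∀ J ∈ genJacobian F (z + p.1 • p.2), ‖J p.2 - l‖ < ε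

/-- Strong semismoothness: `F` is semismooth and, at every `z`,
`‖F (z + δ) - F z - J δ‖ = O(‖δ‖ ^ 2)` as `δ → 0`, uniformly over `J ∈ 𝒥(z + δ)`. -/
def StronglySemismooth (F : E → G) : Prop :=
  Semismooth F ∧
    ∀ z : E, ∃ C : ℝ, ∀ᶠ δ in 𝓝 (0 : E), ∀ J ∈ genJacobian F (z + δ),
      ‖F (z + δ) - F z - J δ‖ ≤ C * ‖δ‖ ^ 2

end Semismooth

/-- The Euclidean (metric) projection onto `C`: a point of `C` nearest to `x`. It exists and is
unique when `C` is nonempty, closed and convex. -/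
def proj {E : Type*} [NormedAddCommGroup E] (C : Set E) (x : E) : E :=
  Classical.epsilon fun p => p ∈ C ∧ ∀ q ∈ C, ‖x - p‖ ≤ ‖x - q‖

section Cones

/-- The nonnegative orthant of `ℝ^m`. -/
def orthant (m : ℕ) : Set (EuclideanSpace ℝ (Fin m)) :=
  {x | ∀ i, 0 ≤ x i}

/-- The second-order cone `{(x, y) ∈ ℝ^m × ℝ : ‖x‖ ≤ y}` of `ℝ^(m+1)`. -/
def secondOrderCone (m : ℕ) : Set (EuclideanSpace ℝ (Fin (m + 1))) :=
  {x | √(∑ i : Fin m, x i.castSucc ^ 2) ≤ x (Fin.last m)}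

/-- The isometric coordinates `ℝ^(d(d+1)/2) ≃ 𝕊^d` (trace inner product on the right): the
symmetric matrix with diagonal entries `x_{ii}` and off-diagonal entries `x_{ij} / √2`. -/
def smat {d : ℕ} (x : EuclideanSpace ℝ (Sym2 (Fin d))) : Matrix (Fin d) (Fin d) ℝ :=
  Matrix.of fun i j => if i = j then x s(i, j) else x s(i, j) / √2

/-- The cone of positive semidefinite symmetric `d × d` matrices, inside `𝕊^d ≃ ℝ^(d(d+1)/2)`. -/
def psdCone (d : ℕ) : Set (EuclideanSpace ℝ (Sym2 (Fin d))) :=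
  {x | (smat x).PosSemidef}

/-- The cone of vectorized positive semidefinite symmetric `d × d` matrices, inside `ℝ^(d^2)`. -/
def psdConeVec (d : ℕ) : Set (EuclideanSpace ℝ (Fin d × Fin d)) :=
  {x | (Matrix.of fun i j => x (i, j)).PosSemidef}

/-- The exponential cone of `ℝ^3`. -/
def expCone : Set (EuclideanSpace ℝ (Fin 3)) :=
  {w | 0 < w 1 ∧ w 1 * Real.exp (w 0 / w 1) ≤ w 2} ∪ {w | w 0 ≤ 0 ∧ w 1 = 0 ∧ 0 ≤ w 2}

end Cones

section Residual

/-- The index set of the coordinates of `u = (x, y, τ) ∈ ℝ^n × ℝ^ι × ℝ`. -/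
abbrev Idx (n : ℕ) (ι : Type*) := Fin n ⊕ ι ⊕ Unit

variable {n : ℕ} {ι : Type*}

/-- The matrix `[0, Aᵀ, c; -A, 0, b; -cᵀ, -bᵀ, 0]` of the self-dual homogeneous embedding. -/
def embQ (A : Matrix ι (Fin n) ℝ) (b : ι → ℝ) (c : Fin n → ℝ) :
    Matrix (Idx n ι) (Idx n ι) ℝ :=
  Matrix.of fun
    | .inl _, .inl _ => 0
    | .inl i, .inr (.inl j) => A j i
    | .inl i, .inr (.inr _) => c i
    | .inr (.inl i), .inl j => -A i j
    | .inr (.inl _), .inr (.inl _) => 0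
    | .inr (.inl i), .inr (.inr _) => b i
    | .inr (.inr _), .inl j => -c j
    | .inr (.inr _), .inr (.inl j) => -b j
    | .inr (.inr _), .inr (.inr _) => 0

variable [Fintype ι]

/-- `C = ℝ^n × K^* × ℝ₊`. -/
def coneC (n : ℕ) (K : Set (EuclideanSpace ℝ ι)) : Set (EuclideanSpace ℝ (Idx n ι)) :=
  {u | WithLp.toLp 2 (fun i => u (.inr (.inl i))) ∈ ProperCone.innerDual K ∧
    0 ≤ u (.inr (.inr ()))}

/-- The residual map
`F(ũ, u, v) = ((I + Q) ũ - (u + v), u - P_C(ũ - v), ũ - u)` of the ADMM iteration for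
`minimize cᵀ x subject to b - A x ∈ K`. -/
def admmF [DecidableEq ι] (K : Set (EuclideanSpace ℝ ι)) (A : Matrix ι (Fin n) ℝ) (b : ι → ℝ)
    (c : Fin n → ℝ) (z : EuclideanSpace ℝ (Idx n ι ⊕ Idx n ι ⊕ Idx n ι)) :
    EuclideanSpace ℝ (Idx n ι ⊕ Idx n ι ⊕ Idx n ι) :=
  let ut : EuclideanSpace ℝ (Idx n ι) := WithLp.toLp 2 fun i => z (.inl i)
  let u : EuclideanSpace ℝ (Idx n ι) := WithLp.toLp 2 fun i => z (.inr (.inl i))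
  let v : EuclideanSpace ℝ (Idx n ι) := WithLp.toLp 2 fun i => z (.inr (.inr i))
  WithLp.toLp 2 (Sum.elim (fun i => ((1 + embQ A b c).mulVec ut.ofLp) i - (u i + v i))
    (Sum.elim (fun i => u i - proj (coneC n K) (ut - v) i) (fun i => ut i - u i)))

end Residual

end NewtonADMM

end

/-!
Write `P` for the projection onto `K^*`. The residual map `F` is a linear map plus `P` and
`max · 0`, each read through linear coordinates (`isSplit_admmF`), in such a way that `P` and `max · 0`
can be recovered from `F` by linear maps. Hence `F` is differentiable only where both are, its
Jacobians are the obvious sums, and everything reduces to `P`. Elements of Clarke's Jacobian are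
convex combinations of limits of Jacobians, and the conditions to be checked are closed and convex
in the Jacobian, so it is enough to look at Jacobians at points of differentiability: the estimate
`QuadApprox` and the limit `JacobianLimit`.

For Lipschitz maps `QuadApprox` already implies semismoothness
(`QuadApprox.exists_jacobianLimit`). By Rademacher's theorem and Fubini almost every line through
`z` meets the bad points in a null set; on such a line the quadratic estimate bounds the
derivative of `t ↦ (P (z + t d) - P z) / t`, so the difference quotients converge, and
`DP(z + t d') d'` follows them. As `P` is positively homogeneous, Euler's identity `DP(w) w = P w` reduces
`QuadApprox` to `‖DP(w) z - P z‖ = O(‖w - z‖²)`.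

* For the orthant `DP(w) z = P z` for `w` near `z`.
* For the second-order cone the same holds where `P` is linear, and in between `P` is smooth, so
  that Taylor's formula applies (`quadApprox_lorentzProj`).
* For semidefinite matrices `P` is a linear function of `X` and `|X|`. At a point of
  differentiability `X` is invertible, and `Y = D|X| Z - |Z|` satisfies
  `|X| Y + Y |X| = (|X| - |Z|)² - (X - Z)²`. In an eigenbasis of `X` this bounds the entries of `Y` for which one of the
  eigenvalues is not small; when both are small, both eigenvectors are almost in the kernel of `Z`
  and the entry is small for that reason (`IsAbs.abs_entry_le`).

For the exponential cone the limits are computed directly. Outside the regions where `P` is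
linear, a point is `q μ(r) - s γ(r)` with `γ(r) = (r, 1, eʳ)`, `μ(r) = (-eʳ, (r - 1) eʳ, 1)`
orthogonal and `q, s ≥ 0`, and `P` maps it to `q μ(r)`. So `DP` fixes `μ(r)`, kills `γ(r)` and
multiplies `γ(r) × μ(r)` by an explicit number `tangEig r q s`. Let `z ≠ 0`. Along an ultrafilter
of points `z + t d'` of differentiability with `t → 0`, `d' → d`, either one linear region is
occupied or `r` converges in `[-∞, ∞]`; in every case the limit of `DP(z + t d') d'` exists and is
listed in `ExpOutcome` together with the constraints on `z` and `d` that the approach forces.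
These constraints make the limit independent of the ultrafilter (`ExpOutcome.unique`). At `z = 0`
homogeneity gives the limit `P d`.
-/

/-! ### Criteria at points of differentiability -/

namespace NewtonADMM

open MeasureTheory

section Criteria

variable {E G : Type*} [NormedAddCommGroup E] [NormedSpace ℝ E]
  [NormedAddCommGroup G] [NormedSpace ℝ G]

/-- The quadratic estimate of strong semismoothness, demanded only at the points `w` near `z` where
`P` is differentiable. -/
def QuadApprox (P : E → G) : Prop :=
  ∀ z, ∃ C : ℝ, ∀ᶠ w in 𝓝 z, DifferentiableAt ℝ P w →
    ‖P w - P z - fderiv ℝ P w (w - z)‖ ≤ C * ‖w - z‖ ^ 2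

/-- `JacobianLimit P z d l`: the limit in the definition of semismoothness at `z` in the direction
`d` is `l`, when only points `z + t d'` of differentiability are considered. -/
def JacobianLimit (P : E → G) (z d : E) (l : G) : Prop :=
  Tendsto (fun p : ℝ × E => fderiv ℝ P (z + p.1 • p.2) p.2)
    ((𝓝[>] (0 : ℝ) ×ˢ 𝓝 d) ⊓ 𝓟 {p | DifferentiableAt ℝ P (z + p.1 • p.2)}) (𝓝 l)

lemma tendsto_clm_apply {α : Type*} {f : Filter α} {J : α → E →L[ℝ] G} {J₀ : E →L[ℝ] G}
    {x : α → E} {x₀ : E} (hJ : Tendsto J f (𝓝 J₀)) (hx : Tendsto x f (𝓝 x₀)) :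
    Tendsto (fun i => J i (x i)) f (𝓝 (J₀ x₀)) :=
  (isBoundedBilinearMap_apply.continuous.tendsto (J₀, x₀)).comp (hJ.prodMk_nhds hx)

lemma tendsto_add_smul (z d : E) :
    Tendsto (fun p : ℝ × E => z + p.1 • p.2) (𝓝[>] (0 : ℝ) ×ˢ 𝓝 d) (𝓝 z) := by
  have h1 : Tendsto (fun p : ℝ × E => p.1) (𝓝[>] (0 : ℝ) ×ˢ 𝓝 d) (𝓝 0) :=
    tendsto_fst.mono_right nhdsWithin_le_nhds
  have h2 : Tendsto (fun p : ℝ × E => p.2) (𝓝[>] (0 : ℝ) ×ˢ 𝓝 d) (𝓝 d) := tendsto_snd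
  simpa using tendsto_const_nhds.add (h1.smul h2)

/-- An element of the generalized Jacobian is a convex combination of limits of Jacobians, and
`{J | ‖J d' - l‖ ≤ ε}` is closed and convex, so the points of differentiability decide. -/
theorem semismooth_of_jacobianLimit {F : E → G} (hF : LocallyLipschitz F)
    (h : ∀ z d, ∃ l, JacobianLimit F z d l) : Semismooth F := by
  refine ⟨hF, fun z d => ?_⟩
  obtain ⟨l, hl⟩ := h z d
  refine ⟨l, fun ε hε => ?_⟩
  have h1 := (Metric.tendsto_nhds.1 hl) (ε / 2) (half_pos hε)
  rw [eventually_inf_principal] at h1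
  obtain ⟨pa, hpa, pb, hpb, hab⟩ := eventually_prod_iff.1 h1
  obtain ⟨δ, hδ, hδa⟩ := mem_nhdsGT_iff_exists_Ioo_subset.1 hpa
  refine eventually_prod_iff.2 ⟨_, Ioo_mem_nhdsGT hδ, _, eventually_nhds_iff.1 hpb |>.elim
    (fun t ht => eventually_nhds_iff.2 ⟨t, fun x hx => eventually_nhds_iff.2
      ⟨t, ht.1, ht.2.1, hx⟩, ht.2⟩), ?_⟩
  intro t ht d' hd' J hJ
  have ht0 : 0 < t := ht.1
  have hsub : genJacobian F (z + t • d') ⊆ {J | ‖J d' - l‖ ≤ ε / 2} := by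
    refine convexHull_min ?_ ?_
    · rintro J ⟨s, hs, hsz, hsJ⟩
      have hq : Tendsto (fun i => t⁻¹ • (s i - z)) atTop (𝓝 d') := by
        have := (hsz.sub_const z).const_smul t⁻¹
        simpa [smul_smul, ht0.ne'] using this
      have hlim : Tendsto (fun i => ‖fderiv ℝ F (s i) (t⁻¹ • (s i - z)) - l‖) atTop
          (𝓝 ‖J d' - l‖) := ((tendsto_clm_apply hsJ hq).sub_const l).norm
      refine le_of_tendsto hlim ?_
      filter_upwards [hq.eventually hd'] with i hi
      have hzi : z + t • (t⁻¹ • (s i - z)) = s i := by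
        rw [smul_smul, mul_inv_cancel₀ ht0.ne', one_smul, add_sub_cancel]
      have := hab (hδa ht) hi (by simpa only [Set.mem_ofPred_eq, hzi] using hs i)
      simp only [hzi, dist_eq_norm] at this
      exact this.le
    · have : {J : E →L[ℝ] G | ‖J d' - l‖ ≤ ε / 2}
          = (ContinuousLinearMap.apply ℝ G d').toLinearMap ⁻¹' Metric.closedBall l (ε / 2) := by
        ext J; simp [dist_eq_norm]
      rw [this]
      exact (convex_closedBall l _).linear_preimage _
  exact lt_of_le_of_lt (hsub hJ) (half_lt_self hε)

/-- For fixed `δ` the estimate is a closed convex condition on `J`, so it passes from the points of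
differentiability to the generalized Jacobian. -/
theorem QuadApprox.genJacobian {F : E → G} (hF : Continuous F) (h : QuadApprox F) (z : E) :
    ∃ C : ℝ, ∀ᶠ δ in 𝓝 (0 : E), ∀ J ∈ genJacobian F (z + δ),
      ‖F (z + δ) - F z - J δ‖ ≤ C * ‖δ‖ ^ 2 := by
  obtain ⟨C, hC⟩ := h z
  refine ⟨C, ?_⟩
  have ht : Tendsto (fun δ : E => z + δ) (𝓝 0) (𝓝 z) := by
    simpa using (tendsto_const_nhds (x := z)).add (tendsto_id (α := E) (x := 𝓝 0))
  filter_upwards [ht.eventually hC.eventually_nhds] with δ hδ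
  intro J hJ
  have hsub : NewtonADMM.genJacobian F (z + δ)
      ⊆ {J | ‖F (z + δ) - F z - J δ‖ ≤ C * ‖δ‖ ^ 2} := by
    refine convexHull_min ?_ ?_
    · rintro J ⟨s, hs, hsz, hsJ⟩
      have hd : Tendsto (fun i => s i - z) atTop (𝓝 δ) := by
        simpa using hsz.sub_const z
      have hlim := ((((hF.tendsto _).comp hsz).sub_const (F z)).sub (tendsto_clm_apply hsJ hd)).norm
      refine le_of_tendsto_of_tendsto hlim ((hd.norm.pow 2).const_mul C) ?_
      filter_upwards [hsz.eventually hδ] with i hi using hi (hs i)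
    · have : {J : E →L[ℝ] G | ‖F (z + δ) - F z - J δ‖ ≤ C * ‖δ‖ ^ 2}
          = (ContinuousLinearMap.apply ℝ G δ).toLinearMap ⁻¹'
            Metric.closedBall (F (z + δ) - F z) (C * ‖δ‖ ^ 2) := by
        ext J; simp [dist_eq_norm, norm_sub_rev]
      rw [this]
      exact (convex_closedBall _ _).linear_preimage _
  exact hsub hJ

/-- Where `P` is differentiable at `z + τ d`, the difference quotient of `P` at `z` along `d` has
derivative `τ⁻² (DP(w)(w - z) - (P w - P z))` at `τ`, with `w = z + τ d`; the quadratic estimate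
bounds it. -/
lemma norm_deriv_quotient_le {P : E → G} {z d : E} {C r τ : ℝ}
    (hC : ∀ w ∈ Metric.ball z r, DifferentiableAt ℝ P w →
      ‖P w - P z - fderiv ℝ P w (w - z)‖ ≤ C * ‖w - z‖ ^ 2)
    (f : G →L[ℝ] ℝ) (hτ : 0 < τ) (hr : τ * ‖d‖ < r) (hd : DifferentiableAt ℝ P (z + τ • d)) :
    ‖deriv (fun τ : ℝ => τ⁻¹ * f (P (z + τ • d) - P z)) τ‖ ≤ C * ‖d‖ ^ 2 * ‖f‖ := by
  have h1 : HasDerivAt (fun τ : ℝ => z + τ • d) d τ := by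
    simpa using ((hasDerivAt_id τ).smul_const d).const_add z
  have h2 := (hd.hasFDerivAt.comp_hasDerivAt τ h1).sub_const (P z)
  have h3 := (hasDerivAt_inv hτ.ne').mul (f.hasFDerivAt.comp_hasDerivAt τ h2)
  have hw : z + τ • d ∈ Metric.ball z r := by
    simpa [dist_eq_norm, norm_smul, abs_of_pos hτ] using hr
  have h4 := hC _ hw hd
  have h5 : ‖f (P (z + τ • d) - P z - fderiv ℝ P (z + τ • d) (z + τ • d - z))‖
      ≤ ‖f‖ * (C * ‖z + τ • d - z‖ ^ 2) :=
    (f.le_opNorm _).trans (mul_le_mul_of_nonneg_left h4 (norm_nonneg _))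
  rw [show (fun τ : ℝ => τ⁻¹ * f (P (z + τ • d) - P z)) =
    (fun τ : ℝ => τ⁻¹) * (f ∘ fun x => (P ∘ fun τ : ℝ => z + τ • d) x - P z) from rfl, h3.deriv]
  simp only [add_sub_cancel_left, norm_smul, map_sub, map_smul, smul_eq_mul, Real.norm_eq_abs,
    abs_of_pos hτ, Function.comp_apply] at h5 ⊢
  have h6 : -(τ ^ 2)⁻¹ * (f (P (z + τ • d)) - f (P z)) + τ⁻¹ * f (fderiv ℝ P (z + τ • d) d)
      = -(τ ^ 2)⁻¹ * (f (P (z + τ • d)) - f (P z) - τ * f (fderiv ℝ P (z + τ • d) d)) := by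
    field_simp
    ring
  rw [h6, abs_mul, abs_neg, abs_of_pos (by positivity : 0 < (τ ^ 2)⁻¹),
    inv_mul_le_iff₀ (by positivity)]
  calc _ ≤ _ := h5
    _ = _ := by ring

/-- The difference quotient is absolutely continuous on `[s, t]`, so the almost everywhere bound on
its derivative can be integrated. -/
lemma norm_quotient_sub_le_of_ae {P : E → G} {K : NNReal} (hP : LipschitzWith K P) {z d : E}
    {C r s t : ℝ} (hC0 : 0 ≤ C)
    (hC : ∀ w ∈ Metric.ball z r, DifferentiableAt ℝ P w →
      ‖P w - P z - fderiv ℝ P w (w - z)‖ ≤ C * ‖w - z‖ ^ 2)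
    (hs : 0 < s) (hst : s ≤ t) (hr : t * ‖d‖ < r)
    (hd : ∀ᵐ τ : ℝ, DifferentiableAt ℝ P (z + τ • d)) :
    ‖t⁻¹ • (P (z + t • d) - P z) - s⁻¹ • (P (z + s • d) - P z)‖ ≤ C * ‖d‖ ^ 2 * (t - s) := by
  have hts : 0 ≤ t - s := sub_nonneg.2 hst
  refine NormedSpace.norm_le_dual_bound ℝ _ (by positivity) fun f => ?_
  have hac1 : AbsolutelyContinuousOnInterval (fun τ : ℝ => τ⁻¹) s t := by
    refine ContDiffOn.absolutelyContinuousOnInterval ?_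
    refine contDiffOn_inv ℝ |>.mono ?_
    intro τ hτ
    rw [Set.uIcc_of_le hst] at hτ
    exact (hs.trans_le hτ.1).ne'
  have hac2 : AbsolutelyContinuousOnInterval (fun τ : ℝ => f (P (z + τ • d) - P z)) s t := by
    have h1 : LipschitzWith ‖d‖₊ (fun τ : ℝ => z + τ • d) :=
      LipschitzWith.of_dist_le_mul fun x y => by
        rw [dist_add_left, dist_eq_norm, ← sub_smul, norm_smul, dist_eq_norm, mul_comm]; rfl
    have h2 : LipschitzWith (‖f‖₊ * (K * ‖d‖₊)) (fun τ : ℝ => f (P (z + τ • d) - P z)) := by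
      refine LipschitzWith.of_dist_le_mul fun x y => ?_
      have h3 := (f.lipschitz.comp (hP.comp h1)).dist_le_mul x y
      simpa [dist_eq_norm, map_sub, mul_assoc] using h3
    exact (h2.lipschitzOnWith (s := Set.uIcc s t)).absolutelyContinuousOnInterval
  have hint := (hac1.mul hac2).integral_deriv_eq_sub
  have hb := intervalIntegral.norm_integral_le_of_norm_le_const_ae (a := s) (b := t)
    (C := C * ‖d‖ ^ 2 * ‖f‖)
    (f := deriv ((fun τ : ℝ => τ⁻¹) * fun τ : ℝ => f (P (z + τ • d) - P z))) (by
      filter_upwards [hd] with τ hτ hτI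
      rw [Set.uIoc_of_le hst] at hτI
      exact norm_deriv_quotient_le hC f (hs.trans hτI.1)
        ((mul_le_mul_of_nonneg_right hτI.2 (norm_nonneg _)).trans_lt hr) hτ)
  rw [hint, abs_of_nonneg hts] at hb
  simp only [Pi.mul_apply] at hb
  simpa [map_sub, mul_assoc, mul_comm, mul_left_comm] using hb

/-- By Rademacher's theorem and Fubini, almost every line through `z` meets the points of
non-differentiability in a null set. -/
lemma ae_ae_differentiableAt [FiniteDimensional ℝ E] [FiniteDimensional ℝ G] [MeasurableSpace E]
    [BorelSpace E] (μ : Measure E) [μ.IsAddHaarMeasure] {P : E → G} {K : NNReal}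
    (hP : LipschitzWith K P) (z : E) :
    ∀ᵐ d ∂μ, ∀ᵐ τ : ℝ, DifferentiableAt ℝ P (z + τ • d) := by
  have : CompleteSpace G := FiniteDimensional.complete ℝ G
  have hmeas : MeasurableSet {x : E × ℝ | DifferentiableAt ℝ P (z + x.2 • x.1)} := by
    refine (measurableSet_of_differentiableAt ℝ P).preimage ?_
    fun_prop
  rw [Measure.ae_ae_comm (p := fun d (τ : ℝ) => DifferentiableAt ℝ P (z + τ • d)) hmeas]
  have h0 : ∀ᵐ τ : ℝ, τ ≠ 0 := by simp [ae_iff]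
  filter_upwards [h0] with τ hτ
  have hnull : μ {w | ¬ DifferentiableAt ℝ P w} = 0 := hP.ae_differentiableAt
  rw [ae_iff]
  have : {d | ¬ DifferentiableAt ℝ P (z + τ • d)}
      = (fun d => τ • d) ⁻¹' ((fun h => z + h) ⁻¹' {w | ¬ DifferentiableAt ℝ P w}) := rfl
  rw [this, Measure.addHaar_preimage_smul μ hτ, measure_preimage_add, hnull, mul_zero]

/-- A Lipschitz map with the quadratic estimate has one-sided directional derivatives: the
difference quotients along a ray are themselves Lipschitz functions of the step length. -/
theorem QuadApprox.exists_tendsto_quotient [FiniteDimensional ℝ E] [FiniteDimensional ℝ G]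
    {P : E → G} {K : NNReal} (hP : LipschitzWith K P) (h : QuadApprox P) (z d : E) :
    ∃ l, Tendsto (fun t : ℝ => t⁻¹ • (P (z + t • d) - P z)) (𝓝[>] 0) (𝓝 l) := by
  let : MeasurableSpace E := borel E
  have : BorelSpace E := ⟨rfl⟩
  have : CompleteSpace G := FiniteDimensional.complete ℝ G
  obtain ⟨C₀, hC₀⟩ := h z
  obtain ⟨r, hr, hball⟩ := Metric.eventually_nhds_iff_ball.1 hC₀
  set C := max C₀ 0
  have hC : ∀ w ∈ Metric.ball z r, DifferentiableAt ℝ P w →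
      ‖P w - P z - fderiv ℝ P w (w - z)‖ ≤ C * ‖w - z‖ ^ 2 := fun w hw hd =>
    (hball w hw hd).trans (mul_le_mul_of_nonneg_right (le_max_left _ _) (by positivity))
  have hae := ae_ae_differentiableAt (Measure.addHaar : Measure E) hP z
  have hdense := Measure.dense_of_ae hae
  have key : ∀ s t : ℝ, 0 < s → s ≤ t → t * ‖d‖ < r →
      ‖t⁻¹ • (P (z + t • d) - P z) - s⁻¹ • (P (z + s • d) - P z)‖ ≤ C * ‖d‖ ^ 2 * (t - s) := by
    intro s t hs hst htr
    have hfr : ∃ᶠ d' in 𝓝 d, ∀ᵐ τ : ℝ, DifferentiableAt ℝ P (z + τ • d') :=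
      mem_closure_iff_frequently.1 (hdense d)
    have hev : ∀ᶠ d' in 𝓝 d, t * ‖d'‖ < r :=
      (Continuous.tendsto (by fun_prop : Continuous fun d' : E => t * ‖d'‖) d).eventually_lt_const
        htr
    have hcont : Continuous fun d' : E => ‖t⁻¹ • (P (z + t • d') - P z)
        - s⁻¹ • (P (z + s • d') - P z)‖ - C * ‖d'‖ ^ 2 * (t - s) := by
      have := hP.continuous
      fun_prop
    have := le_of_tendsto_of_frequently (b := 0) (hcont.tendsto d)
      ((hfr.and_eventually hev).mono fun d' hd' => sub_nonpos.2
        (norm_quotient_sub_le_of_ae hP (le_max_right _ _) hC hs hst hd'.2 hd'.1))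
    exact sub_nonpos.1 this
  rw [← cauchy_map_iff_exists_tendsto, Metric.cauchy_iff]
  refine ⟨inferInstance, fun ε hε => ?_⟩
  have hsmall : ∀ᶠ t : ℝ in 𝓝[>] 0, t * ‖d‖ < r ∧ C * ‖d‖ ^ 2 * t < ε := by
    refine nhdsWithin_le_nhds ?_
    refine Filter.Eventually.and ?_ ?_
    · exact (Continuous.tendsto (by fun_prop : Continuous fun t : ℝ => t * ‖d‖)
        0).eventually_lt_const (by simpa using hr)
    · exact (Continuous.tendsto (by fun_prop : Continuous fun t : ℝ => C * ‖d‖ ^ 2 * t)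
        0).eventually_lt_const (by simpa using hε)
  have hC0 : 0 ≤ C := le_max_right _ _
  refine ⟨_, image_mem_map (inter_mem hsmall self_mem_nhdsWithin), ?_⟩
  have main : ∀ s t : ℝ, 0 < s → s ≤ t → t * ‖d‖ < r → C * ‖d‖ ^ 2 * t < ε →
      dist (t⁻¹ • (P (z + t • d) - P z)) (s⁻¹ • (P (z + s • d) - P z)) < ε := by
    intro s t hs hst h1 h2
    rw [dist_eq_norm]
    refine (key s t hs hst h1).trans_lt (lt_of_le_of_lt ?_ h2)
    exact mul_le_mul_of_nonneg_left (by linarith) (by positivity)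
  rintro _ ⟨t, ⟨⟨h1, h2⟩, h3⟩, rfl⟩ _ ⟨s, ⟨⟨h4, h5⟩, h6⟩, rfl⟩
  rcases le_total s t with hst | hst
  · exact main s t h6 hst h1 h2
  · rw [dist_comm]
    exact main t s h3 hst h4 h5

/-- The limit is the one-sided directional derivative of `P` at `z` along `d`. -/
theorem QuadApprox.exists_jacobianLimit [FiniteDimensional ℝ E] [FiniteDimensional ℝ G]
    {P : E → G} {K : NNReal} (hP : LipschitzWith K P) (h : QuadApprox P) (z d : E) :
    ∃ l, JacobianLimit P z d l := by
  obtain ⟨l, hl⟩ := h.exists_tendsto_quotient hP z d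
  refine ⟨l, ?_⟩
  obtain ⟨C, hC⟩ := h z
  set Fl := (𝓝[>] (0 : ℝ) ×ˢ 𝓝 d) ⊓ 𝓟 {p | DifferentiableAt ℝ P (z + p.1 • p.2)}
  have ht : Tendsto (fun p : ℝ × E => p.1) Fl (𝓝[>] 0) := tendsto_fst.mono_left inf_le_left
  have ht0 : Tendsto (fun p : ℝ × E => p.1) Fl (𝓝 0) := ht.mono_right nhdsWithin_le_nhds
  have hd : Tendsto (fun p : ℝ × E => p.2) Fl (𝓝 d) := tendsto_snd.mono_left inf_le_left
  have hpos : ∀ᶠ p in Fl, 0 < p.1 := ht.eventually self_mem_nhdsWithin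
  have hdiff : ∀ᶠ p in Fl, DifferentiableAt ℝ P (z + p.1 • p.2) :=
    mem_inf_of_right (mem_principal_self _)
  have hz : Tendsto (fun p : ℝ × E => z + p.1 • p.2) Fl (𝓝 z) :=
    (tendsto_add_smul z d).mono_left inf_le_left
  have hbound : Tendsto (fun p : ℝ × E => C * (p.1 * ‖p.2‖ ^ 2) + K * ‖p.2 - d‖) Fl (𝓝 0) := by
    have := ((ht0.mul (hd.norm.pow 2)).const_mul C).add
      ((hd.sub_const d).norm.const_mul (K : ℝ))
    simpa using this
  have := tendsto_iff_norm_sub_tendsto_zero.1 (hl.comp ht)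
  refine tendsto_iff_norm_sub_tendsto_zero.2 ?_
  refine squeeze_zero' (Eventually.of_forall fun _ => norm_nonneg _) ?_
    (by simpa using hbound.add this)
  filter_upwards [hpos, hdiff, hz.eventually hC] with p hp hpd hpC
  have h1 := hpC hpd
  rw [add_sub_cancel_left, map_smul, norm_smul, Real.norm_eq_abs, abs_of_pos hp] at h1
  have h2 : ‖P (z + p.1 • p.2) - P (z + p.1 • d)‖ ≤ K * (p.1 * ‖p.2 - d‖) := by
    refine (hP.norm_sub_le _ _).trans_eq ?_
    rw [add_sub_add_left_eq_sub, ← smul_sub, norm_smul, Real.norm_eq_abs, abs_of_pos hp]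
  set D := fderiv ℝ P (z + p.1 • p.2) p.2
  have h3 : D - l = -(p.1⁻¹ • (P (z + p.1 • p.2) - P z - p.1 • D))
      + p.1⁻¹ • (P (z + p.1 • p.2) - P (z + p.1 • d))
      + (p.1⁻¹ • (P (z + p.1 • d) - P z) - l) := by
    simp only [smul_sub, smul_smul, inv_mul_cancel₀ hp.ne', one_smul]
    abel
  rw [h3]
  refine (norm_add_le _ _).trans (add_le_add ((norm_add_le _ _).trans (add_le_add ?_ ?_)) le_rfl)
  · rw [norm_neg, norm_smul, Real.norm_eq_abs, abs_of_pos (inv_pos.2 hp), inv_mul_le_iff₀ hp]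
    calc _ ≤ _ := h1
      _ = _ := by ring
  · rw [norm_smul, Real.norm_eq_abs, abs_of_pos (inv_pos.2 hp), inv_mul_le_iff₀ hp]
    calc _ ≤ _ := h2
      _ = _ := by ring

theorem QuadApprox.stronglySemismooth [FiniteDimensional ℝ E] [FiniteDimensional ℝ G]
    {P : E → G} {K : NNReal} (hP : LipschitzWith K P) (h : QuadApprox P) :
    StronglySemismooth P :=
  ⟨semismooth_of_jacobianLimit hP.locallyLipschitz fun z d => h.exists_jacobianLimit hP z d,
    fun z => h.genJacobian hP.continuous z⟩

end Criteria

end NewtonADMM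

/-! ### Metric projections, homogeneous maps and split maps -/

namespace NewtonADMM

section Projection

variable {E : Type*} [NormedAddCommGroup E] [InnerProductSpace ℝ E]

/-- `P` is the metric projection onto `C`, expressed by the variational inequality. -/
def IsProjOn (C : Set E) (P : E → E) : Prop :=
  ∀ w, P w ∈ C ∧ ∀ q ∈ C, inner ℝ (w - P w) (q - P w) ≤ 0

lemma norm_sub_sq_add_le {w p q : E} (h : inner ℝ (w - p) (q - p) ≤ 0) :
    ‖w - p‖ ^ 2 + ‖q - p‖ ^ 2 ≤ ‖w - q‖ ^ 2 := by
  have : w - q = (w - p) - (q - p) := by abel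
  rw [this, norm_sub_sq_real (w - p) (q - p)]
  linarith

lemma proj_eq_of_inner_le {C : Set E} {w p : E} (hp : p ∈ C)
    (h : ∀ q ∈ C, inner ℝ (w - p) (q - p) ≤ 0) : proj C w = p := by
  have hex : p ∈ C ∧ ∀ q ∈ C, ‖w - p‖ ≤ ‖w - q‖ := by
    refine ⟨hp, fun q hq => ?_⟩
    have := norm_sub_sq_add_le (h q hq)
    exact le_of_sq_le_sq (by nlinarith [sq_nonneg ‖q - p‖]) (norm_nonneg _)
  obtain ⟨h1, h2⟩ := Classical.epsilon_spec (p := fun p => p ∈ C ∧ ∀ q ∈ C, ‖w - p‖ ≤ ‖w - q‖)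
    ⟨p, hex⟩
  change proj C w ∈ C at h1
  have h3 : ‖w - proj C w‖ ≤ ‖w - p‖ := h2 p hp
  have h4 := norm_sub_sq_add_le (h _ h1)
  have h5 : ‖w - proj C w‖ ^ 2 ≤ ‖w - p‖ ^ 2 := by gcongr
  have h6 : ‖proj C w - p‖ ^ 2 ≤ 0 := by linarith
  exact sub_eq_zero.1 (norm_eq_zero.1 (pow_eq_zero_iff two_ne_zero |>.1
    (le_antisymm h6 (sq_nonneg _))))

lemma IsProjOn.eq_of_inner_le {C : Set E} {P : E → E} (hP : IsProjOn C P) {w p : E} (hp : p ∈ C)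
    (h : ∀ q ∈ C, inner ℝ (w - p) (q - p) ≤ 0) : P w = p := by
  rw [← proj_eq_of_inner_le (hP w).1 (hP w).2, proj_eq_of_inner_le hp h]

lemma IsProjOn.lipschitzWith {C : Set E} {P : E → E} (hP : IsProjOn C P) : LipschitzWith 1 P := by
  refine LipschitzWith.of_dist_le_mul fun x y => ?_
  rw [NNReal.coe_one, one_mul, dist_eq_norm, dist_eq_norm]
  have h1 := (hP x).2 _ (hP y).1
  have h2 := (hP y).2 _ (hP x).1
  have h3 : ‖P x - P y‖ ^ 2 ≤ inner ℝ (x - y) (P x - P y) := by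
    have e1 : inner ℝ (x - y) (P x - P y) - ‖P x - P y‖ ^ 2
        = - inner ℝ (x - P x) (P y - P x) - inner ℝ (y - P y) (P x - P y) := by
      rw [← real_inner_self_eq_norm_sq, ← inner_sub_left, ← neg_sub (P x) (P y), inner_neg_right,
        neg_neg, ← inner_sub_left]
      congr 1
      abel
    linarith
  have h4 := real_inner_le_norm (x - y) (P x - P y)
  by_contra hlt
  push Not at hlt
  nlinarith [norm_nonneg (x - y), norm_nonneg (P x - P y)]

lemma isProjOn_of_innerDual [CompleteSpace E] {K : Set E} {P : E → E}
    (h : ∀ w, P w ∈ ProperCone.innerDual K ∧ P w - w ∈ K ∧ inner ℝ (P w - w) (P w) = 0) :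
    IsProjOn (ProperCone.innerDual K : Set E) P := by
  refine fun w => ⟨(h w).1, fun q hq => ?_⟩
  have h1 : 0 ≤ inner ℝ (P w - w) q := hq (h w).2.1
  rw [inner_sub_right, ← neg_sub (P w) w, inner_neg_left, inner_neg_left, (h w).2.2]
  linarith

lemma exists_isProjOn [CompleteSpace E] {C : Set E} (hne : C.Nonempty) (hc : IsClosed C)
    (hconv : Convex ℝ C) : ∃ P, IsProjOn C P := by
  have h : ∀ w, ∃ p ∈ C, ∀ q ∈ C, inner ℝ (w - p) (q - p) ≤ 0 := by
    intro w
    obtain ⟨p, hp, hpn⟩ := exists_norm_eq_iInf_of_complete_convex hne hc.isComplete hconv w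
    exact ⟨p, hp, (norm_eq_iInf_iff_real_inner_le_zero hconv hp).1 hpn⟩
  choose P hP using h
  exact ⟨P, hP⟩

lemma IsProjOn.smul {C : ProperCone ℝ E} {P : E → E} (hP : IsProjOn (C : Set E) P) {c : ℝ}
    (hc : 0 < c) (w : E) : P (c • w) = c • P w := by
  refine hP.eq_of_inner_le (C.smul_mem (hP w).1 hc.le) fun q hq => ?_
  have hq' : c⁻¹ • q ∈ (C : Set E) := C.smul_mem hq (inv_pos.2 hc).le
  have h1 := (hP w).2 _ hq'
  have e : q - c • P w = c • (c⁻¹ • q - P w) := by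
    rw [smul_sub, smul_smul, mul_inv_cancel₀ hc.ne', one_smul]
  rw [e, ← smul_sub, real_inner_smul_left, real_inner_smul_right]
  nlinarith [mul_pos hc hc]

end Projection

section OneSided

variable {E G : Type*} [NormedAddCommGroup E] [NormedSpace ℝ E]
  [NormedAddCommGroup G] [NormedSpace ℝ G]

/-- Where `P` is known to be differentiable, its derivative in a direction can be read off from one
side. -/
lemma fderiv_eq_of_eventually {P : E → G} {w h : E} {k : G} (hP : DifferentiableAt ℝ P w)
    (hk : ∀ᶠ ε : ℝ in 𝓝[>] 0, P (w + ε • h) = P w + ε • k) : fderiv ℝ P w h = k := by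
  have h1 : HasDerivAt (fun ε : ℝ => w + ε • h) h 0 := by
    simpa using ((hasDerivAt_id (0 : ℝ)).smul_const h).const_add w
  have h2 : HasDerivAt (fun ε : ℝ => P (w + ε • h)) (fderiv ℝ P w h) 0 :=
    HasFDerivAt.comp_hasDerivAt (0 : ℝ) (by simpa using hP.hasFDerivAt) h1
  have h3 : HasDerivAt (fun ε : ℝ => P w + ε • k) k 0 := by
    simpa using ((hasDerivAt_id (0 : ℝ)).smul_const k).const_add (P w)
  have h4 : HasDerivWithinAt (fun ε : ℝ => P (w + ε • h)) k (Set.Ioi 0) 0 :=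
    h3.hasDerivWithinAt.congr_of_eventuallyEq hk (by simp)
  exact (uniqueDiffWithinAt_Ioi (0 : ℝ)).eq_deriv _ h2.hasDerivWithinAt h4

lemma fderiv_self_of_homogeneous {P : E → G} (hom : ∀ c : ℝ, 0 < c → ∀ w, P (c • w) = c • P w)
    {w : E} (hP : DifferentiableAt ℝ P w) : fderiv ℝ P w w = P w := by
  refine fderiv_eq_of_eventually hP ?_
  filter_upwards [self_mem_nhdsWithin] with ε hε
  have hε' : (0 : ℝ) < ε := hε
  have := hom (1 + ε) (by linarith) w
  simpa [add_smul] using this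

/-- For a positively homogeneous map Euler's identity turns the quadratic estimate into a bound on
`DP(w) z - P z`. -/
lemma quadApprox_of_homogeneous {P : E → G}
    (hom : ∀ c : ℝ, 0 < c → ∀ w, P (c • w) = c • P w)
    (h : ∀ z, ∃ C : ℝ, ∀ᶠ w in 𝓝 z, DifferentiableAt ℝ P w →
      ‖fderiv ℝ P w z - P z‖ ≤ C * ‖w - z‖ ^ 2) : QuadApprox P := by
  intro z
  obtain ⟨C, hC⟩ := h z
  refine ⟨C, hC.mono fun w hw hd => ?_⟩
  rw [map_sub, fderiv_self_of_homogeneous hom hd]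
  convert hw hd using 2
  abel

/-- If `P` is additive along the direction `z` near `z`, then `DP(w) z = P z` holds exactly. -/
lemma quadApprox_of_eventually_add {P : E → G}
    (hom : ∀ c : ℝ, 0 < c → ∀ w, P (c • w) = c • P w)
    (h : ∀ z, ∀ᶠ w in 𝓝 z, ∀ ε : ℝ, 0 < ε → P (w + ε • z) = P w + ε • P z) :
    QuadApprox P := by
  refine quadApprox_of_homogeneous hom fun z => ⟨0, (h z).mono fun w hw hd => ?_⟩
  rw [fderiv_eq_of_eventually hd (k := P z)]
  · simp
  · filter_upwards [self_mem_nhdsWithin] with ε hε using hw ε hε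

lemma eventually_max_add (z : ℝ) :
    ∀ᶠ w in 𝓝 z, ∀ ε : ℝ, 0 < ε → max (w + ε * z) 0 = max w 0 + ε * max z 0 := by
  rcases lt_trichotomy z 0 with hz | rfl | hz
  · filter_upwards [eventually_lt_nhds hz] with w hw ε hε
    rw [max_eq_right (by nlinarith), max_eq_right hw.le, max_eq_right hz.le]
    simp
  · simp
  · filter_upwards [eventually_gt_nhds hz] with w hw ε hε
    rw [max_eq_left (by nlinarith), max_eq_left hw.le, max_eq_left hz.le]

lemma quadApprox_max : QuadApprox fun x : ℝ => max x 0 := by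
  refine quadApprox_of_eventually_add (fun c hc w => ?_) fun z => ?_
  · simp [mul_max_of_nonneg _ _ hc.le]
  · simpa using eventually_max_add z

lemma lipschitzWith_max : LipschitzWith 1 fun x : ℝ => max x 0 :=
  LipschitzWith.id.max_const 0

end OneSided

section Splitting

variable {Z Z' Y₁ Y₂ : Type*} [NormedAddCommGroup Z] [NormedSpace ℝ Z]
  [NormedAddCommGroup Z'] [NormedSpace ℝ Z'] [NormedAddCommGroup Y₁] [NormedSpace ℝ Y₁]
  [NormedAddCommGroup Y₂] [NormedSpace ℝ Y₂]

/-- `F` is a linear map plus two maps `P₁`, `P₂` read through linear coordinates, and each `Pᵢ` can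
be recovered from `F`: the section `sᵢ` of `πᵢ` moves the argument of `Pᵢ` freely and `Nᵢ` extracts
its value. -/
structure IsSplit (F : Z → Z') (P₁ : Y₁ → Y₁) (P₂ : Y₂ → Y₂) (L : Z →L[ℝ] Z')
    (M₁ : Y₁ →L[ℝ] Z') (π₁ : Z →L[ℝ] Y₁) (M₂ : Y₂ →L[ℝ] Z') (π₂ : Z →L[ℝ] Y₂)
    (N₁ : Z' →L[ℝ] Y₁) (s₁ : Y₁ →L[ℝ] Z) (N₂ : Z' →L[ℝ] Y₂) (s₂ : Y₂ →L[ℝ] Z) : Prop where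
  eq : ∀ z, F z = L z + M₁ (P₁ (π₁ z)) + M₂ (P₂ (π₂ z))
  section₁ : ∀ y, π₁ (s₁ y) = y
  section₂ : ∀ y, π₂ (s₂ y) = y
  retract₁₁ : ∀ y, N₁ (M₁ y) = y
  retract₁₂ : ∀ y, N₁ (M₂ y) = 0
  retract₂₁ : ∀ y, N₂ (M₁ y) = 0
  retract₂₂ : ∀ y, N₂ (M₂ y) = y

namespace IsSplit

variable {F : Z → Z'} {P₁ : Y₁ → Y₁} {P₂ : Y₂ → Y₂} {L : Z →L[ℝ] Z'}
    {M₁ : Y₁ →L[ℝ] Z'} {π₁ : Z →L[ℝ] Y₁} {M₂ : Y₂ →L[ℝ] Z'} {π₂ : Z →L[ℝ] Y₂}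
    {N₁ : Z' →L[ℝ] Y₁} {s₁ : Y₁ →L[ℝ] Z} {N₂ : Z' →L[ℝ] Y₂} {s₂ : Y₂ →L[ℝ] Z}

lemma differentiableAt₁ (h : IsSplit F P₁ P₂ L M₁ π₁ M₂ π₂ N₁ s₁ N₂ s₂) {z : Z}
    (hF : DifferentiableAt ℝ F z) : DifferentiableAt ℝ P₁ (π₁ z) := by
  have e : P₁ = fun y => N₁ (F (z + s₁ (y - π₁ z)) - L (z + s₁ (y - π₁ z))) := by
    funext y
    rw [h.eq, add_assoc, add_sub_cancel_left, map_add, h.retract₁₁, h.retract₁₂, map_add,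
      h.section₁, add_sub_cancel, add_zero]
  rw [e]
  have h1 : DifferentiableAt ℝ F (z + s₁ (π₁ z - π₁ z)) := by simpa using hF
  have h2 : DifferentiableAt ℝ (fun y => z + s₁ (y - π₁ z)) (π₁ z) := by fun_prop
  have h3 := DifferentiableAt.comp (f := fun y => z + s₁ (y - π₁ z)) (π₁ z) h1 h2
  have h4 := DifferentiableAt.comp (g := L) (f := fun y => z + s₁ (y - π₁ z)) (π₁ z)
    L.differentiableAt h2
  exact N₁.differentiableAt.comp _ (h3.sub h4)

lemma symm (h : IsSplit F P₁ P₂ L M₁ π₁ M₂ π₂ N₁ s₁ N₂ s₂) :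
    IsSplit F P₂ P₁ L M₂ π₂ M₁ π₁ N₂ s₂ N₁ s₁ :=
  ⟨fun z => by rw [h.eq, add_right_comm], h.section₂, h.section₁, h.retract₂₂, h.retract₂₁,
    h.retract₁₂, h.retract₁₁⟩

lemma differentiableAt₂ (h : IsSplit F P₁ P₂ L M₁ π₁ M₂ π₂ N₁ s₁ N₂ s₂) {z : Z}
    (hF : DifferentiableAt ℝ F z) : DifferentiableAt ℝ P₂ (π₂ z) :=
  h.symm.differentiableAt₁ hF

lemma fderiv_eq (h : IsSplit F P₁ P₂ L M₁ π₁ M₂ π₂ N₁ s₁ N₂ s₂) {z : Z}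
    (hF : DifferentiableAt ℝ F z) (d : Z) :
    fderiv ℝ F z d = L d + M₁ (fderiv ℝ P₁ (π₁ z) (π₁ d)) + M₂ (fderiv ℝ P₂ (π₂ z) (π₂ d)) := by
  have h1 := (h.differentiableAt₁ hF).hasFDerivAt.comp z π₁.hasFDerivAt
  have h2 := (h.differentiableAt₂ hF).hasFDerivAt.comp z π₂.hasFDerivAt
  have h3 : HasFDerivAt (fun z => L z + M₁ (P₁ (π₁ z)) + M₂ (P₂ (π₂ z))) _ z :=
    (L.hasFDerivAt.add (M₁.hasFDerivAt.comp z h1)).add (M₂.hasFDerivAt.comp z h2)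
  have e : F = fun z => L z + M₁ (P₁ (π₁ z)) + M₂ (P₂ (π₂ z)) := funext h.eq
  rw [← e] at h3
  rw [h3.fderiv]
  rfl

lemma exists_lipschitzWith (h : IsSplit F P₁ P₂ L M₁ π₁ M₂ π₂ N₁ s₁ N₂ s₂) {K₁ K₂ : NNReal}
    (h₁ : LipschitzWith K₁ P₁) (h₂ : LipschitzWith K₂ P₂) : ∃ K, LipschitzWith K F := by
  have e : F = fun z => L z + M₁ (P₁ (π₁ z)) + M₂ (P₂ (π₂ z)) := funext h.eq
  rw [e]
  exact ⟨_, (L.lipschitz.add (M₁.lipschitz.comp (h₁.comp π₁.lipschitz))).add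
    (M₂.lipschitz.comp (h₂.comp π₂.lipschitz))⟩

lemma norm_apply_le {M : Y₁ →L[ℝ] Z'} {π : Z →L[ℝ] Y₁} {C : ℝ} {y : Y₁} {δ : Z}
    (h : ‖y‖ ≤ C * ‖π δ‖ ^ 2) : ‖M y‖ ≤ ‖M‖ * (|C| * ‖π‖ ^ 2) * ‖δ‖ ^ 2 :=
  calc ‖M y‖ ≤ ‖M‖ * ‖y‖ := M.le_opNorm _
    _ ≤ ‖M‖ * (C * ‖π δ‖ ^ 2) := by gcongr
    _ ≤ ‖M‖ * (|C| * (‖π‖ * ‖δ‖) ^ 2) := by gcongr; exacts [le_abs_self C, π.le_opNorm δ]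
    _ = _ := by ring

lemma quadApprox (h : IsSplit F P₁ P₂ L M₁ π₁ M₂ π₂ N₁ s₁ N₂ s₂) (h₁ : QuadApprox P₁)
    (h₂ : QuadApprox P₂) : QuadApprox F := by
  intro z
  obtain ⟨C₁, hC₁⟩ := h₁ (π₁ z)
  obtain ⟨C₂, hC₂⟩ := h₂ (π₂ z)
  refine ⟨‖M₁‖ * (|C₁| * ‖π₁‖ ^ 2) + ‖M₂‖ * (|C₂| * ‖π₂‖ ^ 2), ?_⟩
  filter_upwards [(π₁.continuous.tendsto z).eventually hC₁,
    (π₂.continuous.tendsto z).eventually hC₂] with w hw₁ hw₂ hF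
  have e₁ := hw₁ (h.differentiableAt₁ hF)
  have e₂ := hw₂ (h.differentiableAt₂ hF)
  rw [← map_sub] at e₁ e₂
  have e : F w - F z - fderiv ℝ F w (w - z)
      = M₁ (P₁ (π₁ w) - P₁ (π₁ z) - fderiv ℝ P₁ (π₁ w) (π₁ (w - z)))
        + M₂ (P₂ (π₂ w) - P₂ (π₂ z) - fderiv ℝ P₂ (π₂ w) (π₂ (w - z))) := by
    rw [h.fderiv_eq hF, h.eq, h.eq z]
    simp only [map_sub]
    abel
  rw [e, add_mul]
  exact (norm_add_le _ _).trans (add_le_add (norm_apply_le e₁) (norm_apply_le e₂))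

lemma jacobianLimit (h : IsSplit F P₁ P₂ L M₁ π₁ M₂ π₂ N₁ s₁ N₂ s₂) {z d : Z} {l₁ : Y₁} {l₂ : Y₂}
    (h₁ : JacobianLimit P₁ (π₁ z) (π₁ d) l₁) (h₂ : JacobianLimit P₂ (π₂ z) (π₂ d) l₂) :
    JacobianLimit F z d (L d + M₁ l₁ + M₂ l₂) := by
  set Fl := (𝓝[>] (0 : ℝ) ×ˢ 𝓝 d) ⊓ 𝓟 {p | DifferentiableAt ℝ F (z + p.1 • p.2)} with hFl
  have ht : Tendsto (fun p : ℝ × Z => p.1) Fl (𝓝[>] 0) := tendsto_fst.mono_left inf_le_left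
  have hd : Tendsto (fun p : ℝ × Z => p.2) Fl (𝓝 d) := tendsto_snd.mono_left inf_le_left
  have hdiff : ∀ᶠ p in Fl, DifferentiableAt ℝ F (z + p.1 • p.2) :=
    mem_inf_of_right (mem_principal_self _)
  have t₁ : Tendsto (fun p : ℝ × Z => (p.1, π₁ p.2)) Fl ((𝓝[>] (0 : ℝ) ×ˢ 𝓝 (π₁ d))
      ⊓ 𝓟 {p | DifferentiableAt ℝ P₁ (π₁ z + p.1 • p.2)}) := by
    refine tendsto_inf.2 ⟨ht.prodMk ((π₁.continuous.tendsto d).comp hd), tendsto_principal.2 ?_⟩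
    filter_upwards [hdiff] with p hp
    simpa using h.differentiableAt₁ hp
  have t₂ : Tendsto (fun p : ℝ × Z => (p.1, π₂ p.2)) Fl ((𝓝[>] (0 : ℝ) ×ˢ 𝓝 (π₂ d))
      ⊓ 𝓟 {p | DifferentiableAt ℝ P₂ (π₂ z + p.1 • p.2)}) := by
    refine tendsto_inf.2 ⟨ht.prodMk ((π₂.continuous.tendsto d).comp hd), tendsto_principal.2 ?_⟩
    filter_upwards [hdiff] with p hp
    simpa using h.differentiableAt₂ hp
  have hlim := (((L.continuous.tendsto d).comp hd).add
    ((M₁.continuous.tendsto l₁).comp (Tendsto.comp h₁ t₁))).add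
    ((M₂.continuous.tendsto l₂).comp (Tendsto.comp h₂ t₂))
  refine hlim.congr' ?_
  filter_upwards [hdiff] with p hp
  rw [h.fderiv_eq hp]
  simp

end IsSplit

end Splitting

end NewtonADMM

/-! ### The residual map and the nonnegative orthant -/

namespace NewtonADMM

section Embedding

variable {n : ℕ} {ι : Type*} [Fintype ι]

/-- The space of the variables `z = (ũ, u, v)`. -/
abbrev ResidualSpace (n : ℕ) (ι : Type*) :=
  EuclideanSpace ℝ (Idx n ι ⊕ Idx n ι ⊕ Idx n ι)

/-- The restriction of a vector along a map of index sets. -/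
noncomputable def pullback {κ κ' : Type*} [Fintype κ] [Fintype κ'] (σ : κ → κ') :
    EuclideanSpace ℝ κ' →L[ℝ] EuclideanSpace ℝ κ :=
  LinearMap.toContinuousLinearMap
    { toFun := fun x => WithLp.toLp 2 fun i => x (σ i)
      map_add' := fun _ _ => rfl
      map_smul' := fun _ _ => rfl }

@[simp] lemma pullback_apply {κ κ' : Type*} [Fintype κ] [Fintype κ'] (σ : κ → κ')
    (x : EuclideanSpace ℝ κ') (i : κ) : pullback σ x i = x (σ i) := rfl

/-- The vector of `ℝ^k` that has the given cone and scale components. -/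
noncomputable def embIdx (n : ℕ) (y : EuclideanSpace ℝ ι) (t : ℝ) : Idx n ι → ℝ :=
  Sum.elim 0 (Sum.elim y fun _ => t)

/-- The argument of the projection onto `K^*`: the cone component of `ũ - v`. -/
noncomputable def coneArg (n : ℕ) (ι : Type*) [Fintype ι] :
    ResidualSpace n ι →L[ℝ] EuclideanSpace ℝ ι :=
  pullback (fun i => .inl (.inr (.inl i))) - pullback (fun i => .inr (.inr (.inr (.inl i))))

/-- The argument of the projection onto `ℝ₊`: the scale component of `ũ - v`. -/
noncomputable def scaleArg (n : ℕ) (ι : Type*) [Fintype ι] : ResidualSpace n ι →L[ℝ] ℝ :=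
  EuclideanSpace.proj (.inl (.inr (.inr ()))) - EuclideanSpace.proj (.inr (.inr (.inr (.inr ()))))

/-- The vector whose `ũ` component is `(0, y, 0)` and whose other components vanish. -/
noncomputable def coneSection (n : ℕ) (ι : Type*) [Fintype ι] :
    EuclideanSpace ℝ ι →L[ℝ] ResidualSpace n ι :=
  LinearMap.toContinuousLinearMap
    { toFun := fun y => WithLp.toLp 2 (Sum.elim (embIdx n y 0) 0)
      map_add' := fun x y => by ext ((_ | _ | _) | _ | _) <;> simp [embIdx]
      map_smul' := fun c y => by ext ((_ | _ | _) | _ | _) <;> simp [embIdx] }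

/-- The vector whose `ũ` component is `(0, 0, t)` and whose other components vanish. -/
noncomputable def scaleSection (n : ℕ) (ι : Type*) [Fintype ι] : ℝ →L[ℝ] ResidualSpace n ι :=
  LinearMap.toContinuousLinearMap
    { toFun := fun t => WithLp.toLp 2 (Sum.elim (embIdx n 0 t) 0)
      map_add' := fun x y => by ext ((_ | _ | _) | _ | _) <;> simp [embIdx]
      map_smul' := fun c y => by ext ((_ | _ | _) | _ | _) <;> simp [embIdx] }

/-- The contribution `-(0, y, 0)` of the projection onto `K^*` to the second block of the
residual. -/
noncomputable def coneOut (n : ℕ) (ι : Type*) [Fintype ι] :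
    EuclideanSpace ℝ ι →L[ℝ] ResidualSpace n ι :=
  LinearMap.toContinuousLinearMap
    { toFun := fun y => WithLp.toLp 2 (Sum.elim 0 (Sum.elim (-embIdx n y 0) 0))
      map_add' := fun x y => by ext (_ | (_ | _ | _) | _) <;> simp [embIdx, add_comm]
      map_smul' := fun c y => by ext (_ | (_ | _ | _) | _) <;> simp [embIdx] }

/-- The contribution `-(0, 0, t)` of the projection onto `ℝ₊` to the second block of the
residual. -/
noncomputable def scaleOut (n : ℕ) (ι : Type*) [Fintype ι] : ℝ →L[ℝ] ResidualSpace n ι :=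
  LinearMap.toContinuousLinearMap
    { toFun := fun t => WithLp.toLp 2 (Sum.elim 0 (Sum.elim (-embIdx n 0 t) 0))
      map_add' := fun x y => by ext (_ | (_ | _ | _) | _) <;> simp [embIdx, add_comm]
      map_smul' := fun c y => by ext (_ | (_ | _ | _) | _) <;> simp [embIdx] }

/-- The residual map with the projections onto `K^*` and `ℝ₊` removed. -/
noncomputable def linearPart [DecidableEq ι] (A : Matrix ι (Fin n) ℝ) (b : ι → ℝ) (c : Fin n → ℝ) :
    ResidualSpace n ι →L[ℝ] ResidualSpace n ι :=
  LinearMap.toContinuousLinearMap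
    { toFun := fun z => WithLp.toLp 2
        (Sum.elim (fun i => ((1 + embQ A b c).mulVec fun j => z (.inl j)) i
            - (z (.inr (.inl i)) + z (.inr (.inr i))))
          (Sum.elim (fun i => z (.inr (.inl i))
              - Sum.elim (fun j => z (.inl (.inl j)) - z (.inr (.inr (.inl j)))) 0 i)
            (fun i => z (.inl i) - z (.inr (.inl i)))))
      map_add' := fun x y => by
        ext (i | (i | i) | i)
        · have := congrFun (Matrix.mulVec_add (1 + embQ A b c) (fun j => x (.inl j))
            (fun j => y (.inl j))) i
          simp only [Pi.add_apply] at this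
          simp only [PiLp.add_apply, Sum.elim_inl]
          rw [← sub_eq_zero] at this ⊢
          refine Eq.trans ?_ this
          simp only [Pi.add_def]
          ring
        all_goals simp; try ring
      map_smul' := fun r x => by
        ext (i | (i | i) | i)
        · have := congrFun (Matrix.mulVec_smul (1 + embQ A b c) r (fun j => x (.inl j))) i
          simp only [Pi.smul_apply, smul_eq_mul] at this
          simp only [PiLp.smul_apply, Sum.elim_inl, smul_eq_mul, RingHom.id_apply]
          rw [← sub_eq_zero] at this ⊢
          refine Eq.trans ?_ this
          simp only [Pi.smul_def, smul_eq_mul]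
          ring
        all_goals simp; try ring }

/-- The projection onto `C` acts componentwise. -/
lemma proj_coneC {K : Set (EuclideanSpace ℝ ι)} {P : EuclideanSpace ℝ ι → EuclideanSpace ℝ ι}
    (hP : IsProjOn (ProperCone.innerDual K : Set (EuclideanSpace ℝ ι)) P)
    (u : EuclideanSpace ℝ (Idx n ι)) :
    proj (coneC n K) u = WithLp.toLp 2 (Sum.elim (fun i => u (.inl i))
      (Sum.elim (P (WithLp.toLp 2 fun i => u (.inr (.inl i))))
        fun _ => max (u (.inr (.inr ()))) 0)) := by
  set y : EuclideanSpace ℝ ι := WithLp.toLp 2 fun i => u (.inr (.inl i))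
  refine proj_eq_of_inner_le ⟨(hP y).1, le_max_right _ _⟩ fun q hq => ?_
  have h1 := (hP y).2 _ hq.1
  have h2 := hq.2
  simp only [PiLp.inner_apply, Fintype.sum_sum_type, PiLp.sub_apply, Sum.elim_inl, Sum.elim_inr,
    sub_self, mul_zero, Finset.sum_const_zero, zero_add, Finset.univ_unique,
    Finset.sum_singleton, RCLike.inner_apply, conj_trivial] at h1 ⊢
  have h3 : (q (.inr (.inr ())) - max (u (.inr (.inr ()))) 0)
      * (u (.inr (.inr ())) - max (u (.inr (.inr ()))) 0) ≤ 0 := by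
    rcases le_total (u (.inr (.inr ()))) 0 with h | h
    · rw [max_eq_right h]
      nlinarith
    · rw [max_eq_left h]
      simp
  exact add_nonpos h1 h3

lemma isSplit_admmF [DecidableEq ι] {K : Set (EuclideanSpace ℝ ι)}
    {P : EuclideanSpace ℝ ι → EuclideanSpace ℝ ι}
    (hP : IsProjOn (ProperCone.innerDual K : Set (EuclideanSpace ℝ ι)) P)
    (A : Matrix ι (Fin n) ℝ) (b : ι → ℝ) (c : Fin n → ℝ) :
    IsSplit (admmF K A b c) P (fun t : ℝ => max t 0) (linearPart A b c)
      (coneOut n ι) (coneArg n ι) (scaleOut n ι) (scaleArg n ι)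
      (-pullback fun i => .inr (.inl (.inr (.inl i)))) (coneSection n ι)
      (-EuclideanSpace.proj (.inr (.inl (.inr (.inr ()))))) (scaleSection n ι) where
  eq z := by
    have hy : (WithLp.toLp 2 fun i => z (.inl (.inr (.inl i))) - z (.inr (.inr (.inr (.inl i))))
        : EuclideanSpace ℝ ι) = coneArg n ι z := rfl
    ext (i | (i | i | i) | i)
    · simp [admmF, linearPart, coneOut, scaleOut]
    · simp [admmF, linearPart, coneOut, scaleOut, proj_coneC hP, embIdx]
    · simp [admmF, linearPart, coneOut, scaleOut, proj_coneC hP, embIdx, hy]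
      rw [sub_eq_add_neg]
    · simp [admmF, linearPart, coneOut, scaleOut, scaleArg, proj_coneC hP, embIdx, sub_eq_add_neg]
    · simp [admmF, linearPart, coneOut, scaleOut]
  section₁ y := by ext i; simp [coneArg, coneSection, embIdx]
  section₂ y := by simp [scaleArg, scaleSection, embIdx]
  retract₁₁ y := by ext i; simp [coneOut, embIdx]
  retract₁₂ y := by ext i; simp [scaleOut, embIdx]
  retract₂₁ y := by simp [coneOut, embIdx]
  retract₂₂ y := by simp [scaleOut, embIdx]

theorem stronglySemismooth_admmF [DecidableEq ι] {K : Set (EuclideanSpace ℝ ι)}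
    {P : EuclideanSpace ℝ ι → EuclideanSpace ℝ ι}
    (hP : IsProjOn (ProperCone.innerDual K : Set (EuclideanSpace ℝ ι)) P) (hQ : QuadApprox P)
    (A : Matrix ι (Fin n) ℝ) (b : ι → ℝ) (c : Fin n → ℝ) :
    StronglySemismooth (admmF K A b c) := by
  have h := isSplit_admmF hP A b c
  obtain ⟨L, hL⟩ := h.exists_lipschitzWith hP.lipschitzWith lipschitzWith_max
  exact (h.quadApprox hQ quadApprox_max).stronglySemismooth hL

theorem semismooth_admmF [DecidableEq ι] {K : Set (EuclideanSpace ℝ ι)}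
    {P : EuclideanSpace ℝ ι → EuclideanSpace ℝ ι}
    (hP : IsProjOn (ProperCone.innerDual K : Set (EuclideanSpace ℝ ι)) P)
    (hJ : ∀ z d, ∃ l, JacobianLimit P z d l)
    (A : Matrix ι (Fin n) ℝ) (b : ι → ℝ) (c : Fin n → ℝ) :
    Semismooth (admmF K A b c) := by
  have h := isSplit_admmF hP A b c
  obtain ⟨L, hL⟩ := h.exists_lipschitzWith hP.lipschitzWith lipschitzWith_max
  refine semismooth_of_jacobianLimit hL.locallyLipschitz fun z d => ?_
  obtain ⟨l₁, h₁⟩ := hJ (coneArg n ι z) (coneArg n ι d)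
  obtain ⟨l₂, h₂⟩ := quadApprox_max.exists_jacobianLimit lipschitzWith_max
    (scaleArg n ι z) (scaleArg n ι d)
  exact ⟨_, h.jacobianLimit h₁ h₂⟩

end Embedding

lemma real_inner_eq_sum {ι : Type*} [Fintype ι] (x y : EuclideanSpace ℝ ι) :
    inner ℝ x y = ∑ i, x i * y i := by
  rw [PiLp.inner_apply]
  exact Finset.sum_congr rfl fun i _ => by simp [mul_comm]

section Orthant

variable {m : ℕ}

/-- The componentwise positive part. -/
noncomputable def orthantProj (m : ℕ) (w : EuclideanSpace ℝ (Fin m)) : EuclideanSpace ℝ (Fin m) :=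
  WithLp.toLp 2 fun i => max (w i) 0

lemma isProjOn_orthantProj :
    IsProjOn (ProperCone.innerDual (orthant m) : Set (EuclideanSpace ℝ (Fin m)))
      (orthantProj m) := by
  refine isProjOn_of_innerDual fun w => ⟨fun x hx => ?_, fun i => ?_, ?_⟩
  · change 0 ≤ inner ℝ x (orthantProj m w)
    rw [real_inner_eq_sum]
    exact Finset.sum_nonneg fun i _ => mul_nonneg (hx i) (le_max_right _ _)
  · simp [orthantProj]
  · rw [real_inner_eq_sum]
    refine Finset.sum_eq_zero fun i _ => ?_
    change (max (w i) 0 - w i) * max (w i) 0 = 0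
    rcases le_total (w i) 0 with h | h
    · simp [h]
    · simp [h]

lemma quadApprox_orthantProj : QuadApprox (orthantProj m) := by
  refine quadApprox_of_eventually_add (fun c hc w => ?_) fun z => ?_
  · ext i
    simp [orthantProj, mul_max_of_nonneg _ _ hc.le]
  · have h : ∀ i, ∀ᶠ w : EuclideanSpace ℝ (Fin m) in 𝓝 z, ∀ ε : ℝ, 0 < ε →
        max (w i + ε * z i) 0 = max (w i) 0 + ε * max (z i) 0 := fun i =>
      ((EuclideanSpace.proj (𝕜 := ℝ) i).continuous.tendsto z).eventually (eventually_max_add (z i))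
    filter_upwards [eventually_all.2 h] with w hw ε hε
    ext i
    simpa [orthantProj] using hw i ε hε

end Orthant

end NewtonADMM

/-! ### The second-order cone -/

namespace NewtonADMM

/-- The quadratic estimate for a `C²` map, with the derivative taken at the moving point. -/
lemma ContDiffAt.exists_taylor_bound {E G : Type*} [NormedAddCommGroup E] [NormedSpace ℝ E]
    [NormedAddCommGroup G] [NormedSpace ℝ G] {g : E → G} {z : E} (hg : ContDiffAt ℝ 2 g z) :
    ∃ C : ℝ, ∀ᶠ w in 𝓝 z, ‖g w - g z - fderiv ℝ g w (w - z)‖ ≤ C * ‖w - z‖ ^ 2 := by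
  have h1 : ContDiffAt ℝ 1 (fderiv ℝ g) z := hg.fderiv_right (by norm_num)
  obtain ⟨K, s, hs, hK⟩ := h1.exists_lipschitzOnWith
  have h2 : ∀ᶠ w in 𝓝 z, DifferentiableAt ℝ g w :=
    (hg.eventually (by simp)).mono fun w hw => hw.differentiableAt (by simp)
  obtain ⟨r, hr, hball⟩ := Metric.mem_nhds_iff.1 (inter_mem hs h2)
  refine ⟨2 * K, ?_⟩
  filter_upwards [Metric.ball_mem_nhds z hr] with w hw
  rw [Metric.mem_ball, dist_eq_norm] at hw
  have hsub : Metric.closedBall z ‖w - z‖ ⊆ Metric.ball z r := Metric.closedBall_subset_ball hw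
  have hwz : w ∈ Metric.closedBall z ‖w - z‖ := by simp [dist_eq_norm]
  have hzz : z ∈ Metric.closedBall z ‖w - z‖ := by simp
  have := (convex_closedBall z ‖w - z‖).norm_image_sub_le_of_norm_hasFDerivWithin_le'
    (f := g) (f' := fderiv ℝ g) (φ := fderiv ℝ g w) (C := K * (2 * ‖w - z‖))
    (fun x hx => (hball (hsub hx)).2.hasFDerivAt.hasFDerivWithinAt)
    (fun x hx => ?_) hzz hwz
  · calc _ ≤ _ := this
      _ = _ := by ring
  · refine (hK.norm_sub_le (hball (hsub hx)).1 (hball (hsub hwz)).1).trans ?_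
    gcongr
    rw [Metric.mem_closedBall, dist_eq_norm] at hx
    calc ‖x - w‖ = ‖(x - z) - (w - z)‖ := by congr 1; abel
      _ ≤ ‖x - z‖ + ‖w - z‖ := norm_sub_le _ _
      _ ≤ 2 * ‖w - z‖ := by linarith

section Lorentz

variable {E : Type*} [NormedAddCommGroup E] [InnerProductSpace ℝ E]

/-- The component of `w` orthogonal to the unit vector `e`. -/
noncomputable def orthComp (e : E) : E →L[ℝ] E :=
  ContinuousLinearMap.id ℝ E - (innerSL ℝ e).smulRight e

lemma orthComp_apply (e w : E) : orthComp e w = w - inner ℝ e w • e := rfl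

/-- The circular cone with axis `e`; for the last basis vector it is the second-order cone. -/
def lorentzCone (e : E) : Set E := {w | ‖orthComp e w‖ ≤ inner ℝ e w}

open Classical in
/-- The projection onto the circular cone with axis `e`. -/
noncomputable def lorentzProj (e w : E) : E :=
  if w ∈ lorentzCone e then w else if -w ∈ lorentzCone e then 0 else
    ((‖orthComp e w‖ + inner ℝ e w) / (2 * ‖orthComp e w‖)) • (orthComp e w + ‖orthComp e w‖ • e)

lemma isClosed_lorentzCone (e : E) : IsClosed (lorentzCone e) :=
  isClosed_le (by fun_prop) (by fun_prop)

lemma add_mem_lorentzCone {e v w : E} (hv : v ∈ lorentzCone e) (hw : w ∈ lorentzCone e) :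
    v + w ∈ lorentzCone e := by
  simp only [lorentzCone, Set.mem_ofPred_eq, map_add, inner_add_right] at *
  exact (norm_add_le _ _).trans (add_le_add hv hw)

lemma smul_mem_lorentzCone {e w : E} {c : ℝ} (hc : 0 ≤ c) (hw : w ∈ lorentzCone e) :
    c • w ∈ lorentzCone e := by
  simp only [lorentzCone, Set.mem_ofPred_eq, map_smul, inner_smul_right, norm_smul,
    Real.norm_eq_abs, abs_of_nonneg hc] at *
  exact mul_le_mul_of_nonneg_left hw hc

lemma inner_orthComp {e : E} (he : ‖e‖ = 1) (w : E) : inner ℝ e (orthComp e w) = 0 := by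
  rw [orthComp_apply, inner_sub_right, inner_smul_right, real_inner_self_eq_norm_sq, he]
  ring

lemma inner_eq_orthComp {e : E} (he : ‖e‖ = 1) (v w : E) :
    inner ℝ v w = inner ℝ (orthComp e v) (orthComp e w) + inner ℝ e v * inner ℝ e w := by
  simp only [orthComp_apply, inner_sub_left, inner_sub_right, inner_smul_left, inner_smul_right,
    real_inner_self_eq_norm_sq, he, real_inner_comm e v, conj_trivial]
  ring

lemma inner_nonneg_of_mem_lorentzCone {e v w : E} (he : ‖e‖ = 1) (hv : v ∈ lorentzCone e)
    (hw : w ∈ lorentzCone e) : 0 ≤ inner ℝ v w := by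
  rw [inner_eq_orthComp he]
  have h1 := neg_le_of_abs_le (abs_real_inner_le_norm (orthComp e v) (orthComp e w))
  have h2 : ‖orthComp e v‖ * ‖orthComp e w‖ ≤ inner ℝ e v * inner ℝ e w :=
    mul_le_mul hv hw (norm_nonneg _) ((norm_nonneg _).trans hv)
  linarith

lemma orthComp_self {e : E} (he : ‖e‖ = 1) : orthComp e e = 0 := by
  rw [orthComp_apply, real_inner_self_eq_norm_sq, he]
  simp

lemma orthComp_orthComp {e : E} (he : ‖e‖ = 1) (w : E) :
    orthComp e (orthComp e w) = orthComp e w := by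
  rw [orthComp_apply e (orthComp e w), inner_orthComp he]
  simp

lemma abs_lt_of_not_mem_lorentzCone {e w : E} (h1 : w ∉ lorentzCone e) (h2 : -w ∉ lorentzCone e) :
    |inner ℝ e w| < ‖orthComp e w‖ := by
  simp only [lorentzCone, Set.mem_ofPred_eq, map_neg, norm_neg, inner_neg_right, not_le] at h1 h2
  exact abs_lt.2 ⟨by linarith, h1⟩

lemma isProjOn_lorentzProj [CompleteSpace E] {e : E} (he : ‖e‖ = 1) :
    IsProjOn (ProperCone.innerDual (lorentzCone e) : Set E) (lorentzProj e) := by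
  refine isProjOn_of_innerDual fun w => ?_
  suffices h : lorentzProj e w ∈ lorentzCone e ∧ lorentzProj e w - w ∈ lorentzCone e
      ∧ inner ℝ (lorentzProj e w - w) (lorentzProj e w) = 0 from
    ⟨fun v hv => inner_nonneg_of_mem_lorentzCone he hv h.1, h.2⟩
  have h0 : (0 : E) ∈ lorentzCone e := by simp [lorentzCone]
  rw [lorentzProj]
  split_ifs with h1 h2
  · simp [h1, h0]
  · simp [h2, h0]
  · have h3 := abs_lt.1 (abs_lt_of_not_mem_lorentzCone h1 h2)
    set t := inner ℝ e w
    set x := orthComp e w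
    have hx : 0 < ‖x‖ := by linarith [h3.1, h3.2]
    have hee : inner ℝ e e = (1 : ℝ) := by rw [real_inner_self_eq_norm_sq, he, one_pow]
    have hO : orthComp e (((‖x‖ + t) / (2 * ‖x‖)) • (x + ‖x‖ • e))
        = ((‖x‖ + t) / (2 * ‖x‖)) • x := by
      rw [map_smul, map_add, map_smul, orthComp_self he, orthComp_orthComp he]
      simp [x]
    have hI : inner ℝ e (((‖x‖ + t) / (2 * ‖x‖)) • (x + ‖x‖ • e)) = (‖x‖ + t) / 2 := by
      rw [inner_smul_right, inner_add_right, inner_smul_right, inner_orthComp he, hee]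
      field_simp
      ring
    have hO' : orthComp e (((‖x‖ + t) / (2 * ‖x‖)) • (x + ‖x‖ • e) - w)
        = ((t - ‖x‖) / (2 * ‖x‖)) • x := by
      rw [map_sub, hO, show orthComp e w = (1 : ℝ) • x from (one_smul _ _).symm, ← sub_smul]
      congr 1
      field_simp
      ring
    have hI' : inner ℝ e (((‖x‖ + t) / (2 * ‖x‖)) • (x + ‖x‖ • e) - w) = (‖x‖ - t) / 2 := by
      rw [inner_sub_right, hI]
      ring
    refine ⟨?_, ?_, ?_⟩
    · simp only [lorentzCone, Set.mem_ofPred_eq, hO, hI, norm_smul, Real.norm_eq_abs]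
      rw [abs_of_nonneg (div_nonneg (by linarith) (by positivity))]
      apply le_of_eq
      field_simp
    · simp only [lorentzCone, Set.mem_ofPred_eq, hO', hI', norm_smul, Real.norm_eq_abs]
      rw [abs_of_nonpos (div_nonpos_of_nonpos_of_nonneg (by linarith) (by positivity))]
      apply le_of_eq
      field_simp
      ring
    · rw [inner_eq_orthComp he, hO, hO', hI, hI', inner_smul_left, inner_smul_right,
        real_inner_self_eq_norm_sq]
      simp only [conj_trivial]
      field_simp
      ring

lemma lorentzProj_eq_of_abs_le {e w : E} (hx : orthComp e w ≠ 0)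
    (h : |inner ℝ e w| ≤ ‖orthComp e w‖) :
    lorentzProj e w = ((‖orthComp e w‖ + inner ℝ e w) / (2 * ‖orthComp e w‖)) •
      (orthComp e w + ‖orthComp e w‖ • e) := by
  have hx' : 0 < ‖orthComp e w‖ := norm_pos_iff.2 hx
  have h' := abs_le.1 h
  rw [lorentzProj]
  split_ifs with h1 h2
  · have ht : inner ℝ e w = ‖orthComp e w‖ := le_antisymm h'.2 h1
    have : (‖orthComp e w‖ + ‖orthComp e w‖) / (2 * ‖orthComp e w‖) = 1 := by field_simp; ring
    rw [ht, this, one_smul, ← ht, orthComp_apply, sub_add_cancel]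
  · simp only [lorentzCone, Set.mem_ofPred_eq, map_neg, norm_neg, inner_neg_right] at h2
    have ht : inner ℝ e w = -‖orthComp e w‖ := by linarith [h'.1]
    rw [ht]
    simp
  · rfl

/-- On the two cones where `P` is linear the identity `DP(w) z = P z` is exact near `z`; on the open
region between them `P` is given by a smooth formula. -/
lemma quadApprox_lorentzProj [CompleteSpace E] {e : E} (he : ‖e‖ = 1) :
    QuadApprox (lorentzProj e) := by
  have hom : ∀ c : ℝ, 0 < c → ∀ w, lorentzProj e (c • w) = c • lorentzProj e w :=
    fun c hc w => (isProjOn_lorentzProj he).smul hc w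
  have hcone : ∀ w ∈ lorentzCone e, lorentzProj e w = w := fun w hw => by
    rw [lorentzProj, if_pos hw]
  have hpolar : ∀ w, -w ∈ lorentzCone e → lorentzProj e w = 0 := fun w hw => by
    rw [lorentzProj]
    split_ifs with h1
    · have := inner_nonneg_of_mem_lorentzCone he h1 hw
      rw [inner_neg_right, real_inner_self_eq_norm_sq] at this
      exact norm_eq_zero.1 (pow_eq_zero_iff two_ne_zero |>.1
        (le_antisymm (by linarith) (sq_nonneg _)))
    · rfl
  refine quadApprox_of_homogeneous hom fun z => ?_
  set g : E → E := fun w => ((‖orthComp e w‖ + inner ℝ e w) / (2 * ‖orthComp e w‖)) •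
      (orthComp e w + ‖orthComp e w‖ • e) with hg
  -- Points between the two cones are relevant only if `z` is in the closure of that region.
  have hmid : ∃ C : ℝ, 0 ≤ C ∧ ∀ᶠ w in 𝓝 z, |inner ℝ e w| < ‖orthComp e w‖ →
      DifferentiableAt ℝ (lorentzProj e) w →
      ‖fderiv ℝ (lorentzProj e) w z - lorentzProj e z‖ ≤ C * ‖w - z‖ ^ 2 := by
    rcases eq_or_ne z 0 with rfl | hz
    · refine ⟨0, le_rfl, Eventually.of_forall fun w _ _ => ?_⟩
      rw [hcone 0 (by simp [lorentzCone])]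
      simp
    rcases lt_or_ge ‖orthComp e z‖ |inner ℝ e z| with hlt | hle
    · refine ⟨0, le_rfl, ?_⟩
      have h1 : Continuous fun w : E => ‖orthComp e w‖ := by fun_prop
      have h2 : Continuous fun w : E => |inner ℝ e w| := by fun_prop
      filter_upwards [(h1.tendsto z).eventually_lt (h2.tendsto z) hlt] with w hw hw'
      exact absurd hw hw'.not_gt
    · have hx : orthComp e z ≠ 0 := by
        intro h0
        rw [h0, norm_zero] at hle
        have h1 : inner ℝ e z = (0 : ℝ) := abs_eq_zero.1 (le_antisymm hle (abs_nonneg _))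
        rw [orthComp_apply, h1, zero_smul, sub_zero] at h0
        exact hz h0
      have hn : ContDiffAt ℝ 2 (fun w => ‖orthComp e w‖) z :=
        (orthComp e).contDiff.contDiffAt.norm ℝ hx
      have hcd : ContDiffAt ℝ 2 g z := by
        refine ((hn.add (contDiffAt_const.inner ℝ contDiffAt_id)).div
          (contDiffAt_const.mul hn) (by simpa using hx)).smul
          ((orthComp e).contDiff.contDiffAt.add (hn.smul contDiffAt_const))
      obtain ⟨C, hC⟩ := ContDiffAt.exists_taylor_bound hcd
      refine ⟨max C 0, le_max_right _ _, ?_⟩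
      filter_upwards [hC] with w hw hmw hd
      have hPg : lorentzProj e =ᶠ[𝓝 w] g := by
        have h1 : Continuous fun w : E => ‖orthComp e w‖ := by fun_prop
        have h2 : Continuous fun w : E => |inner ℝ e w| := by fun_prop
        filter_upwards [(h2.tendsto w).eventually_lt (h1.tendsto w) hmw] with v hv
        exact lorentzProj_eq_of_abs_le (norm_pos_iff.1 ((abs_nonneg _).trans_lt hv)) hv.le
      have hE : fderiv ℝ (lorentzProj e) w w = lorentzProj e w :=
        fderiv_self_of_homogeneous hom hd
      rw [hPg.fderiv_eq, hPg.eq_of_nhds] at hE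
      rw [lorentzProj_eq_of_abs_le hx hle, hPg.fderiv_eq]
      rw [map_sub, hE] at hw
      have e1 : g w - g z - (g w - fderiv ℝ g w z) = fderiv ℝ g w z - g z := by abel
      rw [e1] at hw
      exact hw.trans (mul_le_mul_of_nonneg_right (le_max_left _ _) (by positivity))
  obtain ⟨C, hC0, hC⟩ := hmid
  refine ⟨C, ?_⟩
  have hc1 : ∀ᶠ w in 𝓝 z, w ∈ lorentzCone e → z ∈ lorentzCone e := by
    by_cases h : z ∈ lorentzCone e
    · exact Eventually.of_forall fun _ _ => h
    · filter_upwards [(isClosed_lorentzCone e).isOpen_compl.mem_nhds h] with w hw hw'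
      exact absurd hw' hw
  have hc2 : ∀ᶠ w in 𝓝 z, -w ∈ lorentzCone e → -z ∈ lorentzCone e := by
    by_cases h : -z ∈ lorentzCone e
    · exact Eventually.of_forall fun _ _ => h
    · filter_upwards [((isClosed_lorentzCone e).preimage continuous_neg).isOpen_compl.mem_nhds h]
        with w hw hw'
      exact absurd hw' hw
  filter_upwards [hC, hc1, hc2] with w hCw h1 h2 hd
  by_cases hw1 : w ∈ lorentzCone e
  · have hz := h1 hw1
    rw [fderiv_eq_of_eventually hd (k := lorentzProj e z), sub_self, norm_zero]
    · positivity
    filter_upwards [self_mem_nhdsWithin] with ε hε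
    rw [hcone w hw1, hcone z hz,
      hcone _ (add_mem_lorentzCone hw1 (smul_mem_lorentzCone (le_of_lt hε) hz))]
  by_cases hw2 : -w ∈ lorentzCone e
  · have hz := h2 hw2
    rw [fderiv_eq_of_eventually hd (k := lorentzProj e z), sub_self, norm_zero]
    · positivity
    filter_upwards [self_mem_nhdsWithin] with ε hε
    rw [hpolar w hw2, hpolar z hz, hpolar]
    · simp
    · rw [neg_add, ← smul_neg]
      exact add_mem_lorentzCone hw2 (smul_mem_lorentzCone (le_of_lt hε) hz)
  · exact hCw (abs_lt_of_not_mem_lorentzCone hw1 hw2) hd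

end Lorentz

lemma secondOrderCone_eq (m : ℕ) :
    secondOrderCone m = lorentzCone (EuclideanSpace.single (Fin.last m) (1 : ℝ)) := by
  ext w
  have h1 : inner ℝ (EuclideanSpace.single (Fin.last m) (1 : ℝ)) w = w (Fin.last m) := by
    simp [EuclideanSpace.inner_single_left]
  have h2 : ‖orthComp (EuclideanSpace.single (Fin.last m) (1 : ℝ)) w‖
      = √(∑ i : Fin m, w i.castSucc ^ 2) := by
    rw [EuclideanSpace.norm_eq, Fin.sum_univ_castSucc, orthComp_apply, h1]
    congr 1
    simp [(Fin.castSucc_lt_last _).ne]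
  simp only [secondOrderCone, lorentzCone, Set.mem_ofPred_eq, h1, h2]

lemma norm_single_last (m : ℕ) : ‖EuclideanSpace.single (Fin.last m) (1 : ℝ)‖ = 1 := by simp

end NewtonADMM

/-! ### Operators with an absolute value -/

namespace NewtonADMM

section Operators

variable {V : Type*} [NormedAddCommGroup V] [InnerProductSpace ℝ V]

section Diagonal

variable {ι : Type*} [Fintype ι]

/-- The operator with eigenbasis `b` and eigenvalues `s`. -/
noncomputable def diagOp (b : OrthonormalBasis ι ℝ V) (s : ι → ℝ) : V →L[ℝ] V :=
  ∑ i, s i • (innerSL ℝ (b i)).smulRight (b i)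

lemma diagOp_apply (b : OrthonormalBasis ι ℝ V) (s : ι → ℝ) (x : V) :
    diagOp b s x = ∑ i, (s i * inner ℝ (b i) x) • b i := by
  simp [diagOp, smul_smul]

lemma diagOp_basis (b : OrthonormalBasis ι ℝ V) (s : ι → ℝ) (j : ι) :
    diagOp b s (b j) = s j • b j := by
  classical
  rw [diagOp_apply, Finset.sum_eq_single j]
  · simp
  · intro i _ hij
    simp [b.inner_eq_ite, hij]
  · simp

lemma inner_diagOp (b : OrthonormalBasis ι ℝ V) (s : ι → ℝ) (x y : V) :
    inner ℝ (diagOp b s x) y = ∑ i, s i * inner ℝ (b i) x * inner ℝ (b i) y := by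
  simp [diagOp_apply, sum_inner, inner_smul_left]

lemma diagOp_isPositive (b : OrthonormalBasis ι ℝ V) {s : ι → ℝ} (hs : ∀ i, 0 ≤ s i) :
    (diagOp b s).IsPositive := by
  refine (ContinuousLinearMap.isPositive_iff _).2 ⟨fun x y => ?_, fun x => ?_⟩
  · change inner ℝ (diagOp b s x) y = inner ℝ x (diagOp b s y)
    rw [real_inner_comm (diagOp b s y) x, inner_diagOp, inner_diagOp]
    exact Finset.sum_congr rfl fun i _ => by ring
  · rw [inner_diagOp]
    refine Finset.sum_nonneg fun i _ => ?_
    rw [mul_assoc]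
    exact mul_nonneg (hs i) (mul_self_nonneg _)

lemma eq_of_basis (b : OrthonormalBasis ι ℝ V) {S S' : V →L[ℝ] V} (h : ∀ i, S (b i) = S' (b i)) :
    S = S' := by
  ext x
  have : (S : V →ₗ[ℝ] V) = S' := b.toBasis.ext fun i => by simpa using h i
  exact congrArg (fun f : V →ₗ[ℝ] V => f x) this

lemma eq_diagOp (b : OrthonormalBasis ι ℝ V) {s : ι → ℝ} {S : V →L[ℝ] V}
    (h : ∀ i, S (b i) = s i • b i) : S = diagOp b s :=
  eq_of_basis b fun i => by rw [h, diagOp_basis]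

lemma norm_le_of_entries (b : OrthonormalBasis ι ℝ V) {Y : V →L[ℝ] V} {κ : ℝ}
    (h : ∀ i j, |inner ℝ (b i) (Y (b j))| ≤ κ) : ‖Y‖ ≤ (Fintype.card ι) ^ 2 * |κ| := by
  refine Y.opNorm_le_bound (by positivity) fun x => ?_
  have hcol : ∀ j, ‖Y (b j)‖ ≤ Fintype.card ι * |κ| := by
    intro j
    rw [← b.sum_repr' (Y (b j))]
    refine (norm_sum_le _ _).trans ?_
    calc ∑ i, ‖inner ℝ (b i) (Y (b j)) • b i‖ ≤ ∑ _i : ι, |κ| := by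
          refine Finset.sum_le_sum fun i _ => ?_
          rw [norm_smul, b.norm_eq_one, mul_one]
          exact (h i j).trans (le_abs_self _)
      _ = _ := by simp
  conv_lhs => rw [← b.sum_repr' x, map_sum]
  refine (norm_sum_le _ _).trans ?_
  calc ∑ j, ‖Y (inner ℝ (b j) x • b j)‖ ≤ ∑ _j : ι, ‖x‖ * (Fintype.card ι * |κ|) := by
        refine Finset.sum_le_sum fun j _ => ?_
        rw [map_smul, norm_smul]
        refine mul_le_mul ?_ (hcol j) (norm_nonneg _) (norm_nonneg _)
        have := abs_real_inner_le_norm (b j) x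
        rwa [b.norm_eq_one, one_mul] at this
    _ = _ := by simp; ring

end Diagonal

section Symmetric

variable [FiniteDimensional ℝ V]

lemma exists_eigenbasis {S : V →L[ℝ] V} (hS : (S : V →ₗ[ℝ] V).IsSymmetric) :
    ∃ (b : OrthonormalBasis (Fin (Module.finrank ℝ V)) ℝ V) (s : Fin (Module.finrank ℝ V) → ℝ),
      ∀ i, S (b i) = s i • b i :=
  ⟨hS.eigenvectorBasis rfl, hS.eigenvalues rfl, fun i => hS.apply_eigenvectorBasis rfl i⟩

/-- A symmetric operator has a generalized inverse commuting with it. -/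
lemma exists_generalized_inverse {S : V →L[ℝ] V} (hS : (S : V →ₗ[ℝ] V).IsSymmetric) :
    ∃ W : V →L[ℝ] V, (∀ x, S x = W (S (S x))) ∧ ∀ x, S x = S (W (S x)) := by
  obtain ⟨b, s, hb⟩ := exists_eigenbasis hS
  have h1 : ∀ i, (s i)⁻¹ * (s i * s i) = s i := fun i => by
    rcases eq_or_ne (s i) 0 with h | h
    · simp [h]
    · field_simp
  refine ⟨diagOp b fun i => (s i)⁻¹, fun x => ?_, fun x => ?_⟩
  · have : S = (diagOp b fun i => (s i)⁻¹) ∘L S ∘L S := eq_of_basis b fun i => by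
      simp only [ContinuousLinearMap.comp_apply, hb, map_smul, diagOp_basis, smul_smul]
      congr 1
      linear_combination -(h1 i)
    exact congrArg (fun f : V →L[ℝ] V => f x) this
  · have : S = S ∘L (diagOp b fun i => (s i)⁻¹) ∘L S := eq_of_basis b fun i => by
      simp only [ContinuousLinearMap.comp_apply, hb, map_smul, diagOp_basis, smul_smul]
      congr 1
      linear_combination -(h1 i)
    exact congrArg (fun f : V →L[ℝ] V => f x) this

end Symmetric

lemma norm_apply_eq {A S : V →L[ℝ] V} (hA : (A : V →ₗ[ℝ] V).IsSymmetric)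
    (hS : (S : V →ₗ[ℝ] V).IsSymmetric) {x : V} (h : A (A x) = S (S x)) : ‖A x‖ = ‖S x‖ := by
  have h1 : inner ℝ (A x) (A x) = inner ℝ x (A (A x)) := hA x (A x)
  have h2 : inner ℝ (S x) (S x) = inner ℝ x (S (S x)) := hS x (S x)
  rw [h, ← h2, real_inner_self_eq_norm_sq, real_inner_self_eq_norm_sq] at h1
  exact (sq_eq_sq₀ (norm_nonneg _) (norm_nonneg _)).1 h1

lemma apply_eq_abs_smul {A : V →L[ℝ] V} (hA : A.IsPositive) {a : ℝ} {u : V}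
    (h : A (A u) = (a * a) • u) : A u = |a| • u := by
  have hsym := hA.isSymmetric
  rcases eq_or_ne a 0 with rfl | ha
  · have h1 : inner ℝ (A u) (A u) = inner ℝ u (A (A u)) := hsym u (A u)
    rw [h] at h1
    simpa using h1
  · set v := A u - |a| • u with hv
    have h1 : A v = -(|a| • v) := by
      rw [hv, map_sub, map_smul, h, smul_sub, smul_smul, abs_mul_abs_self]
      abel
    have h2 := ((ContinuousLinearMap.isPositive_iff A).1 hA).2 v
    rw [h1, inner_neg_left, inner_smul_left, real_inner_self_eq_norm_sq] at h2
    have h3 : 0 < |a| := abs_pos.2 ha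
    have h4 : ‖v‖ ^ 2 ≤ 0 := by
      simp only [conj_trivial] at h2
      nlinarith [sq_nonneg ‖v‖]
    exact sub_eq_zero.1 (norm_eq_zero.1 (pow_eq_zero_iff two_ne_zero |>.1
      (le_antisymm h4 (sq_nonneg _))))

lemma IsPositive.eq_of_sq_eq [FiniteDimensional ℝ V] {A B : V →L[ℝ] V} (hA : A.IsPositive)
    (hB : B.IsPositive) (h : ∀ x, A (A x) = B (B x)) : A = B := by
  obtain ⟨b, s, hb⟩ := exists_eigenbasis hA.isSymmetric
  refine eq_of_basis b fun i => ?_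
  have h1 : A (A (b i)) = (s i * s i) • b i := by rw [hb, map_smul, hb, smul_smul]
  rw [apply_eq_abs_smul hA h1, apply_eq_abs_smul hB (by rw [← h, h1])]

/-- `A` is the map `w ↦ |T w|`, where `T` takes symmetric values. -/
structure IsAbs {E : Type*} [NormedAddCommGroup E] [NormedSpace ℝ E]
    (T : E →L[ℝ] V →L[ℝ] V) (A : E → V →L[ℝ] V) : Prop where
  symm : ∀ w, (T w : V →ₗ[ℝ] V).IsSymmetric
  pos : ∀ w, (A w).IsPositive
  sq : ∀ w x, A w (A w x) = T w (T w x)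

namespace IsAbs

variable {E : Type*} [NormedAddCommGroup E] [NormedSpace ℝ E]
  {T : E →L[ℝ] V →L[ℝ] V} {A : E → V →L[ℝ] V}

lemma eq_of_sq [FiniteDimensional ℝ V] (h : IsAbs T A) {w : E} {B : V →L[ℝ] V} (hB : B.IsPositive)
    (hsq : ∀ x, B (B x) = T w (T w x)) : A w = B :=
  IsPositive.eq_of_sq_eq (h.pos w) hB fun x => by rw [h.sq, hsq]

lemma smul [FiniteDimensional ℝ V] (h : IsAbs T A) {c : ℝ} (hc : 0 < c) (w : E) :
    A (c • w) = c • A w := by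
  refine h.eq_of_sq ((h.pos w).smul_of_nonneg hc.le) fun x => ?_
  simp [h.sq]

lemma norm_apply (h : IsAbs T A) (w : E) (x : V) : ‖A w x‖ = ‖T w x‖ :=
  norm_apply_eq (h.pos w).isSymmetric (h.symm w) (h.sq w x)

/-- If `u` is in the kernel of `T w`, then `|T w + ε u uᵀ| = |T w| + |ε| u uᵀ`, which is not
differentiable at `ε = 0` unless `u = 0`. -/
lemma eq_zero_of_differentiableAt [FiniteDimensional ℝ V] (h : IsAbs T A)
    (hrank : ∀ u : V, ∃ k : E, T k = (innerSL ℝ u).smulRight u) {w : E}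
    (hd : DifferentiableAt ℝ A w) {u : V} (hu : T w u = 0) : u = 0 := by
  obtain ⟨k, hk⟩ := hrank u
  set U : V →L[ℝ] V := (innerSL ℝ u).smulRight u with hU
  have hUx : ∀ x, U x = inner ℝ u x • u := fun x => rfl
  have hAu : A w u = 0 := by
    have := h.norm_apply w u
    rw [hu, norm_zero] at this
    exact norm_eq_zero.1 this
  have hUpos : U.IsPositive := by
    refine (ContinuousLinearMap.isPositive_iff _).2 ⟨fun x y => ?_, fun x => ?_⟩
    · change inner ℝ (U x) y = inner ℝ x (U y)
      rw [hUx, hUx, inner_smul_left, inner_smul_right, real_inner_comm u x, conj_trivial]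
      ring
    · rw [hUx, inner_smul_left, conj_trivial]
      exact mul_self_nonneg _
  have hUT : ∀ x, inner ℝ u (T w x) = (0 : ℝ) := fun x => by
    have : inner ℝ (T w u) x = inner ℝ u (T w x) := h.symm w u x
    rw [← this, hu, inner_zero_left]
  have hUA : ∀ x, inner ℝ u (A w x) = (0 : ℝ) := fun x => by
    have : inner ℝ (A w u) x = inner ℝ u (A w x) := (h.pos w).isSymmetric u x
    rw [← this, hAu, inner_zero_left]
  have key : ∀ ε : ℝ, 0 < ε → ∀ σ : ℝ, σ * σ = 1 → A (w + ε • (σ • k)) = A w + ε • U := by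
    intro ε hε σ hσ
    refine h.eq_of_sq ((h.pos w).add (hUpos.smul_of_nonneg hε.le)) fun x => ?_
    simp only [add_apply, smul_apply, map_add, map_smul,
      hk, hUx, hAu, hu, hUT, hUA, h.sq, smul_zero, zero_smul, add_zero, zero_add, smul_smul]
    congr 2
    linear_combination -(ε * inner ℝ u x * (ε * inner ℝ u u)) * hσ
  have h1 : fderiv ℝ A w ((1 : ℝ) • k) = U := by
    refine fderiv_eq_of_eventually hd ?_
    filter_upwards [self_mem_nhdsWithin] with ε hε using key ε hε 1 (by norm_num)
  have h2 : fderiv ℝ A w ((-1 : ℝ) • k) = U := by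
    refine fderiv_eq_of_eventually hd ?_
    filter_upwards [self_mem_nhdsWithin] with ε hε using key ε hε (-1) (by norm_num)
  rw [one_smul] at h1
  rw [map_smul, h1] at h2
  have h3 : U u = 0 := by
    have h4 := congrArg (fun f : V →L[ℝ] V => f u) h2
    simp only [neg_smul, one_smul] at h4
    have h5 : (2 : ℝ) • U u = 0 := by
      rw [two_smul]
      nth_rewrite 1 [← h4]
      exact neg_add_cancel _
    simpa using h5
  rw [hUx] at h3
  rcases smul_eq_zero.1 h3 with h5 | h5
  · exact inner_self_eq_zero.1 h5
  · exact h5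

/-- Differentiating `|X|² = X²` gives a Lyapunov equation for the derivative of `|X|`. -/
lemma lyapunov (h : IsAbs T A) {w : E} (hd : DifferentiableAt ℝ A w) (k : E) (x : V) :
    A w (fderiv ℝ A w k x) + fderiv ℝ A w k (A w x) = T w (T k x) + T k (T w x) := by
  have h1 := hd.hasFDerivAt.clm_comp hd.hasFDerivAt
  have h2 := (T.hasFDerivAt (x := w)).clm_comp (T.hasFDerivAt (x := w))
  have e : (fun y => A y ∘L A y) = fun y => T y ∘L T y := by
    funext y
    ext x
    exact h.sq y x
  rw [e] at h1
  have h3 := congrArg (fun f : E →L[ℝ] V →L[ℝ] V => f k x) (h1.unique h2)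
  simpa using h3

end IsAbs

end Operators

end NewtonADMM

/-! ### The quadratic estimate for the absolute value -/

namespace NewtonADMM

namespace IsAbs

variable {V : Type*} [NormedAddCommGroup V] [InnerProductSpace ℝ V] [FiniteDimensional ℝ V]
  {E : Type*} [NormedAddCommGroup E] [NormedSpace ℝ E]
  {T : E →L[ℝ] V →L[ℝ] V} {A : E → V →L[ℝ] V}

/-- An eigenvector of a perturbation of `Z` whose eigenvalue is small is almost annihilated by
`Z`. -/
lemma norm_apply_le_of_small {V : Type*} [NormedAddCommGroup V] [NormedSpace ℝ V]
    {Z W X : V →L[ℝ] V} (hW : ∀ x, Z x = W (Z (Z x))) {a : ℝ} {u : V}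
    (hu : ‖u‖ = 1) (hX : X u = a • u) (ha : |a| * ‖W‖ ≤ 1 / 2) :
    ‖Z u‖ ≤ 2 * (‖W‖ * ‖Z‖) * ‖X - Z‖ := by
  have h1 : Z u = a • u - (X - Z) u := by
    rw [sub_apply, hX]
    abel
  have h2 : Z (Z u) = a • Z u - Z ((X - Z) u) := by
    conv_lhs => rw [h1, map_sub, map_smul]
  have h3 : ‖(X - Z) u‖ ≤ ‖X - Z‖ := by
    simpa [hu] using (X - Z).le_opNorm u
  have h4 : ‖Z (Z u)‖ ≤ |a| * ‖Z u‖ + ‖Z‖ * ‖X - Z‖ := by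
    rw [h2]
    refine (norm_sub_le _ _).trans (add_le_add (by rw [norm_smul, Real.norm_eq_abs]) ?_)
    exact (Z.le_opNorm _).trans (mul_le_mul_of_nonneg_left h3 (norm_nonneg _))
  have h5 : ‖Z u‖ ≤ ‖W‖ * (|a| * ‖Z u‖ + ‖Z‖ * ‖X - Z‖) := by
    calc ‖Z u‖ = ‖W (Z (Z u))‖ := by rw [← hW]
      _ ≤ ‖W‖ * ‖Z (Z u)‖ := W.le_opNorm _
      _ ≤ _ := mul_le_mul_of_nonneg_left h4 (norm_nonneg _)
  nlinarith [mul_le_mul_of_nonneg_right ha (norm_nonneg (Z u))]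

lemma abs_inner_le_of_generalized_inverse {V : Type*} [NormedAddCommGroup V]
    [InnerProductSpace ℝ V] {S W : V →L[ℝ] V} (hS : (S : V →ₗ[ℝ] V).IsSymmetric)
    (hW : ∀ x, S x = S (W (S x))) (u v : V) :
    |inner ℝ u (S v)| ≤ ‖W‖ * (‖S u‖ * ‖S v‖) := by
  have h1 : inner ℝ (S u) (W (S v)) = inner ℝ u (S (W (S v))) := hS u _
  rw [show inner ℝ u (S v) = inner ℝ (S u) (W (S v)) by rw [h1, ← hW]]
  calc _ ≤ ‖S u‖ * ‖W (S v)‖ := abs_real_inner_le_norm _ _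
    _ ≤ ‖S u‖ * (‖W‖ * ‖S v‖) := by gcongr; exact W.le_opNorm _
    _ = _ := by ring

/-- The entries of `Y = D|·|(w) z - |T z|` in an eigenbasis of `T w`. If one of the two eigenvalues
is bounded away from zero, the Lyapunov equation `|X| Y + Y |X| = (|X| - |Z|)² - (X - Z)²` bounds
the entry; otherwise both eigenvectors are almost in the kernel of `T z`. -/
lemma abs_entry_le (h : IsAbs T A)
    (hrank : ∀ u : V, ∃ k : E, T k = (innerSL ℝ u).smulRight u) {K : NNReal}
    (hK : LipschitzWith K A) {z w : E} (hd : DifferentiableAt ℝ A w)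
    {W₁ W₂ : V →L[ℝ] V} (hW₁ : ∀ x, T z x = W₁ (T z (T z x)))
    (hW₁' : ∀ x, T z x = T z (W₁ (T z x))) (hW₂ : ∀ x, A z x = A z (W₂ (A z x)))
    {u v : V} (hu : ‖u‖ = 1) (hv : ‖v‖ = 1) {a b : ℝ} (hau : T w u = a • u)
    (hbv : T w v = b • v) :
    |inner ℝ u ((fderiv ℝ A w z - A z) v)| ≤
      ((‖W₁‖ + ‖W₂‖) * (2 * (‖W₁‖ * ‖T z‖) * ‖T‖) ^ 2
        + 2 * (‖W₁‖ + 1) * (K ^ 2 + ‖T‖ ^ 2)) * ‖w - z‖ ^ 2 := by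
  have hE : ‖T w - T z‖ ≤ ‖T‖ * ‖w - z‖ := by
    rw [← map_sub]
    exact T.le_opNorm _
  have hAu : A w u = |a| • u :=
    apply_eq_abs_smul (h.pos w) (by rw [h.sq, hau, map_smul, hau, smul_smul])
  have hBv : A w v = |b| • v :=
    apply_eq_abs_smul (h.pos w) (by rw [h.sq, hbv, map_smul, hbv, smul_smul])
  have hane : a ≠ 0 := fun h0 => by
    have := h.eq_zero_of_differentiableAt hrank hd (u := u) (by rw [hau, h0, zero_smul])
    rw [this, norm_zero] at hu
    exact zero_ne_one hu
  have hapos : 0 < |a| := abs_pos.2 hane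
  have hsymA : ∀ x, inner ℝ u (A w x) = |a| * inner ℝ u x := fun x => by
    have h1 : inner ℝ (A w u) x = inner ℝ u (A w x) := (h.pos w).isSymmetric u x
    rw [← h1, hAu, inner_smul_left, conj_trivial]
  have hsymT : ∀ x, inner ℝ u (T w x) = a * inner ℝ u x := fun x => by
    have h1 : inner ℝ (T w u) x = inner ℝ u (T w x) := h.symm w u x
    rw [← h1, hau, inner_smul_left, conj_trivial]
  set D := fderiv ℝ A w z with hD
  have hlyap := congrArg (fun x => inner ℝ u x) (h.lyapunov hd z v)
  simp only [inner_add_right, hsymA, hsymT, hBv, hbv, map_smul, inner_smul_right] at hlyap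
  -- `hlyap : |a| ⟪u, D v⟫ + |b| ⟪u, D v⟫ = a ⟪u, Z v⟫ + b ⟪u, Z v⟫`
  have hcoef : 0 ≤ 2 * (‖W₁‖ + 1) * ((K : ℝ) ^ 2 + ‖T‖ ^ 2) * ‖w - z‖ ^ 2 := by positivity
  have hcoef' : 0 ≤ (‖W₁‖ + ‖W₂‖) * (2 * (‖W₁‖ * ‖T z‖) * ‖T‖) ^ 2 * ‖w - z‖ ^ 2 := by positivity
  rw [add_mul]
  by_cases hsmall : |a| * ‖W₁‖ ≤ 1 / 2 ∧ |b| * ‖W₁‖ ≤ 1 / 2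
  · have hZ : ∀ {x : V} {c : ℝ}, ‖x‖ = 1 → T w x = c • x → |c| * ‖W₁‖ ≤ 1 / 2 →
        ‖T z x‖ ≤ 2 * (‖W₁‖ * ‖T z‖) * ‖T‖ * ‖w - z‖ := fun hx hcx hc =>
      (norm_apply_le_of_small hW₁ hx hcx hc).trans (by
        rw [mul_assoc _ ‖T‖]
        exact mul_le_mul_of_nonneg_left hE (by positivity))
    have hprod : ‖T z u‖ * ‖T z v‖ ≤ (2 * (‖W₁‖ * ‖T z‖) * ‖T‖) ^ 2 * ‖w - z‖ ^ 2 := by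
      calc _ ≤ (2 * (‖W₁‖ * ‖T z‖) * ‖T‖ * ‖w - z‖) * (2 * (‖W₁‖ * ‖T z‖) * ‖T‖ * ‖w - z‖) :=
            mul_le_mul (hZ hu hau hsmall.1) (hZ hv hbv hsmall.2) (norm_nonneg _) (by positivity)
        _ = _ := by ring
    have h1 : |inner ℝ u (D v)| ≤ |inner ℝ u (T z v)| := by
      have h2 : (|a| + |b|) * |inner ℝ u (D v)| ≤ (|a| + |b|) * |inner ℝ u (T z v)| := by
        have h3 : (|a| + |b|) * inner ℝ u (D v) = (a + b) * inner ℝ u (T z v) := by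
          linear_combination hlyap
        have h4 := congrArg abs h3
        rw [abs_mul, abs_mul, abs_of_nonneg (add_nonneg (abs_nonneg a) (abs_nonneg b))] at h4
        rw [h4]
        exact mul_le_mul_of_nonneg_right (abs_add_le a b) (abs_nonneg _)
      exact le_of_mul_le_mul_left h2 (by positivity)
    have h2 : |inner ℝ u (T z v)| ≤ ‖W₁‖ * (‖T z u‖ * ‖T z v‖) :=
      abs_inner_le_of_generalized_inverse (h.symm z) hW₁' u v
    have h3 : |inner ℝ u (A z v)| ≤ ‖W₂‖ * (‖T z u‖ * ‖T z v‖) := by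
      have := abs_inner_le_of_generalized_inverse (h.pos z).isSymmetric hW₂ u v
      rwa [h.norm_apply, h.norm_apply] at this
    rw [sub_apply, inner_sub_right]
    have h4 := abs_sub (inner ℝ u (D v)) (inner ℝ u (A z v))
    have h5 : (‖W₁‖ + ‖W₂‖) * (‖T z u‖ * ‖T z v‖)
        ≤ (‖W₁‖ + ‖W₂‖) * ((2 * (‖W₁‖ * ‖T z‖) * ‖T‖) ^ 2 * ‖w - z‖ ^ 2) :=
      mul_le_mul_of_nonneg_left hprod (by positivity)
    linarith
  · have hbig : 1 ≤ 2 * (‖W₁‖ + 1) * (|a| + |b|) := by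
      have := norm_nonneg W₁
      have := abs_nonneg b
      by_contra hlt
      push Not at hlt
      exact hsmall ⟨by nlinarith, by nlinarith⟩
    have hR : (|a| + |b|) * inner ℝ u ((D - A z) v)
        = inner ℝ u ((A w - A z) ((A w - A z) v)) - inner ℝ u ((T w - T z) ((T w - T z) v)) := by
      have h1 : inner ℝ u (A z (A z v)) = inner ℝ u (T z (T z v)) := by rw [h.sq]
      simp only [sub_apply, map_sub, inner_sub_right, hsymA, hsymT, hBv, hbv, map_smul,
        inner_smul_right]
      linear_combination hlyap - h1 - inner ℝ u v * abs_mul_abs_self b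
    have hq : ∀ S : V →L[ℝ] V, ∀ c : ℝ, ‖S‖ ≤ c * ‖w - z‖ → 0 ≤ c →
        |inner ℝ u (S (S v))| ≤ c ^ 2 * ‖w - z‖ ^ 2 := fun S c hS hc => by
      calc _ ≤ ‖u‖ * ‖S (S v)‖ := abs_real_inner_le_norm _ _
        _ ≤ ‖u‖ * (‖S‖ * (‖S‖ * ‖v‖)) := by
            gcongr
            exact (S.le_opNorm _).trans (mul_le_mul_of_nonneg_left (S.le_opNorm _) (norm_nonneg _))
        _ = ‖S‖ * ‖S‖ := by rw [hu, hv]; ring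
        _ ≤ (c * ‖w - z‖) * (c * ‖w - z‖) := mul_self_le_mul_self (norm_nonneg _) hS
        _ = _ := by ring
    have h1 := hq (A w - A z) K (hK.norm_sub_le w z) K.2
    have h2 := hq (T w - T z) ‖T‖ hE (norm_nonneg T)
    have h3 : (|a| + |b|) * |inner ℝ u ((D - A z) v)| ≤ (K ^ 2 + ‖T‖ ^ 2) * ‖w - z‖ ^ 2 := by
      have h4 := congrArg abs hR
      rw [abs_mul, abs_of_nonneg (add_nonneg (abs_nonneg a) (abs_nonneg b))] at h4
      rw [h4, add_mul]
      exact (abs_sub _ _).trans (add_le_add h1 h2)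
    have h5 : |inner ℝ u ((D - A z) v)|
        ≤ 2 * (‖W₁‖ + 1) * ((|a| + |b|) * |inner ℝ u ((D - A z) v)|) := by
      rw [← mul_assoc]
      exact le_mul_of_one_le_left (abs_nonneg _) hbig
    have h6 := mul_le_mul_of_nonneg_left h3 (by positivity : 0 ≤ 2 * (‖W₁‖ + 1))
    linarith

theorem quadApprox (h : IsAbs T A)
    (hrank : ∀ u : V, ∃ k : E, T k = (innerSL ℝ u).smulRight u) {K : NNReal}
    (hK : LipschitzWith K A) : QuadApprox A := by
  refine quadApprox_of_homogeneous (fun c hc w => h.smul hc w) fun z => ?_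
  obtain ⟨W₁, hW₁, hW₁'⟩ := exists_generalized_inverse (h.symm z)
  obtain ⟨W₂, -, hW₂⟩ := exists_generalized_inverse (h.pos z).isSymmetric
  refine ⟨(Fintype.card (Fin (Module.finrank ℝ V))) ^ 2 *
    ((‖W₁‖ + ‖W₂‖) * (2 * (‖W₁‖ * ‖T z‖) * ‖T‖) ^ 2
        + 2 * (‖W₁‖ + 1) * (K ^ 2 + ‖T‖ ^ 2)), Eventually.of_forall fun w hd => ?_⟩
  obtain ⟨b, s, hb⟩ := exists_eigenbasis (h.symm w)
  refine (norm_le_of_entries b fun i j => abs_entry_le h hrank hK hd hW₁ hW₁' hW₂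
    (b.norm_eq_one i) (b.norm_eq_one j) (hb i) (hb j)).trans_eq ?_
  rw [abs_of_nonneg (by positivity)]
  ring

end IsAbs

end NewtonADMM

/-! ### Projection onto the positive operators -/

namespace NewtonADMM

lemma QuadApprox.add_comp {E G H : Type*} [NormedAddCommGroup E] [NormedSpace ℝ E]
    [NormedAddCommGroup G] [NormedSpace ℝ G] [NormedAddCommGroup H] [NormedSpace ℝ H]
    {P : E → H} {A : E → G} (hA : QuadApprox A) (L : E →L[ℝ] H) (M : G →L[ℝ] H)
    (h : ∀ w, P w = L w + M (A w)) (hd : ∀ w, DifferentiableAt ℝ P w → DifferentiableAt ℝ A w) :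
    QuadApprox P := by
  intro z
  obtain ⟨C, hC⟩ := hA z
  refine ⟨‖M‖ * C, hC.mono fun w hw hP => ?_⟩
  have hAd := hd w hP
  have h1 : HasFDerivAt (fun w => L w + M (A w)) (L + M ∘L fderiv ℝ A w) w :=
    L.hasFDerivAt.add (M.hasFDerivAt.comp w hAd.hasFDerivAt)
  rw [show P = fun w => L w + M (A w) from funext h, h1.fderiv]
  have e : L w + M (A w) - (L z + M (A z)) - (L + M ∘L fderiv ℝ A w) (w - z)
      = M (A w - A z - fderiv ℝ A w (w - z)) := by
    simp only [add_apply, ContinuousLinearMap.comp_apply, map_sub]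
    abel
  rw [e, mul_assoc]
  exact (M.le_opNorm _).trans (mul_le_mul_of_nonneg_left (hw hAd) (norm_nonneg _))

section SpectralProjection

variable {V : Type*} [NormedAddCommGroup V] [InnerProductSpace ℝ V] [FiniteDimensional ℝ V]

lemma exists_abs {S : V →L[ℝ] V} (hS : (S : V →ₗ[ℝ] V).IsSymmetric) :
    ∃ A : V →L[ℝ] V, A.IsPositive ∧ (∀ x, A (A x) = S (S x)) ∧ (A - S).IsPositive ∧
      (A + S).IsPositive := by
  obtain ⟨b, s, hb⟩ := exists_eigenbasis hS
  have hsub : (diagOp b fun i => |s i|) - S = diagOp b fun i => |s i| - s i :=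
    eq_diagOp b fun i => by rw [sub_apply, diagOp_basis, hb, sub_smul]
  have hadd : (diagOp b fun i => |s i|) + S = diagOp b fun i => |s i| + s i :=
    eq_diagOp b fun i => by rw [add_apply, diagOp_basis, hb, add_smul]
  refine ⟨diagOp b fun i => |s i|, diagOp_isPositive b fun i => abs_nonneg _, fun x => ?_, ?_, ?_⟩
  · have h : (diagOp b fun i => |s i|) ∘L (diagOp b fun i => |s i|) = S ∘L S :=
      eq_of_basis b fun i => by
        simp only [ContinuousLinearMap.comp_apply, diagOp_basis, hb, map_smul, smul_smul,
          abs_mul_abs_self]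
    exact congrArg (fun f : V →L[ℝ] V => f x) h
  · rw [hsub]
    exact diagOp_isPositive b fun i => sub_nonneg.2 (le_abs_self _)
  · rw [hadd]
    exact diagOp_isPositive b fun i => by linarith [neg_abs_le (s i)]

lemma trace_comp_nonneg {S Q : V →L[ℝ] V} (hS : S.IsPositive) (hQ : Q.IsPositive) :
    0 ≤ LinearMap.trace ℝ V ((S ∘L Q : V →L[ℝ] V) : V →ₗ[ℝ] V) := by
  obtain ⟨b, q, hb⟩ := exists_eigenbasis hQ.isSymmetric
  rw [LinearMap.trace_eq_sum_inner _ b]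
  refine Finset.sum_nonneg fun i _ => ?_
  have h1 := ((ContinuousLinearMap.isPositive_iff Q).1 hQ).2 (b i)
  have h2 := ((ContinuousLinearMap.isPositive_iff S).1 hS).2 (b i)
  rw [hb, inner_smul_left, real_inner_self_eq_norm_sq, b.norm_eq_one] at h1
  change 0 ≤ inner ℝ (b i) (S (Q (b i)))
  rw [hb, map_smul, inner_smul_right, real_inner_comm]
  exact mul_nonneg (by simpa using h1) h2

/-- Let the space `E` carry symmetric operators through `T`, with a section `R` adjoint to `T` for
the trace inner product. Then the projection onto the dual of the cone of positive operators is
`w ↦ w + R (|T w| - T w) / 2`, and it satisfies the quadratic estimate. -/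
theorem exists_isProjOn_positive {E : Type*} [NormedAddCommGroup E] [InnerProductSpace ℝ E]
    [CompleteSpace E] (T : E →L[ℝ] V →L[ℝ] V) (R : (V →L[ℝ] V) →L[ℝ] E)
    (hsymm : ∀ w, (T w : V →ₗ[ℝ] V).IsSymmetric)
    (hTR : ∀ S : V →L[ℝ] V, (S : V →ₗ[ℝ] V).IsSymmetric → T (R S) = S)
    (htr : ∀ S : V →L[ℝ] V, (S : V →ₗ[ℝ] V).IsSymmetric → ∀ x,
      inner ℝ (R S) x = LinearMap.trace ℝ V ((S ∘L T x : V →L[ℝ] V) : V →ₗ[ℝ] V))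
    {K : Set E} (hK : K = R '' {S | S.IsPositive}) :
    ∃ P, IsProjOn (ProperCone.innerDual K : Set E) P ∧ QuadApprox P := by
  choose A hA hsq hsub hadd using fun w => exists_abs (hsymm w)
  have habs : IsAbs T A := ⟨hsymm, hA, hsq⟩
  have hsym' : ∀ w, ((A w - T w : V →L[ℝ] V) : V →ₗ[ℝ] V).IsSymmetric := fun w =>
    (hsub w).isSymmetric
  set P : E → E := fun w => w + R ((1 / 2 : ℝ) • (A w - T w)) with hP
  have hhalf : ∀ w, ((1 / 2 : ℝ) • (A w - T w)).IsPositive := fun w =>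
    (hsub w).smul_of_nonneg (by norm_num)
  have hTP : ∀ w, T (P w) = (1 / 2 : ℝ) • (A w + T w) := fun w => by
    rw [hP, map_add, hTR _ (hhalf w).isSymmetric]
    module
  have hproj : IsProjOn (ProperCone.innerDual K : Set E) P := by
    refine isProjOn_of_innerDual fun w => ⟨?_, ?_, ?_⟩
    · rw [hK]
      rintro _ ⟨S, hS, rfl⟩
      change 0 ≤ inner ℝ (R S) (P w)
      rw [htr S hS.isSymmetric, hTP]
      exact trace_comp_nonneg hS ((hadd w).smul_of_nonneg (by norm_num))
    · rw [hK, hP, add_sub_cancel_left]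
      exact ⟨_, hhalf w, rfl⟩
    · have h1 : P w - w = R ((1 / 2 : ℝ) • (A w - T w)) := by rw [hP, add_sub_cancel_left]
      rw [h1, htr _ (hhalf w).isSymmetric, hTP]
      -- `(A - T)(A + T) = A T - T A` because `A² = T²`, and a commutator has trace zero
      have h2 : ((((1 / 2 : ℝ) • (A w - T w)) ∘L ((1 / 2 : ℝ) • (A w + T w)) : V →L[ℝ] V)
          : V →ₗ[ℝ] V) = (1 / 4 : ℝ) • ((A w : V →ₗ[ℝ] V) * (T w : V →ₗ[ℝ] V)
            - (T w : V →ₗ[ℝ] V) * (A w : V →ₗ[ℝ] V)) := by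
        ext x
        have h3 := hsq w x
        simp only [ContinuousLinearMap.coe_coe, ContinuousLinearMap.comp_apply, smul_apply,
          sub_apply, add_apply, map_smul, map_add, LinearMap.smul_apply, LinearMap.sub_apply,
          Module.End.mul_apply, h3]
        module
      rw [h2, map_smul, map_sub, LinearMap.trace_mul_comm, sub_self, smul_zero]
  refine ⟨P, hproj, ?_⟩
  have hAP : ∀ w, A w = (2 : ℝ) • T (P w) - T w := fun w => by
    rw [hTP]
    module
  have hA' : A = fun w => ((2 : ℝ) • T) (P w) - T w := funext hAP
  have hlip : LipschitzWith (‖(2 : ℝ) • T‖₊ * 1 + ‖T‖₊) A := by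
    rw [hA']
    exact (((2 : ℝ) • T).lipschitz.comp hproj.lipschitzWith).sub T.lipschitz
  have hrank : ∀ u : V, ∃ k : E, T k = (innerSL ℝ u).smulRight u := fun u => by
    refine ⟨R ((innerSL ℝ u).smulRight u), hTR _ fun x y => ?_⟩
    change inner ℝ (inner ℝ u x • u) y = inner ℝ x (inner ℝ u y • u)
    rw [inner_smul_left, inner_smul_right, real_inner_comm u x, conj_trivial]
    ring
  refine (habs.quadApprox hrank hlip).add_comp
    (ContinuousLinearMap.id ℝ E - (1 / 2 : ℝ) • (R ∘L T)) ((1 / 2 : ℝ) • R) (fun w => ?_)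
    fun w hw => ?_
  · simp only [hP, sub_apply, smul_apply, ContinuousLinearMap.comp_apply, map_smul, map_sub,
      ContinuousLinearMap.id_apply]
    module
  · rw [hA']
    exact ((((2 : ℝ) • T).differentiableAt).comp w hw).sub T.differentiableAt

end SpectralProjection

section Matrices

variable {d : ℕ}

/-- A matrix as an operator of `ℝ^d`, as a linear map of the matrix. -/
noncomputable def matOp (d : ℕ) : Matrix (Fin d) (Fin d) ℝ →ₗ[ℝ]
    EuclideanSpace ℝ (Fin d) →L[ℝ] EuclideanSpace ℝ (Fin d) :=
  (Matrix.toEuclideanCLM (n := Fin d) (𝕜 := ℝ)).toAlgEquiv.toLinearMap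

/-- The matrix of an operator of `ℝ^d`, as a linear map of the operator. -/
noncomputable def opMat (d : ℕ) : (EuclideanSpace ℝ (Fin d) →L[ℝ] EuclideanSpace ℝ (Fin d)) →ₗ[ℝ]
    Matrix (Fin d) (Fin d) ℝ :=
  (Matrix.toEuclideanCLM (n := Fin d) (𝕜 := ℝ)).symm.toAlgEquiv.toLinearMap

@[simp] lemma matOp_opMat (S : EuclideanSpace ℝ (Fin d) →L[ℝ] EuclideanSpace ℝ (Fin d)) :
    matOp d (opMat d S) = S :=
  (Matrix.toEuclideanCLM (n := Fin d) (𝕜 := ℝ)).apply_symm_apply S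

@[simp] lemma opMat_matOp (M : Matrix (Fin d) (Fin d) ℝ) : opMat d (matOp d M) = M :=
  (Matrix.toEuclideanCLM (n := Fin d) (𝕜 := ℝ)).symm_apply_apply M

lemma coe_matOp (M : Matrix (Fin d) (Fin d) ℝ) :
    (matOp d M : EuclideanSpace ℝ (Fin d) →ₗ[ℝ] EuclideanSpace ℝ (Fin d)) = M.toEuclideanLin :=
  Matrix.coe_toEuclideanCLM_eq_toEuclideanLin M

lemma matOp_isSymmetric_iff {M : Matrix (Fin d) (Fin d) ℝ} :
    (matOp d M : EuclideanSpace ℝ (Fin d) →ₗ[ℝ] EuclideanSpace ℝ (Fin d)).IsSymmetric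
      ↔ M.IsHermitian := by
  rw [coe_matOp, Matrix.isSymmetric_toEuclideanLin_iff]

lemma matOp_isPositive_iff {M : Matrix (Fin d) (Fin d) ℝ} :
    (matOp d M).IsPositive ↔ M.PosSemidef := by
  rw [← Matrix.isPositive_toEuclideanLin_iff, ← coe_matOp,
    ContinuousLinearMap.isPositive_toLinearMap_iff]

lemma trace_matOp_comp (M N : Matrix (Fin d) (Fin d) ℝ) :
    LinearMap.trace ℝ _ ((matOp d M ∘L matOp d N :
      EuclideanSpace ℝ (Fin d) →L[ℝ] EuclideanSpace ℝ (Fin d)) :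
      EuclideanSpace ℝ (Fin d) →ₗ[ℝ] EuclideanSpace ℝ (Fin d)) = ∑ i, ∑ j, M i j * N j i := by
  have h : matOp d M ∘L matOp d N = matOp d (M * N) :=
    (map_mul (Matrix.toEuclideanCLM (n := Fin d) (𝕜 := ℝ)) M N).symm
  rw [h, coe_matOp, LinearMap.trace_eq_sum_inner _ (EuclideanSpace.basisFun (Fin d) ℝ)]
  refine Finset.sum_congr rfl fun i _ => ?_
  simp only [EuclideanSpace.basisFun_apply, EuclideanSpace.inner_single_left]
  simp
  rfl

end Matrices

end NewtonADMM

/-! ### The two cones of positive semidefinite matrices -/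

namespace NewtonADMM

variable {d : ℕ}

section Vectorized

/-- The symmetric part of the matrix with the given entries, as an operator. -/
noncomputable def symmPartOp (d : ℕ) : EuclideanSpace ℝ (Fin d × Fin d) →L[ℝ]
    EuclideanSpace ℝ (Fin d) →L[ℝ] EuclideanSpace ℝ (Fin d) :=
  LinearMap.toContinuousLinearMap <| matOp d ∘ₗ
    { toFun := fun x => Matrix.of fun i j => (x (i, j) + x (j, i)) / 2
      map_add' := fun x y => by ext i j; simp; ring
      map_smul' := fun c x => by ext i j; simp; ring }

/-- The entries of an operator of `ℝ^d`. -/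
noncomputable def vecOp (d : ℕ) : (EuclideanSpace ℝ (Fin d) →L[ℝ] EuclideanSpace ℝ (Fin d)) →L[ℝ]
    EuclideanSpace ℝ (Fin d × Fin d) :=
  LinearMap.toContinuousLinearMap
    { toFun := fun S => WithLp.toLp 2 fun p => opMat d S p.1 p.2
      map_add' := fun x y => by ext p; simp
      map_smul' := fun c x => by ext p; simp }

lemma symmPartOp_apply (x : EuclideanSpace ℝ (Fin d × Fin d)) :
    symmPartOp d x = matOp d (Matrix.of fun i j => (x (i, j) + x (j, i)) / 2) := rfl

lemma vecOp_apply (S : EuclideanSpace ℝ (Fin d) →L[ℝ] EuclideanSpace ℝ (Fin d))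
    (p : Fin d × Fin d) : vecOp d S p = opMat d S p.1 p.2 := rfl

lemma opMat_symm {S : EuclideanSpace ℝ (Fin d) →L[ℝ] EuclideanSpace ℝ (Fin d)}
    (hS : (S : EuclideanSpace ℝ (Fin d) →ₗ[ℝ] EuclideanSpace ℝ (Fin d)).IsSymmetric) (i j : Fin d) :
    opMat d S j i = opMat d S i j := by
  rw [← matOp_opMat S, matOp_isSymmetric_iff] at hS
  simpa using hS.apply i j

theorem exists_isProjOn_psdConeVec (d : ℕ) :
    ∃ P, IsProjOn (ProperCone.innerDual (psdConeVec d) : Set (EuclideanSpace ℝ (Fin d × Fin d))) P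
      ∧ QuadApprox P := by
  refine exists_isProjOn_positive (symmPartOp d) (vecOp d) (fun w => ?_) (fun S hS => ?_)
    (fun S hS x => ?_) ?_
  · rw [symmPartOp_apply, matOp_isSymmetric_iff]
    ext i j
    simp [add_comm]
  · rw [symmPartOp_apply]
    conv_rhs => rw [← matOp_opMat S]
    congr 1
    ext i j
    simp [vecOp_apply, opMat_symm hS i j]
  · conv_rhs => rw [← matOp_opMat S]
    rw [symmPartOp_apply, trace_matOp_comp, real_inner_eq_sum, Fintype.sum_prod_type]
    simp only [vecOp_apply, Matrix.of_apply]
    have h1 : ∑ i, ∑ j, opMat d S i j * x (j, i) = ∑ i, ∑ j, opMat d S i j * x (i, j) := by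
      rw [Finset.sum_comm]
      exact Finset.sum_congr rfl fun i _ => Finset.sum_congr rfl fun j _ => by
        rw [opMat_symm hS i j]
    have h2 : ∑ i, ∑ j, opMat d S i j * ((x (j, i) + x (i, j)) / 2)
        = (∑ i, ∑ j, opMat d S i j * x (j, i)) / 2 + (∑ i, ∑ j, opMat d S i j * x (i, j)) / 2 := by
      simp only [Finset.sum_div, ← Finset.sum_add_distrib]
      exact Finset.sum_congr rfl fun i _ => Finset.sum_congr rfl fun j _ => by ring
    rw [h2, h1]
    ring
  · ext x
    constructor
    · intro hx
      refine ⟨matOp d (Matrix.of fun i j => x (i, j)), matOp_isPositive_iff.2 hx, ?_⟩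
      ext p
      simp [vecOp_apply]
    · rintro ⟨S, hS, rfl⟩
      have h1 : (matOp d (opMat d S)).IsPositive := by rw [matOp_opMat]; exact hS
      exact matOp_isPositive_iff.1 h1

end Vectorized

section Isometric

/-- `smat` as an operator-valued linear map. -/
noncomputable def smatOp (d : ℕ) : EuclideanSpace ℝ (Sym2 (Fin d)) →L[ℝ]
    EuclideanSpace ℝ (Fin d) →L[ℝ] EuclideanSpace ℝ (Fin d) :=
  LinearMap.toContinuousLinearMap <| matOp d ∘ₗ
    { toFun := smat
      map_add' := fun x y => by ext i j; by_cases h : i = j <;> simp [smat, h, add_div]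
      map_smul' := fun c x => by ext i j; by_cases h : i = j <;> simp [smat, h, mul_div_assoc] }

/-- The isometric coordinates of the symmetric part of a matrix. -/
noncomputable def svecFun (M : Matrix (Fin d) (Fin d) ℝ) : Sym2 (Fin d) → ℝ :=
  Sym2.lift ⟨fun i j => if i = j then M i j else √2 / 2 * (M i j + M j i), fun i j => by
    by_cases h : i = j
    · simp [h]
    · simp [h, Ne.symm h, add_comm]⟩

lemma svecFun_mk (M : Matrix (Fin d) (Fin d) ℝ) (i j : Fin d) :
    svecFun M s(i, j) = if i = j then M i j else √2 / 2 * (M i j + M j i) := rfl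

/-- The isometric coordinates of the symmetric part of an operator. -/
noncomputable def svecOp (d : ℕ) : (EuclideanSpace ℝ (Fin d) →L[ℝ] EuclideanSpace ℝ (Fin d)) →L[ℝ]
    EuclideanSpace ℝ (Sym2 (Fin d)) :=
  LinearMap.toContinuousLinearMap
    { toFun := fun S => WithLp.toLp 2 (svecFun (opMat d S))
      map_add' := fun x y => by
        ext p
        induction p with | _ i j
        by_cases h : i = j
        · simp [svecFun_mk, h]
        · simp [svecFun_mk, h]; ring
      map_smul' := fun c x => by
        ext p
        induction p with | _ i j
        by_cases h : i = j
        · simp [svecFun_mk, h]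
        · simp [svecFun_mk, h]; ring }

lemma svecOp_apply (S : EuclideanSpace ℝ (Fin d) →L[ℝ] EuclideanSpace ℝ (Fin d))
    (p : Sym2 (Fin d)) : svecOp d S p = svecFun (opMat d S) p := rfl

lemma smatOp_apply (x : EuclideanSpace ℝ (Sym2 (Fin d))) : smatOp d x = matOp d (smat x) := rfl

/-- A sum over pairs counts every unordered pair of distinct indices twice. -/
lemma sum_sum_sym2 (F : Sym2 (Fin d) → ℝ) :
    ∑ i, ∑ j, F s(i, j) = ∑ p, (if p.IsDiag then 1 else 2) * F p := by
  rw [← Fintype.sum_prod_type' (fun i j => F s(i, j)),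
    ← Finset.sum_fiberwise (s := Finset.univ) (fun p : Fin d × Fin d => s(p.1, p.2))]
  refine Finset.sum_congr rfl fun p _ => ?_
  induction p with | _ a b
  have h1 : ∑ q : Fin d × Fin d with s(q.1, q.2) = s(a, b), F s(q.1, q.2)
      = ∑ q ∈ ({(a, b), (b, a)} : Finset (Fin d × Fin d)), F s(a, b) := by
    refine Finset.sum_congr ?_ fun q hq => ?_
    · ext ⟨i, j⟩
      simp
    · simp only [Finset.mem_insert, Finset.mem_singleton] at hq
      rcases hq with rfl | rfl
      · rfl
      · rw [Sym2.eq_swap]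
  rw [h1, Finset.sum_const]
  by_cases h : a = b
  · simp [h]
  · rw [Finset.card_pair (by simp [h])]
    simp [h]

theorem exists_isProjOn_psdCone (d : ℕ) :
    ∃ P, IsProjOn (ProperCone.innerDual (psdCone d) : Set (EuclideanSpace ℝ (Sym2 (Fin d)))) P
      ∧ QuadApprox P := by
  have hs2 : √2 * √2 = 2 := Real.mul_self_sqrt (by norm_num)
  have hs0 : √2 ≠ 0 := by positivity
  have hsmat : ∀ x : EuclideanSpace ℝ (Sym2 (Fin d)), (smat x).IsHermitian := fun x => by
    ext i j
    by_cases h : i = j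
    · simp [smat, h]
    · simp [smat, h, Ne.symm h, Sym2.eq_swap]
  have hsv : ∀ x : EuclideanSpace ℝ (Sym2 (Fin d)), svecOp d (matOp d (smat x)) = x := fun x => by
    ext p
    induction p with | _ i j
    rw [svecOp_apply, opMat_matOp, svecFun_mk]
    by_cases h : i = j
    · simp [smat, h]
    · simp only [smat, h, Ne.symm h, if_false, Matrix.of_apply, Sym2.eq_swap (a := j)]
      field_simp
      ring
  have hmat : ∀ S : EuclideanSpace ℝ (Fin d) →L[ℝ] EuclideanSpace ℝ (Fin d),
      (S : EuclideanSpace ℝ (Fin d) →ₗ[ℝ] EuclideanSpace ℝ (Fin d)).IsSymmetric →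
      smat (svecOp d S) = opMat d S := fun S hS => by
    ext i j
    by_cases h : i = j
    · simp [smat, svecOp_apply, svecFun_mk, h]
    · simp only [smat, h, if_false, Matrix.of_apply, svecOp_apply, svecFun_mk, opMat_symm hS i j]
      field_simp
      ring
  refine exists_isProjOn_positive (smatOp d) (svecOp d) (fun w => ?_) (fun S hS => ?_)
    (fun S hS x => ?_) ?_
  · rw [smatOp_apply, matOp_isSymmetric_iff]
    exact hsmat w
  · rw [smatOp_apply, hmat S hS, matOp_opMat]
  · conv_rhs => rw [← matOp_opMat S]
    rw [smatOp_apply, trace_matOp_comp, real_inner_eq_sum]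
    set F : Sym2 (Fin d) → ℝ := fun p =>
      (if p.IsDiag then 1 else 1 / 2) * (svecOp d S p * x p) with hF
    have h1 : ∀ i j, opMat d S i j * smat x j i = F s(i, j) := fun i j => by
      rw [← hmat S hS]
      by_cases h : i = j
      · simp [smat, h, hF]
      · simp only [smat, h, Ne.symm h, if_false, Matrix.of_apply, Sym2.eq_swap (a := j),
          Sym2.mk_isDiag_iff, hF]
        field_simp
        linear_combination -(svecOp d S s(i, j) * x s(i, j)) * hs2
    rw [Finset.sum_congr rfl fun i _ => Finset.sum_congr rfl fun j _ => h1 i j, sum_sum_sym2 F]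
    refine Finset.sum_congr rfl fun p _ => ?_
    simp only [hF]
    split_ifs <;> ring
  · ext x
    constructor
    · intro hx
      exact ⟨matOp d (smat x), matOp_isPositive_iff.2 hx, hsv x⟩
    · rintro ⟨S, hS, rfl⟩
      have h1 : (matOp d (opMat d S)).IsPositive := by rw [matOp_opMat]; exact hS
      rw [psdCone, Set.mem_ofPred_eq, hmat S hS.isSymmetric]
      exact matOp_isPositive_iff.1 h1

end Isometric

end NewtonADMM

/-! ### The exponential cone and its dual -/

namespace NewtonADMM

section ExpCone

/-- Three-dimensional Euclidean space. -/
abbrev E3 := EuclideanSpace ℝ (Fin 3)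

lemma ext3 {x y : E3} (h0 : x 0 = y 0) (h1 : x 1 = y 1) (h2 : x 2 = y 2) : x = y := by
  ext i
  fin_cases i
  exacts [h0, h1, h2]

lemma inner3 (x y : E3) : inner ℝ x y = x 0 * y 0 + x 1 * y 1 + x 2 * y 2 := by
  rw [real_inner_eq_sum, Fin.sum_univ_three]

/-- The boundary ray of the exponential cone with slope `x / y = r`. -/
noncomputable def expRay (r : ℝ) : E3 := !₂[r, 1, Real.exp r]

/-- The inner normal of the exponential cone along the ray `expRay r`; these vectors span the curved
part of the boundary of the dual cone. -/
noncomputable def expNormal (r : ℝ) : E3 := !₂[-Real.exp r, (r - 1) * Real.exp r, 1]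

/-- The cross product of `expRay r` and `expNormal r`. -/
noncomputable def expCross (r : ℝ) : E3 :=
  !₂[1 - (r - 1) * Real.exp r ^ 2, -(Real.exp r ^ 2 + r), (r ^ 2 - r + 1) * Real.exp r]

@[simp] lemma expRay_zero (r : ℝ) : expRay r 0 = r := rfl
@[simp] lemma expRay_one (r : ℝ) : expRay r 1 = 1 := rfl
@[simp] lemma expRay_two (r : ℝ) : expRay r 2 = Real.exp r := rfl
@[simp] lemma expNormal_zero (r : ℝ) : expNormal r 0 = -Real.exp r := rfl
@[simp] lemma expNormal_one (r : ℝ) : expNormal r 1 = (r - 1) * Real.exp r := rfl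
@[simp] lemma expNormal_two (r : ℝ) : expNormal r 2 = 1 := rfl
@[simp] lemma expCross_zero (r : ℝ) : expCross r 0 = 1 - (r - 1) * Real.exp r ^ 2 := rfl
@[simp] lemma expCross_one (r : ℝ) : expCross r 1 = -(Real.exp r ^ 2 + r) := rfl
@[simp] lemma expCross_two (r : ℝ) : expCross r 2 = (r ^ 2 - r + 1) * Real.exp r := rfl

/-- The squared length of `expRay r`. -/
noncomputable def raySq (r : ℝ) : ℝ := r ^ 2 + 1 + Real.exp r ^ 2

/-- The squared length of `expNormal r`. -/
noncomputable def normalSq (r : ℝ) : ℝ := 1 + (1 + (r - 1) ^ 2) * Real.exp r ^ 2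

lemma raySq_pos (r : ℝ) : 0 < raySq r := by unfold raySq; positivity

lemma normalSq_pos (r : ℝ) : 0 < normalSq r := by unfold normalSq; positivity

lemma inner_expRay_self (r : ℝ) : inner ℝ (expRay r) (expRay r) = raySq r := by
  simp only [inner3, expRay_zero, expRay_one, expRay_two, raySq]; ring

lemma inner_expNormal_self (r : ℝ) : inner ℝ (expNormal r) (expNormal r) = normalSq r := by
  simp only [inner3, expNormal_zero, expNormal_one, expNormal_two, normalSq]; ring

lemma inner_expRay_expNormal (r : ℝ) : inner ℝ (expRay r) (expNormal r) = 0 := by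
  simp only [inner3, expRay_zero, expRay_one, expRay_two, expNormal_zero, expNormal_one,
    expNormal_two]
  ring

/-- The orthogonal decomposition of a vector along the normal, the ray and their cross product. -/
lemma exp_decomposition (r : ℝ) (h : E3) :
    h = (inner ℝ (expNormal r) h / normalSq r) • expNormal r
      + (inner ℝ (expRay r) h / raySq r) • expRay r
      + (inner ℝ (expCross r) h / (raySq r * normalSq r)) • expCross r := by
  have h1 := (raySq_pos r).ne'
  have h2 := (normalSq_pos r).ne'
  apply ext3 <;>
  · simp only [PiLp.add_apply, PiLp.smul_apply, smul_eq_mul, inner3, expRay_zero, expRay_one,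
      expRay_two, expNormal_zero, expNormal_one, expNormal_two, expCross_zero, expCross_one,
      expCross_two]
    field_simp
    unfold raySq normalSq
    ring

/-! ### The cone and its dual -/

lemma smul_expRay_mem {s : ℝ} (hs : 0 ≤ s) (r : ℝ) : s • expRay r ∈ expCone := by
  rcases hs.eq_or_lt with rfl | hs
  · right
    simp
  · left
    simp only [Set.mem_ofPred_eq, PiLp.smul_apply, smul_eq_mul, expRay_zero, expRay_one, expRay_two,
      mul_one]
    exact ⟨hs, by rw [mul_div_cancel_left₀ _ hs.ne']⟩

lemma expCone_one_nonneg {k : E3} (hk : k ∈ expCone) : 0 ≤ k 1 := by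
  rcases hk with hk | hk
  · exact hk.1.le
  · exact hk.2.1.ge

lemma expCone_two_nonneg {k : E3} (hk : k ∈ expCone) : 0 ≤ k 2 := by
  rcases hk with hk | hk
  · exact (mul_pos hk.1 (Real.exp_pos _)).le.trans hk.2
  · exact hk.2.2

lemma inner_expNormal_nonneg {k : E3} (hk : k ∈ expCone) (r : ℝ) :
    0 ≤ inner ℝ (expNormal r) k := by
  simp only [inner3, expNormal_zero, expNormal_one, expNormal_two]
  rcases hk with ⟨h1, h2⟩ | ⟨h1, h2, h3⟩
  · set ρ := k 0 / k 1 with hρ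
    have hk0 : k 0 = ρ * k 1 := by rw [hρ]; field_simp
    have h3 : (ρ - r + 1) * Real.exp r ≤ Real.exp ρ := by
      calc _ ≤ Real.exp (ρ - r) * Real.exp r :=
            mul_le_mul_of_nonneg_right (Real.add_one_le_exp _) (Real.exp_pos r).le
        _ = _ := by rw [← Real.exp_add, sub_add_cancel]
    rw [hk0]
    nlinarith [mul_le_mul_of_nonneg_left h3 h1.le]
  · rw [h2]
    nlinarith [Real.exp_pos r, mul_nonneg (Real.exp_pos r).le (neg_nonneg.2 h1)]

/-- The curved normals determine the exponential cone. -/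
lemma mem_expCone_of_inner_nonneg {p : E3} (h : ∀ r, 0 ≤ inner ℝ (expNormal r) p) :
    p ∈ expCone := by
  simp only [inner3, expNormal_zero, expNormal_one, expNormal_two, one_mul] at h
  rcases lt_trichotomy (p 1) 0 with hy | hy | hy
  · exfalso
    set c := -p 1 with hc
    have hc0 : 0 < c := by rw [hc]; linarith
    set a := (|p 2| + 1 + |p 0|) / c with ha
    have ha0 : 0 ≤ a := by positivity
    have hac : a * c = |p 2| + 1 + |p 0| := by rw [ha]; field_simp
    have h1 := h (1 + a)
    have h2 : 1 ≤ Real.exp (1 + a) := Real.one_le_exp (by linarith)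
    have h3 : |p 2| + 1 ≤ p 0 + a * c := by
      rw [hac]
      linarith [neg_abs_le (p 0)]
    have h4 : |p 2| + 1 ≤ Real.exp (1 + a) * (p 0 + a * c) :=
      h3.trans (le_mul_of_one_le_left (by linarith [abs_nonneg (p 2)]) h2)
    have h5 := le_abs_self (p 2)
    rw [show p 1 = -c by rw [hc, neg_neg]] at h1
    nlinarith
  · rw [hy] at h
    have h' : ∀ r, Real.exp r * p 0 ≤ p 2 := fun r => by have := h r; linarith
    have hx : p 0 ≤ 0 := by
      by_contra hx
      push Not at hx
      have h1 := h' (p 2 / p 0)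
      have h2 : (p 2 / p 0 + 1) * p 0 ≤ Real.exp (p 2 / p 0) * p 0 :=
        mul_le_mul_of_nonneg_right (Real.add_one_le_exp _) hx.le
      have h3 : (p 2 / p 0 + 1) * p 0 = p 2 + p 0 := by field_simp
      linarith
    refine Or.inr ⟨hx, hy, ?_⟩
    by_contra hz
    push Not at hz
    have hx' : p 0 < 0 := by
      have := h' 0
      rw [Real.exp_zero, one_mul] at this
      linarith
    have h1 := h' (Real.log (p 2 / (2 * p 0)))
    rw [Real.exp_log (div_pos_of_neg_of_neg hz (by linarith))] at h1
    have h2 : p 2 / (2 * p 0) * p 0 = p 2 / 2 := by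
      have := hx'.ne
      field_simp
    linarith
  · refine Or.inl ⟨hy, ?_⟩
    have h1 := h (p 0 / p 1)
    have h2 : Real.exp (p 0 / p 1) * (p 0 / p 1) * p 1 = Real.exp (p 0 / p 1) * p 0 := by
      field_simp
    nlinarith

/-- The dual of the exponential cone, as a set. -/
def dualExp : Set E3 := (ProperCone.innerDual expCone : Set E3)

lemma mem_dualExp {q : E3} : q ∈ dualExp ↔ ∀ k ∈ expCone, 0 ≤ inner ℝ k q := Iff.rfl

lemma smul_mem_dualExp {q : E3} (hq : q ∈ dualExp) {c : ℝ} (hc : 0 ≤ c) : c • q ∈ dualExp :=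
  (ProperCone.innerDual expCone).smul_mem hq hc

lemma add_mem_dualExp {q q' : E3} (hq : q ∈ dualExp) (hq' : q' ∈ dualExp) : q + q' ∈ dualExp :=
  (ProperCone.innerDual expCone).add_mem hq hq'

lemma expNormal_mem (r : ℝ) : expNormal r ∈ dualExp := fun k hk => by
  have := inner_expNormal_nonneg hk r
  rwa [real_inner_comm] at this

lemma mem_dualExp_of_nonneg {y z : ℝ} (hy : 0 ≤ y) (hz : 0 ≤ z) : !₂[0, y, z] ∈ dualExp := by
  rw [mem_dualExp]
  intro k hk
  rw [inner3]
  have h1 := expCone_one_nonneg hk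
  have h2 := expCone_two_nonneg hk
  simp
  positivity

lemma mem_expCone_of_face {x z : ℝ} (hx : x ≤ 0) (hz : 0 ≤ z) : !₂[x, 0, z] ∈ expCone :=
  Or.inr ⟨hx, rfl, hz⟩

lemma dualExp_zero_nonpos {q : E3} (hq : q ∈ dualExp) : q 0 ≤ 0 := by
  have := mem_dualExp.1 hq _ (mem_expCone_of_face (x := -1) (z := 0) (by norm_num) le_rfl)
  rw [inner3] at this
  simpa using this

lemma dualExp_two_nonneg {q : E3} (hq : q ∈ dualExp) : 0 ≤ q 2 := by
  have := mem_dualExp.1 hq _ (mem_expCone_of_face (x := 0) (z := 1) le_rfl (by norm_num))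
  rw [inner3] at this
  simpa using this

lemma inner_expRay_nonneg {q : E3} (hq : q ∈ dualExp) (r : ℝ) : 0 ≤ inner ℝ (expRay r) q := by
  have := hq (smul_expRay_mem zero_le_one r)
  rwa [one_smul] at this

lemma add_mem_expCone {p k : E3} (hp : p ∈ expCone) (hk : k ∈ expCone) : p + k ∈ expCone :=
  mem_expCone_of_inner_nonneg fun r => by
    rw [inner_add_right]
    exact add_nonneg (inner_expNormal_nonneg hp r) (inner_expNormal_nonneg hk r)

lemma smul_mem_expCone {p : E3} (hp : p ∈ expCone) {c : ℝ} (hc : 0 ≤ c) : c • p ∈ expCone :=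
  mem_expCone_of_inner_nonneg fun r => by
    rw [inner_smul_right]
    exact mul_nonneg hc (inner_expNormal_nonneg hp r)

lemma isClosed_expCone : IsClosed expCone := by
  have : expCone = ⋂ r, {p : E3 | 0 ≤ inner ℝ (expNormal r) p} := by
    ext p
    simp only [Set.mem_iInter, Set.mem_ofPred_eq]
    exact ⟨fun h r => inner_expNormal_nonneg h r, mem_expCone_of_inner_nonneg⟩
  rw [this]
  exact isClosed_iInter fun r => isClosed_le continuous_const (by fun_prop)

lemma isClosed_dualExp : IsClosed dualExp := (ProperCone.innerDual expCone).isClosed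

/-! ### The projection and its regions -/

variable {P : E3 → E3}

lemma expProj_sub (hP : IsProjOn dualExp P) {p q : E3} (hq : q ∈ dualExp) (hp : p ∈ expCone)
    (h : inner ℝ p q = 0) : P (q - p) = q := by
  refine hP.eq_of_inner_le hq fun q' hq' => ?_
  have h1 : 0 ≤ inner ℝ p q' := hq' hp
  have h2 : q - p - q = -p := by abel
  rw [h2, inner_neg_left, inner_sub_right, h]
  linarith

/-- Moreau's decomposition. -/
lemma expProj_moreau (hP : IsProjOn dualExp P) (w : E3) :
    P w - w ∈ expCone ∧ inner ℝ (P w - w) (P w) = 0 := by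
  obtain ⟨h1, h2⟩ := hP w
  have h3 : ∀ q ∈ dualExp, 0 ≤ inner ℝ (P w - w) q := fun q hq => by
    have := h2 _ (add_mem_dualExp h1 hq)
    rw [add_sub_cancel_left, ← neg_sub, inner_neg_left] at this
    linarith
  refine ⟨mem_expCone_of_inner_nonneg fun r => ?_, le_antisymm ?_ (h3 _ h1)⟩
  · have := h3 _ (expNormal_mem r)
    rwa [real_inner_comm] at this
  · have := h2 0 ((ProperCone.innerDual expCone).zero_mem)
    rw [zero_sub, inner_neg_right, ← inner_neg_left, neg_sub] at this
    exact this

lemma expProj_of_mem (hP : IsProjOn dualExp P) {w : E3} (hw : w ∈ dualExp) : P w = w := by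
  have := expProj_sub hP hw (mem_expCone_of_face le_rfl le_rfl) (by simp [inner3])
  have h0 : (!₂[0, 0, 0] : E3) = 0 := by apply ext3 <;> simp
  rwa [h0, sub_zero] at this

lemma expProj_of_neg_mem (hP : IsProjOn dualExp P) {w : E3} (hw : -w ∈ expCone) : P w = 0 := by
  have := expProj_sub hP ((ProperCone.innerDual expCone).zero_mem) hw (by simp)
  rwa [zero_sub, neg_neg] at this

lemma expProj_curved (hP : IsProjOn dualExp P) {q s : ℝ} (hq : 0 ≤ q) (hs : 0 ≤ s) (r : ℝ) :
    P (q • expNormal r - s • expRay r) = q • expNormal r :=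
  expProj_sub hP (smul_mem_dualExp (expNormal_mem r) hq) (smul_expRay_mem hs r) (by
    rw [inner_smul_left, inner_smul_right, inner_expRay_expNormal]
    simp)

lemma expProj_of_nonneg (hP : IsProjOn dualExp P) {w : E3} (h0 : 0 ≤ w 0) (h1 : 0 ≤ w 1)
    (h2 : 0 ≤ w 2) : P w = !₂[0, w 1, w 2] := by
  have h := expProj_sub hP (mem_dualExp_of_nonneg h1 h2)
    (mem_expCone_of_face (neg_nonpos.2 h0) le_rfl) (by simp [inner3])
  convert h using 2
  apply ext3 <;> simp

lemma expProj_of_nonneg_nonpos (hP : IsProjOn dualExp P) {w : E3} (h0 : 0 ≤ w 0) (h1 : 0 ≤ w 1)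
    (h2 : w 2 ≤ 0) : P w = !₂[0, w 1, 0] := by
  have h := expProj_sub hP (mem_dualExp_of_nonneg h1 le_rfl)
    (mem_expCone_of_face (neg_nonpos.2 h0) (neg_nonneg.2 h2)) (by simp [inner3])
  convert h using 2
  apply ext3 <;> simp

/-- Every point lies in one of the regions where the projection is known. -/
lemma exp_regions (hP : IsProjOn dualExp P) (w : E3) :
    w ∈ dualExp ∨ -w ∈ expCone ∨ (0 ≤ w 0 ∧ 0 ≤ w 1) ∨
      ∃ r q s : ℝ, 0 ≤ q ∧ 0 ≤ s ∧ w = q • expNormal r - s • expRay r := by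
  obtain ⟨hp, hpq⟩ := expProj_moreau hP w
  have hq := (hP w).1
  set q := P w with hqdef
  set p := q - w with hpdef
  have hw : w = q - p := by rw [hpdef]; abel
  by_cases hq0 : q = 0
  · right; left
    rw [hw, hq0, zero_sub, neg_neg]
    exact hp
  by_cases hp0 : p = 0
  · left
    rw [hw, hp0, sub_zero]
    exact hq
  right; right
  have hray : ∀ r, 0 ≤ r * q 0 + q 1 + Real.exp r * q 2 := fun r => by
    have := inner_expRay_nonneg hq r
    rw [inner3] at this
    simpa using this
  have hq0' := dualExp_zero_nonpos hq
  have hq2' := dualExp_two_nonneg hq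
  rw [inner3] at hpq
  rcases hp with ⟨h1, h2⟩ | ⟨h1, h2, h3⟩
  · right
    set r := p 0 / p 1 with hr
    have hp0' : p 0 = r * p 1 := by rw [hr]; field_simp
    -- `⟪p, q⟫ = p₁ ⟪γ(r), q⟫ + (p₂ - p₁ eʳ) q₂` is a sum of two nonnegative terms
    have hsum : p 1 * (r * q 0 + q 1 + Real.exp r * q 2) + (p 2 - p 1 * Real.exp r) * q 2 = 0 := by
      rw [hp0'] at hpq
      linear_combination hpq
    have ha := mul_nonneg h1.le (hray r)
    have hb := mul_nonneg (sub_nonneg.2 h2) hq2'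
    have ha0 : r * q 0 + q 1 + Real.exp r * q 2 = 0 :=
      (mul_eq_zero.1 (le_antisymm (by linarith) ha)).resolve_left h1.ne'
    have hb0 : (p 2 - p 1 * Real.exp r) * q 2 = 0 := le_antisymm (by linarith) hb
    have hmin : IsLocalMin (fun ρ : ℝ => ρ * q 0 + q 1 + Real.exp ρ * q 2) r :=
      Eventually.of_forall fun ρ => by
        change r * q 0 + q 1 + Real.exp r * q 2 ≤ _
        rw [ha0]
        exact hray ρ
    have hder : HasDerivAt (fun ρ : ℝ => ρ * q 0 + q 1 + Real.exp ρ * q 2)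
        (1 * q 0 + Real.exp r * q 2) r :=
      (((hasDerivAt_id r).mul_const (q 0)).add_const (q 1)).add
        ((Real.hasDerivAt_exp r).mul_const (q 2))
    have hd0 := hmin.hasDerivAt_eq_zero hder
    have e0 : q 0 = -(q 2 * Real.exp r) := by linarith
    have e1 : q 1 = q 2 * ((r - 1) * Real.exp r) := by
      rw [e0] at ha0
      linear_combination ha0
    have hq2 : q 2 ≠ 0 := fun h => hq0 (ext3 (by simp [e0, h]) (by simp [e1, h]) (by simp [h]))
    have e2 : p 2 = p 1 * Real.exp r := by
      have := (mul_eq_zero.1 hb0).resolve_right hq2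
      linarith
    refine ⟨r, q 2, p 1, hq2', h1.le, ?_⟩
    rw [hw]
    apply ext3 <;> simp
    · rw [e0, hp0']; ring
    · rw [e1]
    · rw [e2]
  · left
    rw [h2] at hpq
    have ha : 0 ≤ p 0 * q 0 := mul_nonneg_of_nonpos_of_nonpos h1 hq0'
    have hb : 0 ≤ p 2 * q 2 := mul_nonneg h3 hq2'
    have ha0 : p 0 * q 0 = 0 := le_antisymm (by linarith) ha
    have hb0 : p 2 * q 2 = 0 := le_antisymm (by linarith) hb
    have hw0 : w 0 = q 0 - p 0 := by rw [hw]; rfl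
    have hw1 : w 1 = q 1 := by rw [hw]; simp [h2]
    rw [hw0, hw1]
    have hq00 : q 0 = 0 := by
      rcases mul_eq_zero.1 ha0 with h | h
      · have hp2 : p 2 ≠ 0 := fun h' => hp0 (ext3 (by simp [h]) (by simp [h2]) (by simp [h']))
        have hq2 := (mul_eq_zero.1 hb0).resolve_left hp2
        by_contra hne
        have hneg : q 0 < 0 := lt_of_le_of_ne hq0' hne
        have h4 := hray ((q 1 + 1) / (-q 0))
        have h5 : (q 1 + 1) / (-q 0) * q 0 = -(q 1 + 1) := by
          field_simp
        rw [hq2, h5] at h4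
        linarith
      · exact h
    refine ⟨by rw [hq00]; linarith, ?_⟩
    by_contra hneg
    push Not at hneg
    rw [hq00] at hray
    rcases hq2'.eq_or_lt with h | h
    · have h4 := hray 0
      rw [← h] at h4
      linarith
    · have h4 := hray (Real.log (-q 1 / (2 * q 2)))
      rw [Real.exp_log (div_pos (by linarith) (by linarith))] at h4
      have h5 : -q 1 / (2 * q 2) * q 2 = -q 1 / 2 := by field_simp
      rw [h5] at h4
      linarith

end ExpCone

end NewtonADMM

/-! ### Jacobians of the projection onto the dual exponential cone -/

namespace NewtonADMM

section ExpDeriv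

variable {P : E3 → E3} {w : E3}

lemma smul_basis3 (h : E3) :
    h = h 0 • !₂[1, 0, 0] + h 1 • !₂[0, 1, 0] + h 2 • !₂[0, 0, 1] := by
  apply ext3 <;> simp

lemma fderiv_exp_of_mem (hP : IsProjOn dualExp P) (hd : DifferentiableAt ℝ P w)
    (hw : w ∈ dualExp) (h : E3) : fderiv ℝ P w h = h := by
  have key : ∀ k ∈ dualExp, fderiv ℝ P w k = k := fun k hk => by
    refine fderiv_eq_of_eventually hd ?_
    filter_upwards [self_mem_nhdsWithin] with ε hε
    rw [expProj_of_mem hP hw,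
      expProj_of_mem hP (add_mem_dualExp hw (smul_mem_dualExp hk (le_of_lt hε)))]
  have e : h = (-h 0 / Real.exp 1) • expNormal 1 + h 1 • !₂[0, 1, 0]
      + (h 2 + h 0 / Real.exp 1) • !₂[0, 0, 1] := by
    apply ext3 <;> simp
    ring
  rw [e]
  simp only [map_add, map_smul, key _ (expNormal_mem 1),
    key _ (mem_dualExp_of_nonneg zero_le_one le_rfl),
    key _ (mem_dualExp_of_nonneg le_rfl zero_le_one)]

lemma fderiv_exp_of_neg_mem (hP : IsProjOn dualExp P) (hd : DifferentiableAt ℝ P w)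
    (hw : -w ∈ expCone) (h : E3) : fderiv ℝ P w h = 0 := by
  have key : ∀ k ∈ expCone, fderiv ℝ P w k = 0 := fun k hk => by
    have h1 : fderiv ℝ P w (-k) = 0 := by
      refine fderiv_eq_of_eventually hd ?_
      filter_upwards [self_mem_nhdsWithin] with ε hε
      rw [expProj_of_neg_mem hP hw, expProj_of_neg_mem hP]
      · simp
      · rw [smul_neg, neg_add, neg_neg]
        exact add_mem_expCone hw (smul_mem_expCone hk (le_of_lt hε))
    rwa [map_neg, neg_eq_zero] at h1
  have h0 := smul_expRay_mem zero_le_one 0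
  rw [one_smul] at h0
  have e : h = (-h 0) • !₂[-1, 0, 0] + h 1 • expRay 0 + (h 2 - h 1) • !₂[0, 0, 1] := by
    apply ext3 <;> simp
  rw [e]
  simp only [map_add, map_smul, key _ h0,
    key _ (mem_expCone_of_face (neg_nonpos.2 (zero_le_one (α := ℝ))) le_rfl),
    key _ (mem_expCone_of_face le_rfl (zero_le_one (α := ℝ))), smul_zero, add_zero]

lemma fderiv_exp_of_nonneg (hP : IsProjOn dualExp P) (hd : DifferentiableAt ℝ P w)
    (h0 : 0 ≤ w 0) (h1 : 0 ≤ w 1) (h2 : 0 ≤ w 2) (h : E3) :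
    fderiv ℝ P w h = !₂[0, h 1, h 2] := by
  have key : ∀ a b c : ℝ, 0 ≤ a → 0 ≤ b → 0 ≤ c → fderiv ℝ P w !₂[a, b, c] = !₂[0, b, c] := by
    intro a b c ha hb hc
    refine fderiv_eq_of_eventually hd ?_
    filter_upwards [self_mem_nhdsWithin] with ε hε
    have hε' : (0 : ℝ) < ε := hε
    rw [expProj_of_nonneg hP h0 h1 h2, expProj_of_nonneg hP]
    · apply ext3 <;> simp
    all_goals simp; positivity
  conv_lhs => rw [smul_basis3 h]
  simp only [map_add, map_smul, key 1 0 0 zero_le_one le_rfl le_rfl,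
    key 0 1 0 le_rfl zero_le_one le_rfl, key 0 0 1 le_rfl le_rfl zero_le_one]
  apply ext3 <;> simp

lemma fderiv_exp_of_nonneg_nonpos (hP : IsProjOn dualExp P) (hd : DifferentiableAt ℝ P w)
    (h0 : 0 ≤ w 0) (h1 : 0 ≤ w 1) (h2 : w 2 ≤ 0) (h : E3) :
    fderiv ℝ P w h = !₂[0, h 1, 0] := by
  have key : ∀ a b c : ℝ, 0 ≤ a → 0 ≤ b → 0 ≤ c → fderiv ℝ P w !₂[a, b, -c] = !₂[0, b, 0] := by
    intro a b c ha hb hc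
    refine fderiv_eq_of_eventually hd ?_
    filter_upwards [self_mem_nhdsWithin] with ε hε
    have hε' : (0 : ℝ) < ε := hε
    rw [expProj_of_nonneg_nonpos hP h0 h1 h2, expProj_of_nonneg_nonpos hP]
    · apply ext3 <;> simp
    · simp; positivity
    · simp; positivity
    · simp
      nlinarith [mul_nonneg hε'.le hc]
  have e : h = h 0 • !₂[1, 0, -0] + h 1 • !₂[0, 1, -0] + (-h 2) • !₂[0, 0, -1] := by
    apply ext3 <;> simp
  conv_lhs => rw [e]
  simp only [map_add, map_smul, key 1 0 0 zero_le_one le_rfl le_rfl,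
    key 0 1 0 le_rfl zero_le_one le_rfl, key 0 0 1 le_rfl le_rfl zero_le_one]
  apply ext3 <;> simp

lemma hasDerivAt_expNormal (r : ℝ) :
    HasDerivAt expNormal !₂[-Real.exp r, r * Real.exp r, 0] r := by
  have h1 : HasDerivAt (fun ρ : ℝ => (-Real.exp ρ) • (!₂[1, 0, 0] : E3)
      + ((ρ - 1) * Real.exp ρ) • !₂[0, 1, 0] + !₂[0, 0, 1])
      ((-Real.exp r) • !₂[1, 0, 0] + (1 * Real.exp r + (r - 1) * Real.exp r) • !₂[0, 1, 0]) r :=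
    (((Real.hasDerivAt_exp r).neg.smul_const _).add
      ((((hasDerivAt_id r).sub_const 1).mul (Real.hasDerivAt_exp r)).smul_const _)).add_const _
  have e1 : expNormal = fun ρ : ℝ => (-Real.exp ρ) • (!₂[1, 0, 0] : E3)
      + ((ρ - 1) * Real.exp ρ) • !₂[0, 1, 0] + !₂[0, 0, 1] := by
    funext ρ
    apply ext3 <;> simp
  rw [e1]
  convert h1 using 1
  apply ext3 <;> simp
  ring

lemma hasDerivAt_expRay (r : ℝ) : HasDerivAt expRay !₂[1, 0, Real.exp r] r := by
  have h1 : HasDerivAt (fun ρ : ℝ => ρ • (!₂[1, 0, 0] : E3)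
      + Real.exp ρ • !₂[0, 0, 1] + !₂[0, 1, 0])
      ((1 : ℝ) • !₂[1, 0, 0] + Real.exp r • !₂[0, 0, 1]) r :=
    (((hasDerivAt_id r).smul_const _).add ((Real.hasDerivAt_exp r).smul_const _)).add_const _
  have e1 : expRay = fun ρ : ℝ => ρ • (!₂[1, 0, 0] : E3)
      + Real.exp ρ • !₂[0, 0, 1] + !₂[0, 1, 0] := by
    funext ρ
    apply ext3 <;> simp
  rw [e1]
  convert h1 using 1
  apply ext3 <;> simp

/-- The numerator of the tangential eigenvalue of the Jacobian in the curved region. -/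
noncomputable def tangNum (r q : ℝ) : ℝ := q * Real.exp r * raySq r

/-- The eigenvalue of the Jacobian of the projection, at the point
`q • expNormal r - s • expRay r`, on the direction `expCross r` orthogonal to the normal and the
ray. -/
noncomputable def tangEig (r q s : ℝ) : ℝ := tangNum r q / (tangNum r q + s * normalSq r)

lemma tangNum_nonneg (r : ℝ) {q : ℝ} (hq : 0 ≤ q) : 0 ≤ tangNum r q :=
  mul_nonneg (mul_nonneg hq (Real.exp_pos r).le) (raySq_pos r).le

lemma tangEig_nonneg (r : ℝ) {q s : ℝ} (hq : 0 ≤ q) (hs : 0 ≤ s) : 0 ≤ tangEig r q s :=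
  div_nonneg (tangNum_nonneg r hq)
    (add_nonneg (tangNum_nonneg r hq) (mul_nonneg hs (normalSq_pos r).le))

lemma tangEig_le_one (r : ℝ) {q s : ℝ} (hq : 0 ≤ q) (hs : 0 ≤ s) : tangEig r q s ≤ 1 := by
  refine div_le_one_of_le₀ ?_
    (add_nonneg (tangNum_nonneg r hq) (mul_nonneg hs (normalSq_pos r).le))
  linarith [mul_nonneg hs (normalSq_pos r).le]

lemma tang_den_pos (r : ℝ) {q s : ℝ} (hq : 0 ≤ q) (hs : 0 ≤ s) (h : q ≠ 0 ∨ s ≠ 0) :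
    0 < tangNum r q + s * normalSq r := by
  have h1 : 0 < Real.exp r * raySq r := mul_pos (Real.exp_pos r) (raySq_pos r)
  have h2 := normalSq_pos r
  rw [tangNum, mul_assoc]
  rcases h with h | h
  · have : 0 < q := lt_of_le_of_ne hq (Ne.symm h)
    positivity
  · have : 0 < s := lt_of_le_of_ne hs (Ne.symm h)
    positivity

lemma fderiv_exp_normal (hP : IsProjOn dualExp P) {r q s : ℝ} (hq : 0 ≤ q) (hs : 0 ≤ s)
    (hd : DifferentiableAt ℝ P (q • expNormal r - s • expRay r)) :
    fderiv ℝ P (q • expNormal r - s • expRay r) (expNormal r) = expNormal r := by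
  refine fderiv_eq_of_eventually hd ?_
  filter_upwards [self_mem_nhdsWithin] with ε hε
  have hε' : (0 : ℝ) < ε := hε
  have e : q • expNormal r - s • expRay r + ε • expNormal r
      = (q + ε) • expNormal r - s • expRay r := by module
  rw [e, expProj_curved hP hq hs, expProj_curved hP (by positivity) hs, add_smul]

lemma fderiv_exp_ray (hP : IsProjOn dualExp P) {r q s : ℝ} (hq : 0 ≤ q) (hs : 0 ≤ s)
    (hd : DifferentiableAt ℝ P (q • expNormal r - s • expRay r)) :
    fderiv ℝ P (q • expNormal r - s • expRay r) (expRay r) = 0 := by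
  have h1 : fderiv ℝ P (q • expNormal r - s • expRay r) (-expRay r) = 0 := by
    refine fderiv_eq_of_eventually hd ?_
    filter_upwards [self_mem_nhdsWithin] with ε hε
    have hε' : (0 : ℝ) < ε := hε
    have e : q • expNormal r - s • expRay r + ε • -expRay r
        = q • expNormal r - (s + ε) • expRay r := by module
    rw [e, expProj_curved hP hq hs, expProj_curved hP hq (by positivity), smul_zero, add_zero]
  rwa [map_neg, neg_eq_zero] at h1

/-- Differentiating `P (q μ(ρ) - s γ(ρ)) = q μ(ρ)` in `ρ` determines the remaining eigenvalue. -/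
lemma fderiv_exp_cross (hP : IsProjOn dualExp P) {r q s : ℝ} (hq : 0 ≤ q) (hs : 0 ≤ s)
    (hne : q ≠ 0 ∨ s ≠ 0) (hd : DifferentiableAt ℝ P (q • expNormal r - s • expRay r)) :
    fderiv ℝ P (q • expNormal r - s • expRay r) (expCross r) = tangEig r q s • expCross r := by
  have h1 := fderiv_exp_normal hP hq hs hd
  have h2 := fderiv_exp_ray hP hq hs hd
  have h3 : HasDerivAt (fun ρ => q • expNormal ρ - s • expRay ρ)
      (q • !₂[-Real.exp r, r * Real.exp r, 0] - s • !₂[1, 0, Real.exp r]) r :=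
    ((hasDerivAt_expNormal r).const_smul q).sub ((hasDerivAt_expRay r).const_smul s)
  have h4 := hd.hasFDerivAt.comp_hasDerivAt r h3
  have h5 : HasDerivAt (P ∘ fun ρ => q • expNormal ρ - s • expRay ρ)
      (q • !₂[-Real.exp r, r * Real.exp r, 0]) r := by
    have e : (P ∘ fun ρ => q • expNormal ρ - s • expRay ρ) = fun ρ => q • expNormal ρ :=
      funext fun ρ => expProj_curved hP hq hs ρ
    rw [e]
    exact (hasDerivAt_expNormal r).const_smul q
  have h6 := h4.unique h5
  set D := fderiv ℝ P (q • expNormal r - s • expRay r) with hD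
  have hN : normalSq r • (!₂[-Real.exp r, r * Real.exp r, 0] : E3) = -Real.exp r • expCross r
      + (Real.exp r ^ 2 * (1 + r * (r - 1))) • expNormal r := by
    apply ext3 <;> simp [normalSq] <;> ring
  have hR : raySq r • (!₂[1, 0, Real.exp r] : E3)
      = expCross r + (r + Real.exp r ^ 2) • expRay r := by
    apply ext3 <;> simp [raySq] <;> ring
  have h7 : D ((q * raySq r) • normalSq r • (!₂[-Real.exp r, r * Real.exp r, 0] : E3)
      - (s * normalSq r) • raySq r • (!₂[1, 0, Real.exp r] : E3))
      = (q * raySq r) • normalSq r • (!₂[-Real.exp r, r * Real.exp r, 0] : E3) := by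
    have e : (q * raySq r) • normalSq r • (!₂[-Real.exp r, r * Real.exp r, 0] : E3)
      - (s * normalSq r) • raySq r • (!₂[1, 0, Real.exp r] : E3) = (raySq r * normalSq r) •
        (q • !₂[-Real.exp r, r * Real.exp r, 0] - s • !₂[1, 0, Real.exp r]) := by module
    rw [e, map_smul, h6]
    module
  rw [hN, hR] at h7
  simp only [map_sub, map_add, map_smul, h1, h2, smul_zero, add_zero] at h7
  have hpos := tang_den_pos r hq hs hne
  have h8 : (tangNum r q + s * normalSq r) • D (expCross r) = tangNum r q • expCross r := by
    have h9 := congrArg Neg.neg h7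
    have h10 : tangNum r q = q * raySq r * Real.exp r := by rw [tangNum]; ring
    rw [h10]
    linear_combination (norm := module) h9
  rw [tangEig, div_eq_inv_mul, mul_smul, ← h8, smul_smul, inv_mul_cancel₀ hpos.ne', one_smul]

lemma norm_fderiv_exp_le (hP : IsProjOn dualExp P) (w : E3) : ‖fderiv ℝ P w‖ ≤ 1 := by
  simpa using norm_fderiv_le_of_lipschitz ℝ (x₀ := w) hP.lipschitzWith

end ExpDeriv

end NewtonADMM

/-! ### Asymptotics for infinite slope -/

namespace NewtonADMM

section ExpAsymptotics

open Real

lemma tendsto_pow_mul_inv_exp (k : ℕ) :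
    Tendsto (fun r : ℝ => r ^ k * (exp r)⁻¹) atTop (𝓝 0) := by
  simpa only [exp_neg] using tendsto_pow_mul_exp_neg_atTop_nhds_zero k

lemma tendsto_inv_exp : Tendsto (fun r : ℝ => (exp r)⁻¹) atTop (𝓝 0) := by
  simpa using tendsto_pow_mul_inv_exp 0

lemma tendsto_mul_inv_exp : Tendsto (fun r : ℝ => r * (exp r)⁻¹) atTop (𝓝 0) := by
  simpa using tendsto_pow_mul_inv_exp 1

lemma tendsto_pow_mul_exp_atBot (k : ℕ) :
    Tendsto (fun r : ℝ => r ^ k * exp r) atBot (𝓝 0) := by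
  have h := ((tendsto_pow_mul_exp_neg_atTop_nhds_zero k).comp tendsto_neg_atBot_atTop).const_mul
    ((-1 : ℝ) ^ k)
  rw [mul_zero] at h
  refine h.congr fun r => ?_
  simp only [Function.comp_apply, neg_neg]
  rw [← mul_assoc, ← mul_pow, neg_one_mul, neg_neg]

lemma tendsto_mul_exp_atBot : Tendsto (fun r : ℝ => r * exp r) atBot (𝓝 0) := by
  simpa using tendsto_pow_mul_exp_atBot 1

lemma tendsto_raySq_atTop : Tendsto (fun r : ℝ => raySq r * (exp r)⁻¹ ^ 2) atTop (𝓝 1) := by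
  have h := ((tendsto_mul_inv_exp.pow 2).add (tendsto_inv_exp.pow 2)).add_const 1
  simp only [ne_eq, OfNat.ofNat_ne_zero, not_false_eq_true, zero_pow, add_zero, zero_add] at h
  refine h.congr fun r => ?_
  have := exp_ne_zero r
  rw [raySq]
  field_simp

lemma tendsto_normalSq_atTop :
    Tendsto (fun r : ℝ => normalSq r * (exp r)⁻¹ ^ 2) atTop atTop := by
  have h1 : Tendsto (fun r : ℝ => (r - 1) ^ 2) atTop atTop :=
    (tendsto_pow_atTop two_ne_zero).comp (tendsto_atTop_add_const_right _ _ tendsto_id)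
  refine tendsto_atTop_mono (fun r => ?_) h1
  have : normalSq r * (exp r)⁻¹ ^ 2 = (exp r)⁻¹ ^ 2 + 1 + (r - 1) ^ 2 := by
    have := exp_ne_zero r
    rw [normalSq]
    field_simp
    ring
  rw [this]
  have : 0 < (exp r)⁻¹ ^ 2 := by positivity
  linarith

lemma tendsto_raySq_div_normalSq : Tendsto (fun r : ℝ => raySq r / normalSq r) atTop (𝓝 0) := by
  refine (tendsto_raySq_atTop.div_atTop tendsto_normalSq_atTop).congr fun r => ?_
  have := exp_ne_zero r
  have := (normalSq_pos r).ne'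
  field_simp

lemma tendsto_normalSq_div_raySq_atTop :
    Tendsto (fun r : ℝ => normalSq r * (r - 1) / (exp r * raySq r)) atTop (𝓝 0) := by
  have h1 := (((((tendsto_mul_inv_exp.mul (tendsto_inv_exp.pow 2)).sub
    (tendsto_inv_exp.pow 3)).add (tendsto_pow_mul_inv_exp 3)).sub
    ((tendsto_pow_mul_inv_exp 2).const_mul 3)).add (tendsto_mul_inv_exp.const_mul 4)).sub
    (tendsto_inv_exp.const_mul 2)
  have h2 := h1.div tendsto_raySq_atTop one_ne_zero
  simp only [ne_eq, OfNat.ofNat_ne_zero, not_false_eq_true, zero_pow, mul_zero, sub_zero, add_zero,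
    zero_div] at h2
  refine h2.congr fun r => ?_
  have := exp_ne_zero r
  have := (raySq_pos r).ne'
  simp only [Pi.div_apply]
  rw [normalSq]
  field_simp
  ring

lemma tendsto_exp_sq_atBot : Tendsto (fun r : ℝ => exp r ^ 2) atBot (𝓝 0) := by
  simpa using tendsto_exp_atBot.pow 2

lemma tendsto_normalSq_atBot : Tendsto normalSq atBot (𝓝 1) := by
  have h := ((((tendsto_mul_exp_atBot.pow 2).sub
    ((tendsto_mul_exp_atBot.mul tendsto_exp_atBot).const_mul 2)).add
    (tendsto_exp_sq_atBot.const_mul 2))).const_add 1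
  simp only [ne_eq, OfNat.ofNat_ne_zero, not_false_eq_true, zero_pow, mul_zero, sub_zero,
    add_zero] at h
  refine h.congr fun r => ?_
  rw [normalSq]
  ring

lemma tendsto_raySq_atBot : Tendsto raySq atBot atTop := by
  have h1 : Tendsto (fun r : ℝ => r ^ 2) atBot atTop := by
    have := (tendsto_pow_atTop (α := ℝ) two_ne_zero).comp tendsto_neg_atBot_atTop
    refine this.congr fun r => ?_
    simp
  refine tendsto_atTop_mono (fun r => ?_) h1
  rw [raySq]
  have : 0 < exp r ^ 2 := by positivity
  linarith

lemma tendsto_normalSq_div_raySq_atBot :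
    Tendsto (fun r : ℝ => normalSq r / raySq r) atBot (𝓝 0) :=
  tendsto_normalSq_atBot.div_atTop tendsto_raySq_atBot

lemma tendsto_exp_mul_raySq_atBot :
    Tendsto (fun r : ℝ => r * (exp r * raySq r)) atBot (𝓝 0) := by
  have h := ((tendsto_pow_mul_exp_atBot 3).add tendsto_mul_exp_atBot).add
    (tendsto_mul_exp_atBot.mul tendsto_exp_sq_atBot)
  simp only [mul_zero, add_zero] at h
  refine h.congr fun r => ?_
  rw [raySq]
  ring

end ExpAsymptotics

section Directions

variable {α : Type*} {U : Filter α}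

lemma tendsto3 {f : α → E3} {x : E3} (h0 : Tendsto (fun a => f a 0) U (𝓝 (x 0)))
    (h1 : Tendsto (fun a => f a 1) U (𝓝 (x 1))) (h2 : Tendsto (fun a => f a 2) U (𝓝 (x 2))) :
    Tendsto f U (𝓝 x) := by
  have h : Tendsto (fun a => (f a).ofLp) U (𝓝 x.ofLp) := tendsto_pi_nhds.2 fun i => by
    fin_cases i
    exacts [h0, h1, h2]
  exact ((PiLp.continuous_toLp 2 (fun _ : Fin 3 => ℝ)).tendsto x.ofLp).comp h

lemma tendsto_coord {f : α → E3} {x : E3} (h : Tendsto f U (𝓝 x)) (i : Fin 3) :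
    Tendsto (fun a => f a i) U (𝓝 (x i)) :=
  ((EuclideanSpace.proj (𝕜 := ℝ) i).continuous.tendsto x).comp h

lemma tendsto_normal_dir_atTop {r : α → ℝ} (hr : Tendsto r U atTop) :
    Tendsto (fun a => (r a * Real.exp (r a))⁻¹ • expNormal (r a)) U (𝓝 !₂[0, 1, 0]) := by
  have hi := tendsto_inv_atTop_zero.comp hr
  have hu := tendsto_inv_exp.comp hr
  have hne : ∀ᶠ a in U, r a ≠ 0 := hr.eventually_ne_atTop 0
  refine tendsto3 ?_ ?_ ?_
  · have h := hi.neg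
    rw [neg_zero] at h
    refine h.congr' (hne.mono fun a ha => ?_)
    have := Real.exp_ne_zero (r a)
    simp
    field_simp
  · have h := hi.const_sub 1
    rw [sub_zero] at h
    refine h.congr' (hne.mono fun a ha => ?_)
    have := Real.exp_ne_zero (r a)
    simp
    field_simp
  · have h := hi.mul hu
    rw [mul_zero] at h
    refine h.congr' (hne.mono fun a ha => ?_)
    simp [mul_comm]

lemma tendsto_ray_dir_atTop {r : α → ℝ} (hr : Tendsto r U atTop) :
    Tendsto (fun a => (Real.exp (r a))⁻¹ • expRay (r a)) U (𝓝 !₂[0, 0, 1]) := by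
  refine tendsto3 ?_ ?_ ?_
  · refine (tendsto_mul_inv_exp.comp hr).congr fun a => ?_
    simp [mul_comm]
  · refine (tendsto_inv_exp.comp hr).congr fun a => ?_
    simp
  · simp
    exact tendsto_const_nhds

lemma tendsto_cross_dir_atTop {r : α → ℝ} (hr : Tendsto r U atTop) :
    Tendsto (fun a => (r a * Real.exp (r a) ^ 2)⁻¹ • expCross (r a)) U (𝓝 !₂[-1, 0, 0]) := by
  have hi := tendsto_inv_atTop_zero.comp hr
  have hu := tendsto_inv_exp.comp hr
  have hm := tendsto_mul_inv_exp.comp hr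
  have hne : ∀ᶠ a in U, r a ≠ 0 := hr.eventually_ne_atTop 0
  refine tendsto3 ?_ ?_ ?_
  · have h := ((hi.mul (hu.pow 2)).add hi).sub_const 1
    simp only [zero_mul, zero_add, zero_sub] at h
    refine h.congr' (hne.mono fun a ha => ?_)
    have := Real.exp_ne_zero (r a)
    simp
    field_simp
    ring
  · have h := (hi.add (hu.pow 2)).neg
    simp only [ne_eq, OfNat.ofNat_ne_zero, not_false_eq_true, zero_pow, add_zero, neg_zero] at h
    refine h.congr' (hne.mono fun a ha => ?_)
    have := Real.exp_ne_zero (r a)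
    simp
    field_simp
  · have h := (hm.sub hu).add (hi.mul hu)
    simp only [sub_zero, mul_zero, add_zero] at h
    refine h.congr' (hne.mono fun a ha => ?_)
    have := Real.exp_ne_zero (r a)
    simp
    field_simp

lemma tendsto_normal_dir_atBot {r : α → ℝ} (hr : Tendsto r U atBot) :
    Tendsto (fun a => expNormal (r a)) U (𝓝 !₂[0, 0, 1]) := by
  refine tendsto3 ?_ ?_ ?_
  · have h := (Real.tendsto_exp_atBot.comp hr).neg
    rw [neg_zero] at h
    exact h
  · have h := (tendsto_mul_exp_atBot.comp hr).sub (Real.tendsto_exp_atBot.comp hr)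
    rw [sub_zero] at h
    refine h.congr fun a => ?_
    simp
    ring
  · simp
    exact tendsto_const_nhds

lemma tendsto_ray_dir_atBot {r : α → ℝ} (hr : Tendsto r U atBot) :
    Tendsto (fun a => (-r a)⁻¹ • expRay (r a)) U (𝓝 !₂[-1, 0, 0]) := by
  have hi := tendsto_inv_atBot_zero.comp hr
  have he := Real.tendsto_exp_atBot.comp hr
  have hne : ∀ᶠ a in U, r a ≠ 0 := hr.eventually_ne_atBot 0
  refine tendsto3 ?_ ?_ ?_
  · refine tendsto_const_nhds.congr' (hne.mono fun a ha => ?_)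
    simp [ha]
  · have h := hi.neg
    rw [neg_zero] at h
    refine h.congr fun a => ?_
    simp
  · have h := (hi.mul he).neg
    rw [mul_zero, neg_zero] at h
    refine h.congr fun a => ?_
    simp

lemma tendsto_cross_dir_atBot {r : α → ℝ} (hr : Tendsto r U atBot) :
    Tendsto (fun a => (-r a)⁻¹ • expCross (r a)) U (𝓝 !₂[0, 1, 0]) := by
  have hi := tendsto_inv_atBot_zero.comp hr
  have he := Real.tendsto_exp_atBot.comp hr
  have hm := tendsto_mul_exp_atBot.comp hr
  have hne : ∀ᶠ a in U, r a ≠ 0 := hr.eventually_ne_atBot 0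
  refine tendsto3 ?_ ?_ ?_
  · have h := ((he.pow 2).sub hi).sub (hi.mul (he.pow 2))
    simp only [ne_eq, OfNat.ofNat_ne_zero, not_false_eq_true, zero_pow, sub_zero, mul_zero] at h
    refine h.congr' (hne.mono fun a ha => ?_)
    simp
    field_simp
    ring
  · have h := (hi.mul (he.pow 2)).add_const 1
    simp only [zero_mul, zero_add] at h
    refine h.congr' (hne.mono fun a ha => ?_)
    simp
    field_simp
    ring
  · have h := ((hm.sub he).add (hi.mul he)).neg
    simp only [sub_zero, mul_zero, add_zero, neg_zero] at h
    refine h.congr' (hne.mono fun a ha => ?_)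
    simp
    field_simp
    ring

/-- Contractions with eigenvectors converging to a basis: the eigenvalue need only converge after
multiplication with the corresponding coordinate of the limit. -/
lemma tendsto_apply_of_eigen {D : α → E3 →L[ℝ] E3} (hD : ∀ a, ‖D a‖ ≤ 1) {δ : α → E3} {d : E3}
    (hδ : Tendsto δ U (𝓝 d)) {m g e : α → E3} {a b c : E3} (hm : Tendsto m U (𝓝 a))
    (hg : Tendsto g U (𝓝 b)) (he : Tendsto e U (𝓝 c)) {θ : α → ℝ}
    (hDm : ∀ᶠ i in U, D i (m i) = m i) (hDg : ∀ᶠ i in U, D i (g i) = 0)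
    (hDe : ∀ᶠ i in U, D i (e i) = θ i • e i) {x y κ τ : ℝ} (hd : d = x • a + y • b + κ • c)
    (hτ : Tendsto (fun i => θ i * κ) U (𝓝 τ)) :
    Tendsto (fun i => D i (δ i)) U (𝓝 (x • a + τ • c)) := by
  have h1 : Tendsto (fun i => δ i - (x • m i + y • g i + κ • e i)) U (𝓝 0) := by
    have := hδ.sub (((hm.const_smul x).add (hg.const_smul y)).add (he.const_smul κ))
    rwa [← hd, sub_self] at this
  have h2 : Tendsto (fun i => D i (δ i - (x • m i + y • g i + κ • e i))) U (𝓝 0) := by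
    refine squeeze_zero_norm (fun i => ?_) (tendsto_zero_iff_norm_tendsto_zero.1 h1)
    exact ((D i).le_opNorm _).trans (mul_le_of_le_one_left (norm_nonneg _) (hD i))
  have h3 := h2.add ((hm.const_smul x).add (hτ.smul he))
  rw [zero_add] at h3
  refine h3.congr' ?_
  filter_upwards [hDm, hDg, hDe] with i i1 i2 i3
  simp only [map_sub, map_add, map_smul, i1, i2, i3]
  module

end Directions

section Approach

/-- A way of approaching `z` in the direction `d` through points of differentiability of `P`. -/
structure Approach (P : E3 → E3) (z d : E3) (U : Filter (ℝ × E3)) : Prop where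
  pos : ∀ᶠ p in U, 0 < p.1
  zero : Tendsto Prod.fst U (𝓝 0)
  dir : Tendsto Prod.snd U (𝓝 d)
  diff : ∀ᶠ p in U, DifferentiableAt ℝ P (z + p.1 • p.2)

/-- To first order the `i`-th coordinate of `z + t d` is nonnegative for small `t > 0`. -/
def DirNonneg (z d : E3) (i : Fin 3) : Prop := 0 ≤ z i ∧ (z i = 0 → 0 ≤ d i)

/-- To first order the `i`-th coordinate of `z + t d` is nonpositive for small `t > 0`. -/
def DirNonpos (z d : E3) (i : Fin 3) : Prop := z i ≤ 0 ∧ (z i = 0 → d i ≤ 0)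

variable {P : E3 → E3} {z d : E3} {U : Filter (ℝ × E3)}

namespace Approach

lemma point (h : Approach P z d U) : Tendsto (fun p : ℝ × E3 => z + p.1 • p.2) U (𝓝 z) := by
  simpa using (h.zero.smul h.dir).const_add z

lemma dirNonneg [U.NeBot] (h : Approach P z d U) {i : Fin 3}
    (hi : ∀ᶠ p in U, 0 ≤ (z + p.1 • p.2) i) : DirNonneg z d i := by
  refine ⟨ge_of_tendsto (tendsto_coord h.point i) hi, fun hz => ?_⟩
  refine ge_of_tendsto (tendsto_coord h.dir i) ?_
  filter_upwards [hi, h.pos] with p hp hpos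
  rw [PiLp.add_apply, PiLp.smul_apply, hz, zero_add, smul_eq_mul] at hp
  exact (mul_nonneg_iff_of_pos_left hpos).1 hp

lemma dirNonpos [U.NeBot] (h : Approach P z d U) {i : Fin 3}
    (hi : ∀ᶠ p in U, (z + p.1 • p.2) i ≤ 0) : DirNonpos z d i := by
  refine ⟨le_of_tendsto (tendsto_coord h.point i) hi, fun hz => ?_⟩
  refine le_of_tendsto (tendsto_coord h.dir i) ?_
  filter_upwards [hi, h.pos] with p hp hpos
  rw [PiLp.add_apply, PiLp.smul_apply, hz, zero_add, smul_eq_mul] at hp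
  by_contra hlt
  push Not at hlt
  exact absurd hp (mul_pos hpos hlt).not_ge

lemma inner_nonneg [U.NeBot] (h : Approach P z d U) {v : E3}
    (hv : ∀ᶠ p in U, 0 ≤ inner ℝ v (z + p.1 • p.2)) (hz : inner ℝ v z = 0) : 0 ≤ inner ℝ v d := by
  refine ge_of_tendsto (tendsto_const_nhds.inner h.dir) ?_
  filter_upwards [hv, h.pos] with p hp hpos
  rw [inner_add_right, inner_smul_right, hz, zero_add] at hp
  exact (mul_nonneg_iff_of_pos_left hpos).1 hp

lemma inner_nonpos [U.NeBot] (h : Approach P z d U) {v : E3}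
    (hv : ∀ᶠ p in U, inner ℝ v (z + p.1 • p.2) ≤ 0) (hz : inner ℝ v z = 0) : inner ℝ v d ≤ 0 := by
  have h1 := h.inner_nonneg (v := -v) (hv.mono fun p hp => by
    rw [inner_neg_left]
    exact neg_nonneg.2 hp) (by rw [inner_neg_left, hz, neg_zero])
  rw [inner_neg_left] at h1
  linarith

end Approach

end Approach

end NewtonADMM

/-! ### Approach through the curved region -/

namespace NewtonADMM

section Curved

/-- An approach through the curved region of the projection onto the dual exponential cone, with
the parameters of the points recorded. -/
structure CurvedApproach (P : E3 → E3) (z d : E3) (U : Filter (ℝ × E3)) (r q s : ℝ × E3 → ℝ) :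
    Prop extends Approach P z d U where
  q_nonneg : ∀ᶠ p in U, 0 ≤ q p
  s_nonneg : ∀ᶠ p in U, 0 ≤ s p
  eq : ∀ᶠ p in U, z + p.1 • p.2 = q p • expNormal (r p) - s p • expRay (r p)

lemma tangEig_le_div {r q s : ℝ} (hq : 0 ≤ q) (hs : 0 < s) :
    tangEig r q s ≤ tangNum r q / (s * normalSq r) := by
  have h1 := tangNum_nonneg r hq
  have h2 := mul_pos hs (normalSq_pos r)
  exact div_le_div_of_nonneg_left h1 h2 (by linarith)

lemma one_sub_tangEig_le_div {r q s : ℝ} (hq : 0 < q) (hs : 0 ≤ s) :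
    1 - tangEig r q s ≤ s * normalSq r / tangNum r q := by
  have h1 : 0 < tangNum r q := mul_pos (mul_pos hq (Real.exp_pos r)) (raySq_pos r)
  have h2 := mul_nonneg hs (normalSq_pos r).le
  have h3 : 1 - tangEig r q s = s * normalSq r / (tangNum r q + s * normalSq r) := by
    rw [tangEig]
    have : tangNum r q + s * normalSq r ≠ 0 := by positivity
    field_simp
    ring
  rw [h3]
  exact div_le_div_of_nonneg_left h2 h1 (by linarith)

variable {P : E3 → E3} {z d : E3} {U : Filter (ℝ × E3)} {r q s : ℝ × E3 → ℝ}

namespace CurvedApproach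

lemma tendsto_normal (h : CurvedApproach P z d U r q s) (hP : IsProjOn dualExp P) :
    Tendsto (fun p => q p • expNormal (r p)) U (𝓝 (P z)) := by
  refine ((hP.lipschitzWith.continuous.tendsto z).comp h.point).congr' ?_
  filter_upwards [h.eq, h.q_nonneg, h.s_nonneg] with p h1 h2 h3
  rw [Function.comp_apply, h1, expProj_curved hP h2 h3]

lemma tendsto_ray (h : CurvedApproach P z d U r q s) (hP : IsProjOn dualExp P) :
    Tendsto (fun p => s p • expRay (r p)) U (𝓝 (P z - z)) := by
  refine ((h.tendsto_normal hP).sub h.point).congr' ?_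
  filter_upwards [h.eq] with p h1
  rw [h1, sub_sub_cancel]

lemma tendsto_q (h : CurvedApproach P z d U r q s) (hP : IsProjOn dualExp P) :
    Tendsto q U (𝓝 (P z 2)) := by
  simpa using tendsto_coord (h.tendsto_normal hP) 2

lemma tendsto_s (h : CurvedApproach P z d U r q s) (hP : IsProjOn dualExp P) :
    Tendsto s U (𝓝 ((P z - z) 1)) := by
  simpa using tendsto_coord (h.tendsto_ray hP) 1

lemma eventually_ne (h : CurvedApproach P z d U r q s) (hz : z ≠ 0) :
    ∀ᶠ p in U, q p ≠ 0 ∨ s p ≠ 0 := by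
  filter_upwards [h.point.eventually_ne hz, h.eq] with p h1 h2
  by_contra! h3
  rw [h2, h3.1, h3.2] at h1
  simp at h1

lemma fderiv_normal (h : CurvedApproach P z d U r q s) (hP : IsProjOn dualExp P) :
    ∀ᶠ p in U, fderiv ℝ P (z + p.1 • p.2) (expNormal (r p)) = expNormal (r p) := by
  filter_upwards [h.eq, h.q_nonneg, h.s_nonneg, h.diff] with p h1 h2 h3 h4
  rw [h1] at h4 ⊢
  exact fderiv_exp_normal hP h2 h3 h4

lemma fderiv_ray (h : CurvedApproach P z d U r q s) (hP : IsProjOn dualExp P) :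
    ∀ᶠ p in U, fderiv ℝ P (z + p.1 • p.2) (expRay (r p)) = 0 := by
  filter_upwards [h.eq, h.q_nonneg, h.s_nonneg, h.diff] with p h1 h2 h3 h4
  rw [h1] at h4 ⊢
  exact fderiv_exp_ray hP h2 h3 h4

lemma fderiv_cross (h : CurvedApproach P z d U r q s) (hP : IsProjOn dualExp P) (hz : z ≠ 0) :
    ∀ᶠ p in U, fderiv ℝ P (z + p.1 • p.2) (expCross (r p))
      = tangEig (r p) (q p) (s p) • expCross (r p) := by
  filter_upwards [h.eq, h.q_nonneg, h.s_nonneg, h.diff, h.eventually_ne hz] with p h1 h2 h3 h4 h5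
  rw [h1] at h4 ⊢
  exact fderiv_exp_cross hP h2 h3 h5 h4

/-- Limits of Jacobians along directions proportional to the eigenvectors. -/
lemma tendsto_fderiv (h : CurvedApproach P z d U r q s) (hP : IsProjOn dualExp P) (hz : z ≠ 0)
    {x₁ x₂ x₃ : ℝ × E3 → ℝ} {a b c : E3}
    (hm : Tendsto (fun p => x₁ p • expNormal (r p)) U (𝓝 a))
    (hg : Tendsto (fun p => x₂ p • expRay (r p)) U (𝓝 b))
    (he : Tendsto (fun p => x₃ p • expCross (r p)) U (𝓝 c)) {x y κ τ : ℝ}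
    (hd : d = x • a + y • b + κ • c)
    (hτ : Tendsto (fun p => tangEig (r p) (q p) (s p) * κ) U (𝓝 τ)) :
    Tendsto (fun p => fderiv ℝ P (z + p.1 • p.2) p.2) U (𝓝 (x • a + τ • c)) := by
  refine tendsto_apply_of_eigen (fun p => norm_fderiv_exp_le hP _) h.dir hm hg he ?_ ?_ ?_ hd hτ
  · filter_upwards [h.fderiv_normal hP] with p hp
    rw [map_smul, hp]
  · filter_upwards [h.fderiv_ray hP] with p hp
    rw [map_smul, hp, smul_zero]
  · filter_upwards [h.fderiv_cross hP hz] with p hp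
    rw [map_smul, hp, smul_comm]

lemma tangEig_zero (h : CurvedApproach P z d U r q s) (hs : ∀ᶠ p in U, 0 < s p)
    {f : ℝ × E3 → ℝ} (hf : ∀ᶠ p in U, tangNum (r p) (q p) / (s p * normalSq (r p)) ≤ f p)
    (hf0 : Tendsto f U (𝓝 0)) :
    Tendsto (fun p => tangEig (r p) (q p) (s p)) U (𝓝 0) := by
  refine tendsto_of_tendsto_of_tendsto_of_le_of_le' tendsto_const_nhds hf0 ?_ ?_
  · filter_upwards [h.q_nonneg, h.s_nonneg] with p h1 h2
    exact tangEig_nonneg _ h1 h2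
  · filter_upwards [h.q_nonneg, hs, hf] with p h1 h2 h3
    exact (tangEig_le_div h1 h2).trans h3

lemma tangEig_one (h : CurvedApproach P z d U r q s) (hq : ∀ᶠ p in U, 0 < q p)
    {f : ℝ × E3 → ℝ} (hf : ∀ᶠ p in U, s p * normalSq (r p) / tangNum (r p) (q p) ≤ f p)
    (hf0 : Tendsto f U (𝓝 0)) :
    Tendsto (fun p => tangEig (r p) (q p) (s p)) U (𝓝 1) := by
  have h0 : Tendsto (fun p => 1 - f p) U (𝓝 1) := by simpa using hf0.const_sub 1
  refine tendsto_of_tendsto_of_tendsto_of_le_of_le' h0 tendsto_const_nhds ?_ ?_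
  · filter_upwards [hq, h.s_nonneg, hf] with p h1 h2 h3
    have := one_sub_tangEig_le_div (r := r p) h1 h2
    linarith
  · filter_upwards [h.q_nonneg, h.s_nonneg] with p h1 h2
    exact tangEig_le_one _ h1 h2

lemma coord_zero (h : CurvedApproach P z d U r q s) :
    ∀ᶠ p in U, (z + p.1 • p.2) 0 = -(q p * Real.exp (r p)) - s p * r p := by
  filter_upwards [h.eq] with p hp
  rw [hp]
  simp

lemma coord_one (h : CurvedApproach P z d U r q s) :
    ∀ᶠ p in U, (z + p.1 • p.2) 1 = q p * ((r p - 1) * Real.exp (r p)) - s p := by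
  filter_upwards [h.eq] with p hp
  rw [hp]
  simp

lemma coord_two (h : CurvedApproach P z d U r q s) :
    ∀ᶠ p in U, (z + p.1 • p.2) 2 = q p - s p * Real.exp (r p) := by
  filter_upwards [h.eq] with p hp
  rw [hp]
  simp

end CurvedApproach

/-- The value of the directional derivative of the projection in the curved region. -/
noncomputable def curvedDir (ρ Q S : ℝ) (d : E3) : E3 :=
  (inner ℝ (expNormal ρ) d / normalSq ρ) • expNormal ρ
    + (tangEig ρ Q S * (inner ℝ (expCross ρ) d / (raySq ρ * normalSq ρ))) • expCross ρ

/-- The possible limits of Jacobians of the projection onto the dual exponential cone, applied to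
the direction `d` along which the point `z` is approached, each with the constraints on `z` and `d`
under which it arises. -/
inductive ExpOutcome (z d : E3) : E3 → Prop
  | dual (hz : z ∈ dualExp) (h0 : DirNonpos z d 0) (h2 : DirNonneg z d 2)
      (hray : ∀ r, inner ℝ (expRay r) z = 0 → 0 ≤ inner ℝ (expRay r) d) : ExpOutcome z d d
  | polar (hz : -z ∈ expCone) (h1 : DirNonpos z d 1) (h2 : DirNonpos z d 2)
      (hnormal : ∀ r, inner ℝ (expNormal r) z = 0 → inner ℝ (expNormal r) d ≤ 0) :
      ExpOutcome z d 0
  | quadrant_pos (h0 : DirNonneg z d 0) (h1 : DirNonneg z d 1) (h2 : DirNonneg z d 2) :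
      ExpOutcome z d !₂[0, d 1, d 2]
  | quadrant_neg (h0 : DirNonneg z d 0) (h1 : DirNonneg z d 1) (h2 : DirNonpos z d 2) :
      ExpOutcome z d !₂[0, d 1, 0]
  | curved (ρ Q S : ℝ) (hQ : 0 ≤ Q) (hS : 0 ≤ S) (hz : z = Q • expNormal ρ - S • expRay ρ)
      (hS0 : S = 0 → inner ℝ (expRay ρ) d ≤ 0) (hQ0 : Q = 0 → 0 ≤ inner ℝ (expNormal ρ) d) :
      ExpOutcome z d (curvedDir ρ Q S d)
  | top_pos (z0 : z 0 = 0) (z1 : 0 < z 1) (d0 : d 0 ≤ 0) (h2 : DirNonpos z d 2) :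
      ExpOutcome z d !₂[d 0, d 1, 0]
  | top_zero (z0 : z 0 = 0) (z1 : z 1 = 0) (z2 : z 2 < 0) (d0 : d 0 ≤ 0) (d1 : 0 ≤ d 1) :
      ExpOutcome z d !₂[0, d 1, 0]
  | bot_pos (z1 : z 1 = 0) (z0 : 0 < z 0) (d1 : d 1 ≤ 0) (h2 : DirNonneg z d 2) :
      ExpOutcome z d !₂[0, 0, d 2]
  | bot_zero (z1 : z 1 = 0) (z0 : z 0 = 0) (z2 : 0 < z 2) (d1 : d 1 ≤ 0) (d0 : 0 ≤ d 0) :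
      ExpOutcome z d !₂[0, d 1, d 2]

namespace CurvedApproach

lemma outcome_finite [U.NeBot] (h : CurvedApproach P z d U r q s) (hP : IsProjOn dualExp P)
    (hz : z ≠ 0) {ρ : ℝ} (hr : Tendsto r U (𝓝 ρ)) :
    ∃ l, Tendsto (fun p => fderiv ℝ P (z + p.1 • p.2) p.2) U (𝓝 l) ∧ ExpOutcome z d l := by
  have cN : Continuous expNormal := continuous_iff_continuousAt.2 fun ρ =>
    (hasDerivAt_expNormal ρ).continuousAt
  have cR : Continuous expRay := continuous_iff_continuousAt.2 fun ρ =>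
    (hasDerivAt_expRay ρ).continuousAt
  have tN := (cN.tendsto ρ).comp hr
  have tR := (cR.tendsto ρ).comp hr
  have tC : Tendsto (fun p => expCross (r p)) U (𝓝 (expCross ρ)) := by
    have he := (Real.continuous_exp.tendsto ρ).comp hr
    refine tendsto3 ?_ ?_ ?_
    · exact ((hr.sub_const 1).mul (he.pow 2)).const_sub 1
    · exact ((he.pow 2).add hr).neg
    · exact (((hr.pow 2).sub hr).add_const 1).mul he
  have hq := h.tendsto_q hP
  have hs := h.tendsto_s hP
  set Q := P z 2
  set S := (P z - z) 1
  have hQ : 0 ≤ Q := ge_of_tendsto hq h.q_nonneg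
  have hS : 0 ≤ S := ge_of_tendsto hs h.s_nonneg
  have hzeq : z = Q • expNormal ρ - S • expRay ρ := by
    have h1 : Tendsto (fun p => q p • expNormal (r p) - s p • expRay (r p)) U
        (𝓝 (Q • expNormal ρ - S • expRay ρ)) := (hq.smul tN).sub (hs.smul tR)
    exact tendsto_nhds_unique (h.point.congr' h.eq) h1
  have hne : Q ≠ 0 ∨ S ≠ 0 := by
    by_contra! h3
    rw [h3.1, h3.2] at hzeq
    simp at hzeq
    exact hz hzeq
  have hθ : Tendsto (fun p => tangEig (r p) (q p) (s p)) U (𝓝 (tangEig ρ Q S)) := by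
    have he := (Real.continuous_exp.tendsto ρ).comp hr
    have h1 : Tendsto (fun p => tangNum (r p) (q p)) U (𝓝 (tangNum ρ Q)) :=
      (hq.mul he).mul (((hr.pow 2).add_const 1).add (he.pow 2))
    have h2 : Tendsto (fun p => normalSq (r p)) U (𝓝 (normalSq ρ)) :=
      (((((hr.sub_const 1).pow 2).const_add 1)).mul (he.pow 2)).const_add 1
    exact h1.div (h1.add (hs.mul h2)) (tang_den_pos ρ hQ hS hne).ne'
  refine ⟨_, h.tendsto_fderiv hP hz (x₁ := fun _ => 1) (x₂ := fun _ => 1) (x₃ := fun _ => 1)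
    (by simpa [Function.comp_def] using tN) (by simpa [Function.comp_def] using tR)
    (by simpa using tC) (exp_decomposition ρ d)
    (hθ.mul_const _), ExpOutcome.curved ρ Q S hQ hS hzeq ?_ ?_⟩
  · intro hS0
    have hzN : z = Q • expNormal ρ := by simpa [hS0] using hzeq
    have h1 : Tendsto (fun p => inner ℝ (expRay (r p)) p.2) U (𝓝 (inner ℝ (expRay ρ) d)) :=
      tR.inner h.dir
    refine le_of_tendsto h1 ?_
    filter_upwards [h.eq, h.s_nonneg, h.pos] with p h2 h3 h4
    have h5 : inner ℝ (expRay (r p)) (z + p.1 • p.2) ≤ 0 := by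
      rw [h2, inner_sub_right, inner_smul_right, inner_smul_right, inner_expRay_expNormal,
        inner_expRay_self]
      have := mul_nonneg h3 (raySq_pos (r p)).le
      linarith
    have h6 : 0 ≤ inner ℝ (expRay (r p)) z := by
      rw [hzN]
      exact inner_expRay_nonneg (smul_mem_dualExp (expNormal_mem ρ) hQ) _
    rw [inner_add_right, inner_smul_right] at h5
    by_contra! h7
    linarith [mul_pos h4 h7]
  · intro hQ0
    have hzN : z = -(S • expRay ρ) := by simpa [hQ0] using hzeq
    have h1 : Tendsto (fun p => inner ℝ (expNormal (r p)) p.2) U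
        (𝓝 (inner ℝ (expNormal ρ) d)) := tN.inner h.dir
    refine ge_of_tendsto h1 ?_
    filter_upwards [h.eq, h.q_nonneg, h.pos] with p h2 h3 h4
    have h5 : 0 ≤ inner ℝ (expNormal (r p)) (z + p.1 • p.2) := by
      rw [h2, inner_sub_right, inner_smul_right, inner_smul_right, real_inner_comm,
        real_inner_comm (expRay _), inner_expRay_expNormal, inner_expNormal_self]
      have := mul_nonneg h3 (normalSq_pos (r p)).le
      linarith
    have h6 : inner ℝ (expNormal (r p)) z ≤ 0 := by
      rw [hzN, inner_neg_right]
      exact neg_nonpos.2 (inner_expNormal_nonneg (smul_expRay_mem hS ρ) _)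
    rw [inner_add_right, inner_smul_right] at h5
    by_contra! h7
    linarith [mul_neg_of_pos_of_neg h4 h7]

end CurvedApproach

end Curved

end NewtonADMM

/-! ### Approach with the slope tending to infinity -/

namespace NewtonADMM

section CurvedInfinite

open Real

variable {P : E3 → E3} {z d : E3} {U : Filter (ℝ × E3)} {r q s : ℝ × E3 → ℝ}

namespace CurvedApproach

/-- Coordinates of the approached point when the slope of the ray tends to `+∞`. -/
lemma limits_atTop [U.NeBot] (h : CurvedApproach P z d U r q s) (hP : IsProjOn dualExp P)
    (hr : Tendsto r U atTop) :
    z 0 = 0 ∧ Tendsto (fun p => q p * (r p - 1) * exp (r p)) U (𝓝 (z 1)) ∧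
      Tendsto (fun p => s p * exp (r p)) U (𝓝 (-z 2)) := by
  have hu := tendsto_inv_exp.comp hr
  have t1 : Tendsto (fun p => q p * (r p - 1) * exp (r p)) U (𝓝 (P z 1)) := by
    refine (tendsto_coord (h.tendsto_normal hP) 1).congr fun p => ?_
    simp [mul_assoc]
  have hi : Tendsto (fun p => (r p - 1)⁻¹) U (𝓝 0) :=
    tendsto_inv_atTop_zero.comp (tendsto_atTop_add_const_right _ (-1) hr)
  have t0 : Tendsto (fun p => q p * exp (r p)) U (𝓝 0) := by
    have := t1.mul hi
    rw [mul_zero] at this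
    refine this.congr' ((hr.eventually_ne_atTop 1).mono fun p hp => ?_)
    have : r p - 1 ≠ 0 := sub_ne_zero.2 hp
    field_simp
  have t2 : Tendsto q U (𝓝 0) := by
    have := t0.mul hu
    rw [mul_zero] at this
    refine this.congr fun p => ?_
    rw [Function.comp_apply, mul_assoc, mul_inv_cancel₀ (exp_ne_zero _), mul_one]
  have s2 : Tendsto (fun p => s p * exp (r p)) U (𝓝 ((P z - z) 2)) := by
    simpa using tendsto_coord (h.tendsto_ray hP) 2
  have s1 : Tendsto s U (𝓝 0) := by
    have := s2.mul hu
    rw [mul_zero] at this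
    refine this.congr fun p => ?_
    rw [Function.comp_apply, mul_assoc, mul_inv_cancel₀ (exp_ne_zero _), mul_one]
  have s0 : Tendsto (fun p => s p * r p) U (𝓝 0) := by
    have := s2.mul (tendsto_mul_inv_exp.comp hr)
    rw [mul_zero] at this
    refine this.congr fun p => ?_
    have := exp_ne_zero (r p)
    simp only [Function.comp_apply]
    field_simp
  have p2 : P z 2 = 0 := tendsto_nhds_unique (h.tendsto_q hP) t2
  have p1 : P z 1 - z 1 = 0 := tendsto_nhds_unique (h.tendsto_s hP) s1
  have z0 : z 0 = 0 := by
    have := t0.neg.sub s0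
    rw [neg_zero, sub_zero] at this
    exact tendsto_nhds_unique ((tendsto_coord h.point 0).congr' h.coord_zero) this
  refine ⟨z0, ?_, ?_⟩
  · rwa [← sub_eq_zero.1 p1]
  · have e : -z 2 = (P z - z) 2 := by rw [PiLp.sub_apply, p2, zero_sub]
    rwa [e]

/-- Limits of Jacobians when the slope of the ray tends to `+∞`. -/
lemma tendsto_fderiv_atTop (h : CurvedApproach P z d U r q s) (hP : IsProjOn dualExp P)
    (hz : z ≠ 0) (hr : Tendsto r U atTop) {τ : ℝ}
    (hτ : Tendsto (fun p => tangEig (r p) (q p) (s p) * d 0) U (𝓝 τ)) :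
    Tendsto (fun p => fderiv ℝ P (z + p.1 • p.2) p.2) U (𝓝 !₂[τ, d 1, 0]) := by
  have hd : d = d 1 • !₂[0, 1, 0] + d 2 • !₂[0, 0, 1] + (-d 0) • !₂[-1, 0, 0] := by
    apply ext3 <;> simp
  have h1 := h.tendsto_fderiv hP hz (tendsto_normal_dir_atTop hr) (tendsto_ray_dir_atTop hr)
    (tendsto_cross_dir_atTop hr) hd (τ := -τ) (by simpa using hτ.neg)
  have e : d 1 • (!₂[0, 1, 0] : E3) + (-τ) • !₂[-1, 0, 0] = !₂[τ, d 1, 0] := by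
    apply ext3 <;> simp
  rwa [e] at h1

lemma outcome_atTop [U.NeBot] (h : CurvedApproach P z d U r q s) (hP : IsProjOn dualExp P)
    (hz : z ≠ 0) (hr : Tendsto r U atTop) :
    ∃ l, Tendsto (fun p => fderiv ℝ P (z + p.1 • p.2) p.2) U (𝓝 l) ∧ ExpOutcome z d l := by
  obtain ⟨z0, t1, s2⟩ := h.limits_atTop hP hr
  have hr1 : ∀ᶠ p in U, 1 < r p := hr.eventually_gt_atTop 1
  have hd0 : d 0 ≤ 0 := by
    refine (h.dirNonpos (i := 0) ?_).2 z0
    filter_upwards [h.coord_zero, h.q_nonneg, h.s_nonneg, hr1] with p h1 h2 h3 h4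
    rw [h1]
    have := mul_nonneg h2 (exp_pos (r p)).le
    have := mul_nonneg h3 (zero_le_one.trans h4.le)
    linarith
  have hδ0 : ∀ᶠ p in U, p.1 * p.2 0 = -(q p * exp (r p)) - s p * r p := by
    filter_upwards [h.coord_zero] with p hp
    simpa [z0] using hp
  have z1' : 0 ≤ z 1 := by
    refine ge_of_tendsto t1 ?_
    filter_upwards [h.q_nonneg, hr1] with p h1 h2
    exact mul_nonneg (mul_nonneg h1 (sub_nonneg.2 h2.le)) (exp_pos _).le
  have z2' : z 2 ≤ 0 := by
    have : 0 ≤ -z 2 := by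
      refine ge_of_tendsto s2 ?_
      filter_upwards [h.s_nonneg] with p h1
      exact mul_nonneg h1 (exp_pos _).le
    linarith
  rcases z1'.lt_or_eq with z1 | z1
  · have hq : ∀ᶠ p in U, 0 < q p := by
      filter_upwards [t1.eventually_const_lt z1, hr1] with p h1 h2
      rw [mul_assoc] at h1
      exact (pos_iff_pos_of_mul_pos h1).2 (mul_pos (sub_pos.2 h2) (exp_pos _))
    have hθ : Tendsto (fun p => tangEig (r p) (q p) (s p)) U (𝓝 1) := by
      refine h.tangEig_one hq (f := fun p => s p * exp (r p) / (q p * (r p - 1) * exp (r p)) *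
        (normalSq (r p) * (r p - 1) / (exp (r p) * raySq (r p)))) ?_ ?_
      · filter_upwards [hq, hr1] with p h1 h2
        have := exp_ne_zero (r p)
        have := (raySq_pos (r p)).ne'
        have := (sub_pos.2 h2).ne'
        rw [tangNum]
        apply le_of_eq
        field_simp
      · have := (s2.div t1 z1.ne').mul (tendsto_normalSq_div_raySq_atTop.comp hr)
        rwa [mul_zero] at this
    refine ⟨_, h.tendsto_fderiv_atTop hP hz hr (τ := d 0) (by simpa using hθ.mul_const (d 0)),
      .top_pos z0 z1 hd0 ⟨z2', fun z2 => ?_⟩⟩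
    have h1 : Tendsto (fun p : ℝ × E3 => -p.2 0 * (exp (r p))⁻¹) U (𝓝 0) := by
      simpa using (tendsto_coord h.dir 0).neg.mul (tendsto_inv_exp.comp hr)
    refine le_of_tendsto_of_tendsto (tendsto_coord h.dir 2) h1 ?_
    filter_upwards [hδ0, h.coord_two, h.s_nonneg, hr1, h.pos] with p h1 h2 h3 h4 h5
    simp only [PiLp.add_apply, PiLp.smul_apply, smul_eq_mul, z2, zero_add] at h2
    have h6 := mul_nonneg h3 (exp_pos (r p)).le
    have h7 := mul_nonneg h3 (zero_le_one.trans h4.le)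
    rw [← div_eq_mul_inv, le_div_iff₀ (exp_pos _)]
    refine le_of_mul_le_mul_left ?_ h5
    have h8 := mul_nonneg h6 (exp_pos (r p)).le
    calc p.1 * (p.2 2 * exp (r p)) = (q p - s p * exp (r p)) * exp (r p) := by rw [← h2]; ring
      _ ≤ p.1 * -p.2 0 := by linarith
  · have z1 : z 1 = 0 := z1.symm
    have z2 : z 2 < 0 := lt_of_le_of_ne z2' fun h' => hz (ext3 z0 z1 h')
    have hδ1 : ∀ᶠ p in U, p.1 * p.2 1 = q p * ((r p - 1) * exp (r p)) - s p := by
      filter_upwards [h.coord_one] with p hp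
      simpa [z1] using hp
    have hd1 : 0 ≤ d 1 := by
      have h1 : Tendsto (fun p : ℝ × E3 => p.2 0 * (r p)⁻¹) U (𝓝 0) := by
        simpa using (tendsto_coord h.dir 0).mul (tendsto_inv_atTop_zero.comp hr)
      refine le_of_tendsto_of_tendsto h1 (tendsto_coord h.dir 1) ?_
      filter_upwards [hδ0, hδ1, h.q_nonneg, hr1, h.pos] with p h1 h2 h3 h4 h5
      have hr0 : 0 < r p := zero_lt_one.trans h4
      have h6 := mul_nonneg h3 (exp_pos (r p)).le
      have h7 := mul_nonneg h3 (mul_nonneg (sub_nonneg.2 h4.le) (exp_pos (r p)).le)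
      rw [← div_eq_mul_inv, div_le_iff₀ hr0]
      refine le_of_mul_le_mul_left ?_ h5
      have h8 := mul_nonneg h7 hr0.le
      calc p.1 * p.2 0 ≤ (q p * ((r p - 1) * exp (r p)) - s p) * r p := by linarith
        _ = p.1 * (p.2 1 * r p) := by rw [← h2]; ring
    have hs : ∀ᶠ p in U, 0 < s p := by
      filter_upwards [s2.eventually_const_lt (neg_pos.2 z2)] with p h1
      exact (pos_iff_pos_of_mul_pos h1).2 (exp_pos _)
    have hτ : Tendsto (fun p => tangEig (r p) (q p) (s p) * d 0) U (𝓝 0) := by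
      rcases hd0.eq_or_lt with d0 | d0
      · simp [d0]
      -- `C` bounds the ratio of the two small coordinates of the approaching point
      obtain ⟨C, hC0, hC⟩ : ∃ C : ℝ, 0 ≤ C ∧ d 1 < C * -d 0 := by
        refine ⟨(d 1 + 1) / -d 0, div_nonneg (by linarith) (by linarith), ?_⟩
        rw [div_mul_cancel₀ _ (by linarith)]
        linarith
      have hCe : ∀ᶠ p in U, p.2 1 < C * -p.2 0 :=
        (tendsto_coord h.dir 1).eventually_lt ((tendsto_coord h.dir 0).neg.const_mul C) hC
      have hlim : Tendsto (fun p => (C * r p + 1) / (r p - 1 - C)) U (𝓝 C) := by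
        have h1 : Tendsto (fun p => C + (C + C * C + 1) * (r p - 1 - C)⁻¹) U (𝓝 C) := by
          have := (tendsto_inv_atTop_zero.comp
            (tendsto_atTop_add_const_right _ (-1 - C) hr)).const_mul (C + C * C + 1)
          simpa [← add_sub_assoc, ← sub_eq_add_neg] using this.const_add C
        refine h1.congr' ((hr.eventually_gt_atTop (1 + C)).mono fun p hp => ?_)
        have : r p - 1 - C ≠ 0 := by linarith
        field_simp
        ring
      have hθ : Tendsto (fun p => tangEig (r p) (q p) (s p)) U (𝓝 0) := by
        refine h.tangEig_zero hs (f := fun p =>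
          (C * r p + 1) / (r p - 1 - C) * (raySq (r p) / normalSq (r p))) ?_ ?_
        · filter_upwards [hs, hδ0, hδ1, hCe, h.pos, hr.eventually_gt_atTop (1 + C)]
            with p h1 h2 h3 h4 h5 h6
          have h7 : 0 < r p - 1 - C := by linarith
          have h8 : q p * exp (r p) / s p ≤ (C * r p + 1) / (r p - 1 - C) := by
            rw [div_le_div_iff₀ h1 h7]
            have := mul_lt_mul_of_pos_left h4 h5
            have e : p.1 * (C * -p.2 0) = C * (q p * exp (r p) + s p * r p) := by
              rw [show q p * exp (r p) + s p * r p = -(p.1 * p.2 0) by rw [h2]; ring]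
              ring
            rw [h3, e] at this
            linarith
          calc tangNum (r p) (q p) / (s p * normalSq (r p))
              = q p * exp (r p) / s p * (raySq (r p) / normalSq (r p)) := by
                rw [tangNum, div_mul_div_comm]
            _ ≤ _ := mul_le_mul_of_nonneg_right h8
                (div_nonneg (raySq_pos _).le (normalSq_pos _).le)
        · simpa using hlim.mul (tendsto_raySq_div_normalSq.comp hr)
      simpa using hθ.mul_const (d 0)
    exact ⟨_, h.tendsto_fderiv_atTop hP hz hr hτ, .top_zero z0 z1 z2 hd0 hd1⟩

/-- Coordinates of the approached point when the slope of the ray tends to `-∞`. -/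
lemma limits_atBot [U.NeBot] (h : CurvedApproach P z d U r q s) (hP : IsProjOn dualExp P)
    (hr : Tendsto r U atBot) :
    z 1 = 0 ∧ Tendsto (fun p => s p * r p) U (𝓝 (-z 0)) ∧ Tendsto q U (𝓝 (z 2)) := by
  have he := tendsto_exp_atBot.comp hr
  have t2 := h.tendsto_q hP
  have t0 : Tendsto (fun p => q p * exp (r p)) U (𝓝 0) := by
    simpa using t2.mul he
  have t1 : Tendsto (fun p => q p * ((r p - 1) * exp (r p))) U (𝓝 0) := by
    have := (t2.mul (tendsto_mul_exp_atBot.comp hr)).sub t0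
    rw [mul_zero, sub_zero] at this
    refine this.congr fun p => ?_
    simp only [Function.comp_apply]
    ring
  have s0 : Tendsto (fun p => s p * r p) U (𝓝 ((P z - z) 0)) := by
    simpa using tendsto_coord (h.tendsto_ray hP) 0
  have s1 : Tendsto s U (𝓝 0) := by
    have := s0.mul (tendsto_inv_atBot_zero.comp hr)
    rw [mul_zero] at this
    refine this.congr' ((hr.eventually_ne_atBot 0).mono fun p hp => ?_)
    simp only [Function.comp_apply]
    field_simp
  have s2 : Tendsto (fun p => s p * exp (r p)) U (𝓝 0) := by
    simpa using s1.mul he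
  have z1 : z 1 = 0 := by
    have := t1.sub s1
    rw [sub_zero] at this
    exact tendsto_nhds_unique ((tendsto_coord h.point 1).congr' h.coord_one) this
  have p0 : P z 0 = 0 := by
    refine tendsto_nhds_unique (tendsto_coord (h.tendsto_normal hP) 0) ?_
    simpa using t0.neg
  have z2 : z 2 = P z 2 := by
    have := t2.sub s2
    rw [sub_zero] at this
    exact tendsto_nhds_unique ((tendsto_coord h.point 2).congr' h.coord_two) this
  refine ⟨z1, ?_, ?_⟩
  · have e : -z 0 = (P z - z) 0 := by rw [PiLp.sub_apply, p0, zero_sub]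
    rwa [e]
  · rwa [z2]

/-- Limits of Jacobians when the slope of the ray tends to `-∞`. -/
lemma tendsto_fderiv_atBot (h : CurvedApproach P z d U r q s) (hP : IsProjOn dualExp P)
    (hz : z ≠ 0) (hr : Tendsto r U atBot) {τ : ℝ}
    (hτ : Tendsto (fun p => tangEig (r p) (q p) (s p) * d 1) U (𝓝 τ)) :
    Tendsto (fun p => fderiv ℝ P (z + p.1 • p.2) p.2) U (𝓝 !₂[0, τ, d 2]) := by
  have hd : d = d 2 • !₂[0, 0, 1] + (-d 0) • !₂[-1, 0, 0] + d 1 • !₂[0, 1, 0] := by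
    apply ext3 <;> simp
  have h1 := h.tendsto_fderiv hP hz (x₁ := fun _ => 1)
    (by simpa using tendsto_normal_dir_atBot hr) (tendsto_ray_dir_atBot hr)
    (tendsto_cross_dir_atBot hr) hd hτ
  have e : d 2 • (!₂[0, 0, 1] : E3) + τ • !₂[0, 1, 0] = !₂[0, τ, d 2] := by
    apply ext3 <;> simp
  rwa [e] at h1

lemma outcome_atBot [U.NeBot] (h : CurvedApproach P z d U r q s) (hP : IsProjOn dualExp P)
    (hz : z ≠ 0) (hr : Tendsto r U atBot) :
    ∃ l, Tendsto (fun p => fderiv ℝ P (z + p.1 • p.2) p.2) U (𝓝 l) ∧ ExpOutcome z d l := by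
  obtain ⟨z1, s0, t2⟩ := h.limits_atBot hP hr
  have hr0 : ∀ᶠ p in U, r p < 0 := hr.eventually_lt_atBot 0
  have hd1 : d 1 ≤ 0 := by
    refine (h.dirNonpos (i := 1) ?_).2 z1
    filter_upwards [h.coord_one, h.q_nonneg, h.s_nonneg, hr0] with p h1 h2 h3 h4
    rw [h1]
    have := mul_nonneg h2 (mul_nonneg (by linarith : 0 ≤ 1 - r p) (exp_pos (r p)).le)
    linarith
  have hδ1 : ∀ᶠ p in U, p.1 * p.2 1 = q p * ((r p - 1) * exp (r p)) - s p := by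
    filter_upwards [h.coord_one] with p hp
    simpa [z1] using hp
  have z2' : 0 ≤ z 2 := ge_of_tendsto t2 h.q_nonneg
  have z0' : 0 ≤ z 0 := by
    have : -z 0 ≤ 0 := by
      refine le_of_tendsto s0 ?_
      filter_upwards [h.s_nonneg, hr0] with p h1 h2
      exact mul_nonpos_of_nonneg_of_nonpos h1 h2.le
    linarith
  rcases z0'.lt_or_eq with z0 | z0
  · have hs : ∀ᶠ p in U, 0 < s p := by
      filter_upwards [s0.eventually_lt_const (neg_neg_of_pos z0), hr0] with p h1 h2
      exact pos_of_mul_neg_left h1 h2.le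
    have hθ : Tendsto (fun p => tangEig (r p) (q p) (s p)) U (𝓝 0) := by
      refine h.tangEig_zero hs (f := fun p => q p * (r p * (exp (r p) * raySq (r p))) /
        (s p * r p * normalSq (r p))) ?_ ?_
      · filter_upwards [hs, hr0] with p h1 h2
        have := (normalSq_pos (r p)).ne'
        rw [tangNum]
        apply le_of_eq
        have := h2.ne
        field_simp
      · have := (t2.mul (tendsto_exp_mul_raySq_atBot.comp hr)).div
          (s0.mul (tendsto_normalSq_atBot.comp hr)) (by simpa using z0.ne')
        rwa [mul_zero, zero_div] at this
    refine ⟨_, h.tendsto_fderiv_atBot hP hz hr (τ := 0) (by simpa using hθ.mul_const (d 1)),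
      .bot_pos z1 z0 hd1 ⟨z2', fun z2 => ?_⟩⟩
    have h1 : Tendsto (fun p : ℝ × E3 => p.2 1 * exp (r p)) U (𝓝 0) := by
      simpa using (tendsto_coord h.dir 1).mul (tendsto_exp_atBot.comp hr)
    refine le_of_tendsto_of_tendsto h1 (tendsto_coord h.dir 2) ?_
    filter_upwards [hδ1, h.coord_two, h.q_nonneg, hr0, h.pos] with p h1 h2 h3 h4 h5
    simp only [PiLp.add_apply, PiLp.smul_apply, smul_eq_mul, z2, zero_add] at h2
    refine le_of_mul_le_mul_left ?_ h5
    have h6 := mul_nonneg h3 (mul_nonneg (by linarith : 0 ≤ 1 - r p) (exp_pos (r p)).le)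
    have h7 := mul_nonneg h6 (exp_pos (r p)).le
    rw [h2, ← mul_assoc, h1]
    linarith
  · have z0 : z 0 = 0 := z0.symm
    have z2 : 0 < z 2 := lt_of_le_of_ne z2' fun h' => hz (ext3 z0 z1 h'.symm)
    have hδ0 : ∀ᶠ p in U, p.1 * p.2 0 = -(q p * exp (r p)) - s p * r p := by
      filter_upwards [h.coord_zero] with p hp
      simpa [z0] using hp
    have hd0 : 0 ≤ d 0 := by
      have h1 : Tendsto (fun p : ℝ × E3 => p.2 1 * (-r p)⁻¹) U (𝓝 0) := by
        simpa using (tendsto_coord h.dir 1).mul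
          (tendsto_inv_atTop_zero.comp (tendsto_neg_atBot_atTop.comp hr))
      refine le_of_tendsto_of_tendsto h1 (tendsto_coord h.dir 0) ?_
      filter_upwards [hδ0, hδ1, h.q_nonneg, hr0, h.pos, h.s_nonneg] with p h1 h2 h3 h4 h5 hs0
      have h6 := mul_nonneg h3 (exp_pos (r p)).le
      rw [← div_eq_mul_inv, div_le_iff₀ (neg_pos.2 h4)]
      refine le_of_mul_le_mul_left ?_ h5
      rw [← mul_assoc, h1, h2]
      have h7 := mul_nonneg hs0 (sq_nonneg (r p))
      linarith
    have hq : ∀ᶠ p in U, 0 < q p := t2.eventually_const_lt z2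
    have hτ : Tendsto (fun p => tangEig (r p) (q p) (s p) * d 1) U (𝓝 (d 1)) := by
      rcases hd1.eq_or_lt with d1 | d1
      · simp [d1]
      -- `C` bounds the ratio of the two small coordinates of the approaching point
      obtain ⟨C, hC0, hC⟩ : ∃ C : ℝ, 0 ≤ C ∧ d 0 < C * -d 1 := by
        refine ⟨(d 0 + 1) / -d 1, div_nonneg (by linarith) (by linarith), ?_⟩
        rw [div_mul_cancel₀ _ (by linarith)]
        linarith
      have hCe : ∀ᶠ p in U, p.2 0 < C * -p.2 1 :=
        (tendsto_coord h.dir 0).eventually_lt ((tendsto_coord h.dir 1).neg.const_mul C) hC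
      have hlim : Tendsto (fun p => (1 + C * (1 - r p)) / (-r p - C)) U (𝓝 C) := by
        have h1 : Tendsto (fun p => C + (C + C * C + 1) * (-r p - C)⁻¹) U (𝓝 C) := by
          have := (tendsto_inv_atTop_zero.comp (tendsto_atTop_add_const_right _ (-C)
            (tendsto_neg_atBot_atTop.comp hr))).const_mul (C + C * C + 1)
          simpa [← sub_eq_add_neg] using this.const_add C
        refine h1.congr' ((hr.eventually_lt_atBot (-C)).mono fun p hp => ?_)
        have : -r p - C ≠ 0 := by linarith
        field_simp
        ring
      have hθ : Tendsto (fun p => tangEig (r p) (q p) (s p)) U (𝓝 1) := by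
        refine h.tangEig_one hq (f := fun p =>
          (1 + C * (1 - r p)) / (-r p - C) * (normalSq (r p) / raySq (r p))) ?_ ?_
        · filter_upwards [hq, hδ0, hδ1, hCe, h.pos, hr.eventually_lt_atBot (-C)]
            with p h1 h2 h3 h4 h5 h6
          have h7 : 0 < -r p - C := by linarith
          have h8 : s p / (q p * exp (r p)) ≤ (1 + C * (1 - r p)) / (-r p - C) := by
            rw [div_le_div_iff₀ (mul_pos h1 (exp_pos _)) h7]
            have := mul_lt_mul_of_pos_left h4 h5
            have e : p.1 * (C * -p.2 1) = C * (s p - q p * ((r p - 1) * exp (r p))) := by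
              rw [show s p - q p * ((r p - 1) * exp (r p)) = -(p.1 * p.2 1) by rw [h3]; ring]
              ring
            rw [h2, e] at this
            linarith
          calc s p * normalSq (r p) / tangNum (r p) (q p)
              = s p / (q p * exp (r p)) * (normalSq (r p) / raySq (r p)) := by
                rw [tangNum, div_mul_div_comm]
            _ ≤ _ := mul_le_mul_of_nonneg_right h8
                (div_nonneg (normalSq_pos _).le (raySq_pos _).le)
        · simpa using hlim.mul (tendsto_normalSq_div_raySq_atBot.comp hr)
      simpa using hθ.mul_const (d 1)
    exact ⟨_, h.tendsto_fderiv_atBot hP hz hr hτ, .bot_zero z1 z0 z2 hd1 hd0⟩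

end CurvedApproach

end CurvedInfinite

end NewtonADMM

/-! ### Uniqueness of the limit -/

namespace NewtonADMM

section ExpUnique

variable {P : E3 → E3} {z d : E3}

/-- The directional derivative of the projection at a nonzero point whose coordinates `0` and `1`
are nonnegative. -/
noncomputable def quadrantDir (z d : E3) : E3 :=
  !₂[if z 0 = 0 ∧ (0 < z 1 ∨ 0 < z 2) then min (d 0) 0 else 0,
    if z 1 = 0 ∧ (0 < z 0 ∨ z 2 < 0) then max (d 1) 0 else d 1,
    if 0 < z 2 then d 2 else if z 2 < 0 then 0 else max (d 2) 0]

lemma eq_zero_of_curved {ρ Q S : ℝ} (hQ : 0 ≤ Q) (hS : 0 ≤ S)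
    (hz : z = Q • expNormal ρ - S • expRay ρ) (h0 : 0 ≤ z 0) (h1 : 0 ≤ z 1) : z = 0 := by
  have he := Real.exp_pos ρ
  have e0 : z 0 = -(Q * Real.exp ρ) - S * ρ := by rw [hz]; simp
  have e1 : z 1 = Q * ((ρ - 1) * Real.exp ρ) - S := by rw [hz]; simp
  rw [e0] at h0
  rw [e1] at h1
  have hQe := mul_nonneg hQ he.le
  have hS0 : S = 0 := by
    rcases le_total 1 ρ with h | h
    · have := mul_nonneg hS (zero_le_one.trans h)
      have h2 : Q * Real.exp ρ = 0 := by linarith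
      have h3 : Q * ((ρ - 1) * Real.exp ρ) = (ρ - 1) * (Q * Real.exp ρ) := by ring
      rw [h3, h2] at h1
      linarith
    · have := mul_nonneg hQe (sub_nonneg.2 h)
      linarith
  have hQ0 : Q = 0 := by
    rw [hS0] at h0
    have : Q * Real.exp ρ = 0 := by linarith
    exact (mul_eq_zero.1 this).resolve_right he.ne'
  rw [hz, hQ0, hS0]
  simp

lemma ExpOutcome.eq_quadrantDir {l : E3} (h : ExpOutcome z d l) (hz : z ≠ 0) (h0 : 0 ≤ z 0)
    (h1 : 0 ≤ z 1) : l = quadrantDir z d := by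
  have hne : ¬(z 0 = 0 ∧ z 1 = 0 ∧ z 2 = 0) := fun h => hz (ext3 h.1 h.2.1 h.2.2)
  cases h with
  | dual hm k0 k2 _ =>
    have z0 := le_antisymm (dualExp_zero_nonpos hm) h0
    have z2 := dualExp_two_nonneg hm
    obtain ⟨-, k0⟩ := k0
    obtain ⟨-, k2⟩ := k2
    apply ext3 <;> simp [quadrantDir] <;> beta_reduce at * <;> grind
  | polar hm k1 k2 _ =>
    obtain ⟨z1, k1⟩ := k1
    obtain ⟨z2, k2⟩ := k2
    apply ext3 <;> simp [quadrantDir] <;> beta_reduce at * <;> grind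
  | quadrant_pos k0 k1 k2 =>
    obtain ⟨-, k0⟩ := k0
    obtain ⟨-, k1⟩ := k1
    obtain ⟨z2, k2⟩ := k2
    apply ext3 <;> simp [quadrantDir] <;> beta_reduce at * <;> grind
  | quadrant_neg k0 k1 k2 =>
    obtain ⟨-, k0⟩ := k0
    obtain ⟨-, k1⟩ := k1
    obtain ⟨z2, k2⟩ := k2
    apply ext3 <;> simp [quadrantDir] <;> beta_reduce at * <;> grind
  | curved ρ Q S hQ hS he _ _ => exact absurd (eq_zero_of_curved hQ hS he h0 h1) hz
  | top_pos z0 z1 k0 k2 =>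
    obtain ⟨z2, k2⟩ := k2
    apply ext3 <;> simp [quadrantDir] <;> beta_reduce at * <;> grind
  | top_zero z0 z1 z2 k0 k1 => apply ext3 <;> simp [quadrantDir] <;> beta_reduce at * <;> grind
  | bot_pos z1 z0 k1 k2 =>
    obtain ⟨z2, k2⟩ := k2
    apply ext3 <;> simp [quadrantDir] <;> beta_reduce at * <;> grind
  | bot_zero z1 z0 z2 k1 k0 => apply ext3 <;> simp [quadrantDir] <;> beta_reduce at * <;> grind

/-- The outcomes possible away from the quadrant. -/
inductive CurvedOutcome (z d : E3) : E3 → Prop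
  | dual (hz : z ∈ dualExp)
      (hray : ∀ r, inner ℝ (expRay r) z = 0 → 0 ≤ inner ℝ (expRay r) d) : CurvedOutcome z d d
  | polar (hz : -z ∈ expCone)
      (hnormal : ∀ r, inner ℝ (expNormal r) z = 0 → inner ℝ (expNormal r) d ≤ 0) :
      CurvedOutcome z d 0
  | curved (ρ Q S : ℝ) (hQ : 0 ≤ Q) (hS : 0 ≤ S) (hz : z = Q • expNormal ρ - S • expRay ρ)
      (hS0 : S = 0 → inner ℝ (expRay ρ) d ≤ 0) (hQ0 : Q = 0 → 0 ≤ inner ℝ (expNormal ρ) d) :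
      CurvedOutcome z d (curvedDir ρ Q S d)

lemma ExpOutcome.curvedOutcome {l : E3} (h : ExpOutcome z d l) (hn : ¬(0 ≤ z 0 ∧ 0 ≤ z 1)) :
    CurvedOutcome z d l := by
  cases h with
  | dual hm _ _ h => exact .dual hm h
  | polar hm _ _ h => exact .polar hm h
  | quadrant_pos k0 k1 _ => exact absurd ⟨k0.1, k1.1⟩ hn
  | quadrant_neg k0 k1 _ => exact absurd ⟨k0.1, k1.1⟩ hn
  | curved ρ Q S hQ hS he hS0 hQ0 => exact .curved ρ Q S hQ hS he hS0 hQ0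
  | top_pos z0 z1 _ _ => exact absurd ⟨z0.ge, z1.le⟩ hn
  | top_zero z0 z1 _ _ _ => exact absurd ⟨z0.ge, z1.ge⟩ hn
  | bot_pos z1 z0 _ _ => exact absurd ⟨z0.le, z1.ge⟩ hn
  | bot_zero z1 z0 _ _ _ => exact absurd ⟨z0.ge, z1.ge⟩ hn

lemma eq_zero_of_mem_of_neg_mem (hP : IsProjOn dualExp P) (h1 : z ∈ dualExp)
    (h2 : -z ∈ expCone) : z = 0 :=
  (expProj_of_mem hP h1).symm.trans (expProj_of_neg_mem hP h2)

lemma curvedDir_eq_of_mem (hP : IsProjOn dualExp P) (hz : z ≠ 0) (hm : z ∈ dualExp)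
    (hray : ∀ r, inner ℝ (expRay r) z = 0 → 0 ≤ inner ℝ (expRay r) d) {ρ Q S : ℝ} (hQ : 0 ≤ Q)
    (hS : 0 ≤ S) (he : z = Q • expNormal ρ - S • expRay ρ)
    (hS0 : S = 0 → inner ℝ (expRay ρ) d ≤ 0) : curvedDir ρ Q S d = d := by
  have h1 : Q • expNormal ρ = z := by
    rw [← expProj_curved hP hQ hS ρ, ← he, expProj_of_mem hP hm]
  have hS' : S = 0 := by
    have h2 : S • expRay ρ = 0 := by
      rw [← sub_sub_cancel (Q • expNormal ρ) (S • expRay ρ), ← he, h1, sub_self]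
    simpa using congrArg (fun x : E3 => x 1) h2
  have hQ' : Q ≠ 0 := by
    rintro rfl
    simp at h1
    exact hz h1.symm
  have hγ : inner ℝ (expRay ρ) d = 0 := by
    refine le_antisymm (hS0 hS') (hray ρ ?_)
    rw [← h1, inner_smul_right, inner_expRay_expNormal, mul_zero]
  have hθ : tangEig ρ Q S = 1 := by
    rw [hS', tangEig, zero_mul, add_zero]
    exact div_self (mul_ne_zero (mul_ne_zero hQ' (Real.exp_ne_zero _)) (raySq_pos ρ).ne')
  conv_rhs => rw [exp_decomposition ρ d]
  rw [curvedDir, hγ, hθ]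
  simp

lemma curvedDir_eq_of_neg_mem (hP : IsProjOn dualExp P) (hm : -z ∈ expCone)
    (hnormal : ∀ r, inner ℝ (expNormal r) z = 0 → inner ℝ (expNormal r) d ≤ 0) {ρ Q S : ℝ}
    (hQ : 0 ≤ Q) (hS : 0 ≤ S) (he : z = Q • expNormal ρ - S • expRay ρ)
    (hQ0 : Q = 0 → 0 ≤ inner ℝ (expNormal ρ) d) : curvedDir ρ Q S d = 0 := by
  have h1 : Q • expNormal ρ = 0 := by
    rw [← expProj_curved hP hQ hS ρ, ← he, expProj_of_neg_mem hP hm]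
  have hQ' : Q = 0 := by simpa using congrArg (fun x : E3 => x 2) h1
  have hμ : inner ℝ (expNormal ρ) d = 0 := by
    refine le_antisymm (hnormal ρ ?_) (hQ0 hQ')
    rw [he, h1, zero_sub, inner_neg_right, inner_smul_right, real_inner_comm,
      inner_expRay_expNormal, mul_zero, neg_zero]
  have hθ : tangEig ρ Q S = 0 := by
    rw [hQ', tangEig, tangNum, zero_mul, zero_mul, zero_div]
  rw [curvedDir, hμ, hθ]
  simp

lemma curved_params_unique (hP : IsProjOn dualExp P) (hz : z ≠ 0) {ρ Q S ρ' Q' S' : ℝ}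
    (hQ : 0 ≤ Q) (hS : 0 ≤ S) (he : z = Q • expNormal ρ - S • expRay ρ) (hQ' : 0 ≤ Q')
    (hS' : 0 ≤ S') (he' : z = Q' • expNormal ρ' - S' • expRay ρ') :
    ρ = ρ' ∧ Q = Q' ∧ S = S' := by
  have h1 : Q • expNormal ρ = Q' • expNormal ρ' := by
    rw [← expProj_curved hP hQ hS ρ, ← he, he', expProj_curved hP hQ' hS']
  have h2 : S • expRay ρ = S' • expRay ρ' := by
    rw [← sub_sub_cancel (Q • expNormal ρ) (S • expRay ρ), ← he, he', h1, sub_sub_cancel]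
  have eQ : Q = Q' := by simpa using congrArg (fun x : E3 => x 2) h1
  have eS : S = S' := by simpa using congrArg (fun x : E3 => x 1) h2
  refine ⟨?_, eQ, eS⟩
  subst eQ eS
  by_cases hS0 : S = 0
  · have hQ0 : Q ≠ 0 := by
      rintro rfl
      rw [hS0] at he
      simp at he
      exact hz he
    have h3 : Q * Real.exp ρ = Q * Real.exp ρ' := by
      simpa only [PiLp.smul_apply, expNormal_zero, smul_eq_mul, mul_neg, neg_inj]
        using congrArg (fun x : E3 => x 0) h1
    exact Real.exp_injective (mul_left_cancel₀ hQ0 h3)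
  · have h3 : S * ρ = S * ρ' := by
      simpa only [PiLp.smul_apply, expRay_zero, smul_eq_mul]
        using congrArg (fun x : E3 => x 0) h2
    exact mul_left_cancel₀ hS0 h3

lemma ExpOutcome.unique (hP : IsProjOn dualExp P) (hz : z ≠ 0) {l l' : E3}
    (h : ExpOutcome z d l) (h' : ExpOutcome z d l') : l = l' := by
  by_cases hn : 0 ≤ z 0 ∧ 0 ≤ z 1
  · rw [h.eq_quadrantDir hz hn.1 hn.2, h'.eq_quadrantDir hz hn.1 hn.2]
  cases h.curvedOutcome hn with
  | dual hm k =>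
    cases h'.curvedOutcome hn with
    | dual _ _ => rfl
    | polar hm' _ => exact absurd (eq_zero_of_mem_of_neg_mem hP hm hm') hz
    | curved ρ Q S hQ hS he hS0 _ => exact (curvedDir_eq_of_mem hP hz hm k hQ hS he hS0).symm
  | polar hm k =>
    cases h'.curvedOutcome hn with
    | dual hm' _ => exact absurd (eq_zero_of_mem_of_neg_mem hP hm' hm) hz
    | polar _ _ => rfl
    | curved ρ Q S hQ hS he _ hQ0 => exact (curvedDir_eq_of_neg_mem hP hm k hQ hS he hQ0).symm
  | curved ρ Q S hQ hS he hS0 hQ0 =>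
    cases h'.curvedOutcome hn with
    | dual hm k => exact curvedDir_eq_of_mem hP hz hm k hQ hS he hS0
    | polar hm k => exact curvedDir_eq_of_neg_mem hP hm k hQ hS he hQ0
    | curved ρ' Q' S' hQ' hS' he' _ _ =>
      obtain ⟨rfl, rfl, rfl⟩ := curved_params_unique hP hz hQ hS he hQ' hS' he'
      rfl

end ExpUnique

section ExpLimit

variable {P : E3 → E3} {z d : E3}

/-- Along an ultrafilter the approach stays in one region, and in the curved region the slope of the
ray converges in the extended line. -/
lemma exists_expOutcome (hP : IsProjOn dualExp P) (hz : z ≠ 0) {U : Ultrafilter (ℝ × E3)}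
    (h : Approach P z d U) :
    ∃ l, Tendsto (fun p : ℝ × E3 => fderiv ℝ P (z + p.1 • p.2) p.2) U (𝓝 l) ∧ ExpOutcome z d l := by
  have hreg := Eventually.of_forall (f := (U : Filter (ℝ × E3)))
    fun p : ℝ × E3 => exp_regions hP (z + p.1 • p.2)
  rw [Ultrafilter.eventually_or, Ultrafilter.eventually_or, Ultrafilter.eventually_or] at hreg
  rcases hreg with hreg | hreg | hreg | hreg
  · refine ⟨d, h.dir.congr' ?_, .dual ?_ (h.dirNonpos ?_) (h.dirNonneg ?_) fun r hr =>
      h.inner_nonneg ?_ hr⟩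
    · filter_upwards [hreg, h.diff] with p h1 h2
      rw [fderiv_exp_of_mem hP h2 h1]
    · exact isClosed_dualExp.mem_of_tendsto h.point hreg
    · exact hreg.mono fun p hp => dualExp_zero_nonpos hp
    · exact hreg.mono fun p hp => dualExp_two_nonneg hp
    · exact hreg.mono fun p hp => inner_expRay_nonneg hp r
  · refine ⟨0, tendsto_const_nhds.congr' ?_, .polar ?_ (h.dirNonpos ?_) (h.dirNonpos ?_)
      fun r hr => h.inner_nonpos ?_ hr⟩
    · filter_upwards [hreg, h.diff] with p h1 h2
      rw [fderiv_exp_of_neg_mem hP h2 h1]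
    · exact isClosed_expCone.mem_of_tendsto h.point.neg hreg
    · exact hreg.mono fun p hp => neg_nonneg.1 (expCone_one_nonneg hp)
    · exact hreg.mono fun p hp => neg_nonneg.1 (expCone_two_nonneg hp)
    · refine hreg.mono fun p hp => ?_
      have := inner_expNormal_nonneg hp r
      rw [inner_neg_right] at this
      linarith
  · have k0 := h.dirNonneg (hreg.mono fun p hp => hp.1)
    have k1 := h.dirNonneg (hreg.mono fun p hp => hp.2)
    have hsign := Eventually.of_forall (f := (U : Filter (ℝ × E3)))
      fun p : ℝ × E3 => le_total 0 ((z + p.1 • p.2) 2)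
    rw [Ultrafilter.eventually_or] at hsign
    rcases hsign with hs | hs
    · refine ⟨!₂[0, d 1, d 2], ?_, .quadrant_pos k0 k1 (h.dirNonneg hs)⟩
      have h1 : Tendsto (fun p : ℝ × E3 => (!₂[0, p.2 1, p.2 2] : E3)) U (𝓝 !₂[0, d 1, d 2]) :=
        tendsto3 tendsto_const_nhds (tendsto_coord h.dir 1) (tendsto_coord h.dir 2)
      refine h1.congr' ?_
      filter_upwards [hreg, hs, h.diff] with p h1 h2 h3
      rw [fderiv_exp_of_nonneg hP h3 h1.1 h1.2 h2]
    · refine ⟨!₂[0, d 1, 0], ?_, .quadrant_neg k0 k1 (h.dirNonpos hs)⟩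
      have h1 : Tendsto (fun p : ℝ × E3 => (!₂[0, p.2 1, 0] : E3)) U (𝓝 !₂[0, d 1, 0]) :=
        tendsto3 tendsto_const_nhds (tendsto_coord h.dir 1) tendsto_const_nhds
      refine h1.congr' ?_
      filter_upwards [hreg, hs, h.diff] with p h1 h2 h3
      rw [fderiv_exp_of_nonneg_nonpos hP h3 h1.1 h1.2 h2]
  · obtain ⟨r, hreg⟩ := Filter.skolem.1 hreg
    obtain ⟨q, hreg⟩ := Filter.skolem.1 hreg
    obtain ⟨s, hreg⟩ := Filter.skolem.1 hreg
    have hc : CurvedApproach P z d U r q s :=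
      { h with
        q_nonneg := hreg.mono fun p hp => hp.1
        s_nonneg := hreg.mono fun p hp => hp.2.1
        eq := hreg.mono fun p hp => hp.2.2 }
    have hr : Tendsto r U atBot ∨ (∃ ρ, Tendsto r U (𝓝 ρ)) ∨ Tendsto r U atTop := by
      obtain ⟨x, -, hx⟩ := isCompact_univ (X := EReal) |>.ultrafilter_le_nhds
        (U.map fun p => (r p : EReal)) (by simp)
      have hx' : Tendsto (fun p => (r p : EReal)) U (𝓝 x) := hx
      induction x with
      | bot => exact .inl (EReal.tendsto_coe_nhds_bot_iff.1 hx')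
      | top => exact .inr (.inr (EReal.tendsto_coe_nhds_top_iff.1 hx'))
      | coe ρ => exact .inr (.inl ⟨ρ, EReal.tendsto_coe.1 hx'⟩)
    rcases hr with hr | ⟨ρ, hr⟩ | hr
    · exact hc.outcome_atBot hP hz hr
    · exact hc.outcome_finite hP hz hr
    · exact hc.outcome_atTop hP hz hr

lemma exists_jacobianLimit_exp_of_ne (hP : IsProjOn dualExp P) (hz : z ≠ 0) (d : E3) :
    ∃ l, JacobianLimit P z d l := by
  set F : Filter (ℝ × E3) :=
    (𝓝[>] 0 ×ˢ 𝓝 d) ⊓ 𝓟 {p | DifferentiableAt ℝ P (z + p.1 • p.2)} with hF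
  have hA : ∀ U : Ultrafilter (ℝ × E3), (U : Filter _) ≤ F → Approach P z d U := fun U hU =>
    { pos := hU (mem_inf_of_left (tendsto_fst.eventually self_mem_nhdsWithin))
      zero := (tendsto_nhdsWithin_iff.1 tendsto_fst).1.mono_left (hU.trans inf_le_left)
      dir := tendsto_snd.mono_left (hU.trans inf_le_left)
      diff := hU (mem_inf_of_right (mem_principal_self _)) }
  rcases F.eq_or_neBot with hbot | hne
  · refine ⟨0, ?_⟩
    rw [JacobianLimit, ← hF, hbot]
    exact tendsto_bot
  obtain ⟨l, -, hl⟩ := exists_expOutcome hP hz (hA _ (Ultrafilter.of_le F))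
  refine ⟨l, (tendsto_iff_ultrafilter _ _ _).2 fun U hU => ?_⟩
  obtain ⟨l', ht, hl'⟩ := exists_expOutcome hP hz (hA U hU)
  rwa [hl.unique hP hz hl']

/-- By homogeneity and Euler's identity the Jacobian at `t d'` maps `d'` to `P d'`. -/
lemma jacobianLimit_exp_zero (hP : IsProjOn dualExp P) (d : E3) :
    JacobianLimit P 0 d (P d) := by
  have hd : Tendsto (fun p : ℝ × E3 => P p.2)
      ((𝓝[>] 0 ×ˢ 𝓝 d) ⊓ 𝓟 {p | DifferentiableAt ℝ P (0 + p.1 • p.2)}) (𝓝 (P d)) :=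
    ((hP.lipschitzWith.continuous.tendsto d).comp tendsto_snd).mono_left inf_le_left
  refine hd.congr' ?_
  have h1 : ∀ᶠ p : ℝ × E3 in 𝓝[>] 0 ×ˢ 𝓝 d, 0 < p.1 :=
    tendsto_fst.eventually self_mem_nhdsWithin
  filter_upwards [mem_inf_of_left h1, mem_inf_of_right (mem_principal_self _)] with p hp hdiff
  have hom : ∀ c : ℝ, 0 < c → ∀ w, P (c • w) = c • P w := fun c hc w =>
    IsProjOn.smul (C := ProperCone.innerDual expCone) hP hc w
  have hp' : 0 < p.1 := hp
  have h2 := fderiv_self_of_homogeneous hom hdiff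
  rw [zero_add, map_smul, hom _ hp'] at h2
  rw [zero_add]
  exact (smul_right_injective E3 hp'.ne' h2).symm

theorem exists_jacobianLimit_exp (hP : IsProjOn dualExp P) (z d : E3) :
    ∃ l, JacobianLimit P z d l := by
  by_cases hz : z = 0
  · subst hz
    exact ⟨_, jacobianLimit_exp_zero hP d⟩
  · exact exists_jacobianLimit_exp_of_ne hP hz d

end ExpLimit

end NewtonADMM

theorem lemma3 :
    (∀ (n m : ℕ) (A : Matrix (Fin m) (Fin n) ℝ) (b : Fin m → ℝ) (c : Fin n → ℝ),
      NewtonADMM.StronglySemismooth (NewtonADMM.admmF (NewtonADMM.orthant m) A b c)) ∧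
    (∀ (n m : ℕ) (A : Matrix (Fin (m + 1)) (Fin n) ℝ) (b : Fin (m + 1) → ℝ) (c : Fin n → ℝ),
      NewtonADMM.StronglySemismooth (NewtonADMM.admmF (NewtonADMM.secondOrderCone m) A b c)) ∧
    (∀ (n d : ℕ) (A : Matrix (Sym2 (Fin d)) (Fin n) ℝ) (b : Sym2 (Fin d) → ℝ) (c : Fin n → ℝ),
      NewtonADMM.StronglySemismooth (NewtonADMM.admmF (NewtonADMM.psdCone d) A b c)) ∧
    (∀ (n d : ℕ) (A : Matrix (Fin d × Fin d) (Fin n) ℝ) (b : Fin d × Fin d → ℝ)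
      (c : Fin n → ℝ),
      NewtonADMM.StronglySemismooth (NewtonADMM.admmF (NewtonADMM.psdConeVec d) A b c)) ∧
    (∀ (n : ℕ) (A : Matrix (Fin 3) (Fin n) ℝ) (b : Fin 3 → ℝ) (c : Fin n → ℝ),
      NewtonADMM.Semismooth (NewtonADMM.admmF NewtonADMM.expCone A b c)) := by
  open NewtonADMM in
  refine ⟨fun n m A b c => ?_, fun n m A b c => ?_, fun n d A b c => ?_, fun n d A b c => ?_,
    fun n A b c => ?_⟩
  · exact stronglySemismooth_admmF isProjOn_orthantProj quadApprox_orthantProj A b c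
  · have he := norm_single_last m
    refine stronglySemismooth_admmF ?_ (quadApprox_lorentzProj he) A b c
    rw [secondOrderCone_eq]
    exact isProjOn_lorentzProj he
  · obtain ⟨P, hP, hQ⟩ := exists_isProjOn_psdCone d
    exact stronglySemismooth_admmF hP hQ A b c
  · obtain ⟨P, hP, hQ⟩ := exists_isProjOn_psdConeVec d
    exact stronglySemismooth_admmF hP hQ A b c
  · obtain ⟨P, hP⟩ := exists_isProjOn (C := dualExp) ⟨_, expNormal_mem 0⟩ isClosed_dualExp
      (ProperCone.innerDual expCone).convex
    exact semismooth_admmF hP (exists_jacobianLimit_exp hP) A b c
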